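/- Let $R>0$, $D=\{z\in\mathbb C:|z|\le R\}$, let $\operatorname{Int}D$ be its interior, let $\mu,\nu\ge 1$ be integers, $0<\alpha<1$, and let $A:D\to\mathbb C$ be $\alpha$-Hölder continuous on $D$. Write $\partial=\frac12(\partial_x-i\partial_y)$, $\bar\partial=\frac12(\partial_x+i\partial_y)$, $d\bar\zeta\wedge d\zeta=2i\,dx\wedge dy$. For integers $l,m,n\ge 1$ define the kernels $$G(z,\zeta,l)=\frac{(-1)^l(\bar\zeta-\bar z)^{l-1}}{2\pi i\,(l-1)!\,(\zeta-z)},\qquad G(z,\zeta,m,n)=\frac{(-1)^m}{2\pi i\,(m-1)!\,(n-1)!}\,C_3(z,\zeta,m,n),$$ where, with the principal branch of the logarithm, $$C_1(a,b,n)=\sum_{l=1}^{n-1}\frac{-b^l}{l}\sum_{j=0}^{n-1-l}\binom{n-1}{j}a^{n-1-l-j}(-b)^j,$$ $$C_2(a,b,l,n)=\sum_{0\le p\le l,\;0\le q\le n-1,\;p\le q}\binom lp\binom{n-1}{q}R^{2p}(-\bar b)^{l-p}(-b)^{n-1-q}a^{q-p},$$ $$C_3(a,b,m,n)=(\bar b-\bar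 a)^{m-1}\Big(C_1(a,b,n)+(a-b)^{n-1}\ln\frac{R^2-a\bar b}{|a-b|^2}\Big)+\sum_{l=1}^{m-1}\binom{m-1}{l}(\bar b-\bar a)^{m-1-l}\Big(-\frac1l(\bar a-\bar b)^l(a-b)^{n-1}+\frac1l C_2(a,b,l,n)\Big).$$ For functions $f_0,\dots,f_{\mu-1},g_0,\dots,g_{\nu-1}$ consider the formula $$u(z)=g_0(z)+\int_D\Big(\sum_{j=1}^{\nu-1}G(z,\zeta,j)g_j(\zeta)+G(z,\zeta,\nu)\overline{f_0(\zeta)}+\sum_{i=1}^{\mu-1}G(z,\zeta,\nu,i)\overline{f_i(\zeta)}+G(z,\zeta,\nu,\mu)A(\zeta)\Big)\,d\bar\zeta\wedge d\zeta.\qquad(*)$$ A solution of $\partial^\mu\bar\partial^\nu u=A$ means a function $u$ that is $C^{\mu+\nu}$ in $\operatorname{Int}D$ and satisfies the equation there. (1) If all $f_i,g_j$ are holomorphic in $\operatorname{Int}D$ and integrable over $D$, then the integrand in $(*)$ is integrable for every $z\in\operatorname{Int}D$. A function $u$ is a solution for which $\bar\partial^j u$ $(0\le j<\nu)$ and $\partial^i\bar\partial^\nu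 u$ $(0\le i<\mu)$ are integrable over $D$ if and only if there are such $f_i,g_j$ with $(*)$ for all $z\in\operatorname{Int}D$. (2) If all $f_i,g_j$ are continuous on $D$ and holomorphic in $\operatorname{Int}D$, then the integrand in $(*)$ is integrable for every $z\in D$. A function $u$ that is continuous on $D$ is a solution for which $\bar\partial^j u$ $(0\le j<\nu)$ and $\partial^i\bar\partial^\nu u$ $(0\le i<\mu)$ extend continuously from $\operatorname{Int}D$ to $D$ (in particular this holds for every solution of class $C^{\mu+\nu}$ on the closed disk) if and only if there are such $f_i,g_j$ with $(*)$ for all $z\in D$. -/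

import Mathlib

open MeasureTheory Metric Complex
open scoped NNReal ComplexConjugate

noncomputable section

/-- The Wirtinger derivative `∂ = (∂_x - i ∂_y) / 2`. -/
def wirtingerD (u : ℂ → ℂ) (z : ℂ) : ℂ :=
  (fderiv ℝ u z 1 - I * fderiv ℝ u z I) / 2

/-- The Wirtinger derivative `∂̄ = (∂_x + i ∂_y) / 2`. -/
def wirtingerDbar (u : ℂ → ℂ) (z : ℂ) : ℂ :=
  (fderiv ℝ u z 1 + I * fderiv ℝ u z I) / 2

/-- `∫_D F(ζ) dζ̄ ∧ dζ` over the closed disk `D` of radius `R`; here `dζ̄ ∧ dζ = 2 i dx ∧ dy`. -/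
def diskIntegral (R : ℝ) (F : ℂ → ℂ) : ℂ :=
  2 * I * ∫ ζ in closedBall (0 : ℂ) R, F ζ

/-- `2 π i C₁` is the integral of `(ζ - b)^(k-1) log (1 - b / ζ) / (ζ - a) dζ` over `|ζ| = R`. -/
def kerC1 (a b : ℂ) (k : ℕ) : ℂ :=
  ∑ l ∈ Finset.Ico 1 k, (-(b ^ l) / (l : ℂ)) *
    ∑ j ∈ Finset.range (k - l), ((k - 1).choose j : ℂ) * a ^ (k - 1 - l - j) * (-b) ^ j

/-- `2 π i C₂` is the integral of `(ζ̄ - b̄)^l (ζ - b)^(ν-1) / (ζ - a) dζ` over `|ζ| = R`. -/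
def kerC2 (R : ℝ) (a b : ℂ) (l ν : ℕ) : ℂ :=
  ∑ p ∈ Finset.range (l + 1), ∑ q ∈ Finset.range ν,
    if p ≤ q then
      (l.choose p : ℂ) * ((ν - 1).choose q : ℂ) * (R : ℂ) ^ (2 * p) * (-(conj b)) ^ (l - p) *
        (-b) ^ (ν - 1 - q) * a ^ (q - p)
    else 0

/-- `2 π i C₃` is the integral of `(ζ̄ - ā)^(μ-1) (ζ - b)^(ν-1) / ((ζ - a) (ζ̄ - b̄)) dζ̄ ∧ dζ` over
the disk (for `μ, ν ≥ 1`). The quotient under the logarithm has positive real part for distinct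
`a`, `b` in the closed disk, and the principal branch is meant. -/
def kerC3 (R : ℝ) (a b : ℂ) (μ ν : ℕ) : ℂ :=
  (conj b - conj a) ^ (μ - 1) *
      (kerC1 a b ν +
        (a - b) ^ (ν - 1) * Complex.log (((R : ℂ) ^ 2 - a * conj b) / ((‖a - b‖ ^ 2 : ℝ) : ℂ))) +
    ∑ l ∈ Finset.Ico 1 μ, ((μ - 1).choose l : ℂ) * (conj b - conj a) ^ (μ - 1 - l) *
      (-(1 / (l : ℂ)) * (conj a - conj b) ^ l * (a - b) ^ (ν - 1) +
        1 / (l : ℂ) * kerC2 R a b l ν)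

/-- The Green kernel `G(z, ζ, l)`. -/
def greenKer (z ζ : ℂ) (l : ℕ) : ℂ :=
  (-1) ^ l * (conj ζ - conj z) ^ (l - 1) /
    (2 * (Real.pi : ℂ) * I * ((l - 1).factorial : ℂ) * (ζ - z))

/-- The Green kernel `G(z, ζ, μ, ν)`. -/
def greenKer₂ (R : ℝ) (z ζ : ℂ) (μ ν : ℕ) : ℂ :=
  (-1) ^ μ / (2 * (Real.pi : ℂ) * I * ((μ - 1).factorial : ℂ) * ((ν - 1).factorial : ℂ)) *
    kerC3 R z ζ μ ν

/-- The integrand of the representation formula, without the factor `dζ̄ ∧ dζ`. -/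
def greenIntegrand (R : ℝ) (μ ν : ℕ) (A : ℂ → ℂ) (f g : ℕ → ℂ → ℂ) (z ζ : ℂ) : ℂ :=
  (∑ j ∈ Finset.Ico 1 ν, greenKer z ζ j * g j ζ) + greenKer z ζ ν * conj (f 0 ζ) +
    (∑ i ∈ Finset.Ico 1 μ, greenKer₂ R z ζ ν i * conj (f i ζ)) + greenKer₂ R z ζ ν μ * A ζ

/-- `u` is a classical solution of `∂^μ ∂̄^ν u = A` in the open disk of radius `R`. -/
def IsClassicalSolution (R : ℝ) (μ ν : ℕ) (A u : ℂ → ℂ) : Prop :=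
  ContDiffOn ℝ ((μ + ν : ℕ) : WithTop ℕ∞) u (ball 0 R) ∧
    ∀ z ∈ ball (0 : ℂ) R, wirtingerD^[μ] (wirtingerDbar^[ν] u) z = A z

/-- Holomorphic in the open disk and integrable over the disk. -/
def IsIntegrableHolomorphic (R : ℝ) (h : ℂ → ℂ) : Prop :=
  DifferentiableOn ℂ h (ball 0 R) ∧ IntegrableOn h (closedBall 0 R)

/-- Holomorphic in the open disk and continuous on the closed disk. -/
def IsContinuousHolomorphic (R : ℝ) (h : ℂ → ℂ) : Prop :=
  DifferentiableOn ℂ h (ball 0 R) ∧ ContinuousOn h (closedBall 0 R)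

/-- The restriction of `v` to the open disk extends continuously to the closed disk. -/
def ExtendsToClosedDisk (R : ℝ) (v : ℂ → ℂ) : Prop :=
  ∃ w : ℂ → ℂ, ContinuousOn w (closedBall 0 R) ∧ Set.EqOn w v (ball 0 R)

end

/-! The formula comes from solving `∂̄ w = h` again and again with Cauchy potentials. Four facts
about the kernels, as functions of `z`, carry it. The potential of `G(z, ζ, 1)` is a right inverse
of `∂̄` (`dbarKernel_greenKer_one`). Next, `∂̄ G(z, ζ, l+1) = G(z, ζ, l)` (`dbarKernel_greenKer`)
and `∂̄ G(z, ζ, m+1, n) = G(z, ζ, m, n)` (`dbarKernel_greenKer₂`). Finally, `∂̄ G(z, ζ, 1, n)` is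
minus the conjugate of `G(z, ζ, n)` (`dbarKernel_greenKer₂_one`), and conjugation exchanges `∂` and
`∂̄`. All of them are statements about potentials, so differentiation under a singular integral has
to be justified: this uses a Hölder condition for the Cauchy kernel and local boundedness for the
logarithm.

A function killed by `∂̄^N` is a holomorphic function plus iterated potentials of holomorphic
functions (`DbarChain.exists_eq_greenSum`): subtract a potential with the same `∂̄`-derivative, and
what remains is holomorphic. For a solution `u`, the conjugate `v` of `∂̄^ν u` satisfies `∂̄^μ v =
conj A`. Subtracting the iterated Cauchy potential of `conj A` leaves a function killed by `∂̄^μ`,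
which yields the `f i`. The mixed potential built from `A` and the `f i` then has the same
`∂̄^ν`-derivative as `u`, and the difference yields the `g j`.

Conversely, the kernel identities differentiate the right-hand side step by step down to `A`.
Smoothness is recovered by climbing back: each `∂̄`-primitive gains one derivative in the local
Hölder scale (`IsHolderDiff.of_dbar`), so the `μ + ν` steps from the Hölder function `A` produce a
function of class `C^(μ+ν)`.

The integrable and the continuous versions are treated together through `IsPotentialClass`, which
records only that a class of functions is stable under potentials with weakly singular kernels; the
common result is `isClassicalSolution_iff`. -/

/-! ### Wirtinger calculus. -/

/-- `F` is real-differentiable at `z` with `∂̄ F (z) = d`. -/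
def HasDbarAt (F : ℂ → ℂ) (d z : ℂ) : Prop :=
  DifferentiableAt ℝ F z ∧ wirtingerDbar F z = d

theorem fderiv_real_apply (F : ℂ → ℂ) (z v : ℂ) :
    fderiv ℝ F z v = wirtingerD F z * v + wirtingerDbar F z * conj v := by
  have hv : v = v.re • (1 : ℂ) + v.im • I := by
    simp [Complex.re_add_im]
  have h1 : fderiv ℝ F z v = v.re * fderiv ℝ F z 1 + v.im * fderiv ℝ F z I := by
    conv_lhs => rw [hv]
    rw [map_add, map_smul, map_smul, real_smul, real_smul]
  rw [h1]
  unfold wirtingerD wirtingerDbar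
  conv_rhs => rw [← Complex.re_add_im v]
  simp only [map_add, map_mul, conj_ofReal, conj_I]
  linear_combination ((v.im : ℂ) * fderiv ℝ F z I) * I_sq

theorem fderiv_real_eq (F : ℂ → ℂ) (z : ℂ) :
    fderiv ℝ F z = wirtingerD F z • (1 : ℂ →L[ℝ] ℂ) +
      wirtingerDbar F z • (conjCLE : ℂ →L[ℝ] ℂ) := by
  ext v
  all_goals simp [fderiv_real_apply]

theorem wirtinger_of_hasFDerivAt {F : ℂ → ℂ} {z a b : ℂ}
    (h : HasFDerivAt F (a • (1 : ℂ →L[ℝ] ℂ) + b • (conjCLE : ℂ →L[ℝ] ℂ)) z) :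
    wirtingerD F z = a ∧ wirtingerDbar F z = b := by
  unfold wirtingerD wirtingerDbar
  rw [h.fderiv]
  simp only [add_apply, smul_apply,
    one_apply_eq_self, smul_eq_mul, ContinuousLinearEquiv.coe_coe, conjCLE_apply,
    map_one, conj_I]
  constructor
  · linear_combination (-(a - b) / 2) * I_sq
  · linear_combination ((a - b) / 2) * I_sq

theorem hasFDerivAt_wirtinger {F : ℂ → ℂ} {z : ℂ} (h : DifferentiableAt ℝ F z) :
    HasFDerivAt F (wirtingerD F z • (1 : ℂ →L[ℝ] ℂ) +
      wirtingerDbar F z • (conjCLE : ℂ →L[ℝ] ℂ)) z := by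
  rw [← fderiv_real_eq]
  exact h.hasFDerivAt

theorem HasDbarAt.of_hasFDerivAt {F : ℂ → ℂ} {z a b : ℂ}
    (h : HasFDerivAt F (a • (1 : ℂ →L[ℝ] ℂ) + b • (conjCLE : ℂ →L[ℝ] ℂ)) z) :
    HasDbarAt F b z :=
  ⟨h.differentiableAt, (wirtinger_of_hasFDerivAt h).2⟩

theorem HasDbarAt.hasFDerivAt {F : ℂ → ℂ} {z d : ℂ} (h : HasDbarAt F d z) :
    HasFDerivAt F (wirtingerD F z • (1 : ℂ →L[ℝ] ℂ) + d • (conjCLE : ℂ →L[ℝ] ℂ)) z := by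
  rw [← h.2]
  exact hasFDerivAt_wirtinger h.1

theorem HasDbarAt.congr {F G : ℂ → ℂ} {z d : ℂ} (h : HasDbarAt F d z) (e : G =ᶠ[nhds z] F) :
    HasDbarAt G d z := by
  refine ⟨h.1.congr_of_eventuallyEq e, ?_⟩
  rw [← h.2]
  unfold wirtingerDbar
  rw [e.fderiv_eq]

theorem HasDbarAt.congr_deriv {F : ℂ → ℂ} {z d d' : ℂ} (h : HasDbarAt F d z) (e : d = d') :
    HasDbarAt F d' z := e ▸ h

theorem HasDbarAt.add {F G : ℂ → ℂ} {z d e : ℂ} (h : HasDbarAt F d z) (k : HasDbarAt G e z) :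
    HasDbarAt (fun w => F w + G w) (d + e) z := by
  refine .of_hasFDerivAt (a := wirtingerD F z + wirtingerD G z) ?_
  refine (h.hasFDerivAt.add k.hasFDerivAt).congr_fderiv ?_
  ext v
  all_goals simp; ring

theorem HasDbarAt.mul {F G : ℂ → ℂ} {z d e : ℂ} (h : HasDbarAt F d z) (k : HasDbarAt G e z) :
    HasDbarAt (fun w => F w * G w) (d * G z + F z * e) z := by
  refine .of_hasFDerivAt (a := wirtingerD F z * G z + F z * wirtingerD G z) ?_
  refine (h.hasFDerivAt.mul k.hasFDerivAt).congr_fderiv ?_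
  ext v
  all_goals simp; ring

theorem DifferentiableAt.hasDbarAt_zero {F : ℂ → ℂ} {z : ℂ} (h : DifferentiableAt ℂ F z) :
    HasDbarAt F 0 z := by
  refine .of_hasFDerivAt (a := deriv F z) ?_
  refine h.hasDerivAt.complexToReal_fderiv.congr_fderiv ?_
  ext v
  all_goals simp

theorem hasDbarAt_const (c z : ℂ) : HasDbarAt (fun _ => c) 0 z :=
  (differentiableAt_const c).hasDbarAt_zero

theorem hasDbarAt_conj (z : ℂ) : HasDbarAt (fun w => conj w) 1 z := by
  refine .of_hasFDerivAt (a := 0) ?_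
  refine (conjCLE : ℂ →L[ℝ] ℂ).hasFDerivAt.congr_fderiv ?_
  simp

theorem HasDbarAt.const_mul {F : ℂ → ℂ} {z d : ℂ} (c : ℂ) (h : HasDbarAt F d z) :
    HasDbarAt (fun w => c * F w) (c * d) z :=
  ((hasDbarAt_const c z).mul h).congr_deriv (by ring)

theorem HasDbarAt.neg {F : ℂ → ℂ} {z d : ℂ} (h : HasDbarAt F d z) :
    HasDbarAt (fun w => -F w) (-d) z := by
  simpa using h.const_mul (-1)

theorem HasDbarAt.sub {F G : ℂ → ℂ} {z d e : ℂ} (h : HasDbarAt F d z) (k : HasDbarAt G e z) :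
    HasDbarAt (fun w => F w - G w) (d - e) z := by
  simpa [sub_eq_add_neg] using h.add k.neg

theorem HasDbarAt.sum {ι : Type*} {s : Finset ι} {F : ι → ℂ → ℂ} {d : ι → ℂ} {z : ℂ}
    (h : ∀ i ∈ s, HasDbarAt (F i) (d i) z) :
    HasDbarAt (fun w => ∑ i ∈ s, F i w) (∑ i ∈ s, d i) z := by
  classical
  induction s using Finset.induction_on with
  | empty => simpa using hasDbarAt_const 0 z
  | insert a s ha ih =>
    simp only [Finset.sum_insert ha]
    exact (h a (by simp)).add (ih fun i hi => h i (by simp [hi]))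

/-- When the `conj` coefficient vanishes, the real differential is multiplication by `wirtingerD F
z`, hence complex linear. -/
theorem HasDbarAt.differentiableAt_complex {F : ℂ → ℂ} {z : ℂ} (h : HasDbarAt F 0 z) :
    DifferentiableAt ℂ F z := by
  have h1 := h.hasFDerivAt
  suffices HasDerivAt F (wirtingerD F z) z from this.differentiableAt
  refine hasDerivAt_iff_hasFDerivAt.2 ?_
  refine .of_isLittleO ?_
  have := h1.isLittleO
  simpa [mul_comm] using this

theorem wirtinger_conj {F : ℂ → ℂ} {z : ℂ} (h : DifferentiableAt ℝ F z) :
    wirtingerD (fun w => conj (F w)) z = conj (wirtingerDbar F z) ∧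
      wirtingerDbar (fun w => conj (F w)) z = conj (wirtingerD F z) := by
  apply wirtinger_of_hasFDerivAt
  have := (conjCLE : ℂ →L[ℝ] ℂ).hasFDerivAt.comp z (hasFDerivAt_wirtinger h)
  refine this.congr_fderiv ?_
  ext v
  all_goals simp [add_comm]

theorem DifferentiableAt.conj_real {F : ℂ → ℂ} {z : ℂ} (h : DifferentiableAt ℝ F z) :
    DifferentiableAt ℝ (fun w => conj (F w)) z :=
  (conjCLE : ℂ →L[ℝ] ℂ).differentiableAt.comp z h

theorem wirtingerD_congr {F G : ℂ → ℂ} {U : Set ℂ} (hU : IsOpen U) (h : Set.EqOn F G U) :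
    Set.EqOn (wirtingerD F) (wirtingerD G) U := by
  intro z hz
  unfold wirtingerD
  rw [(h.eventuallyEq_of_mem (hU.mem_nhds hz)).fderiv_eq]

theorem wirtingerDbar_congr {F G : ℂ → ℂ} {U : Set ℂ} (hU : IsOpen U) (h : Set.EqOn F G U) :
    Set.EqOn (wirtingerDbar F) (wirtingerDbar G) U := by
  intro z hz
  unfold wirtingerDbar
  rw [(h.eventuallyEq_of_mem (hU.mem_nhds hz)).fderiv_eq]

/-! ### Integrals with a weak singularity in the plane. -/

theorem integrableOn_norm_rpow_neg {s : ℝ} (hs : s < 2) (r : ℝ) :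
    IntegrableOn (fun w : ℂ => ‖w‖ ^ (-s)) (ball 0 r) := by
  refine integrableOn_ball_of_norm_le_rpow (C := 1) (α := s) ?_ ?_ ?_ ?_
  · simp
  · simpa using hs
  · refine Filter.Eventually.of_forall fun w => ?_
    rw [Real.norm_of_nonneg (by positivity), one_mul]
  · exact (measurable_norm.pow_const _).aestronglyMeasurable

theorem integrable_indicator_norm_rpow_neg {s : ℝ} (hs : s < 2) (r : ℝ) :
    Integrable ((ball (0 : ℂ) r).indicator fun w => ‖w‖ ^ (-s)) :=
  (integrable_indicator_iff measurableSet_ball).2 (integrableOn_norm_rpow_neg hs r)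

/-- An integrable function that is bounded near `z₀` can be integrated against a weak singularity
located near `z₀`, with a uniform bound. -/
theorem exists_integral_rpow_neg_mul_le {m : ℂ → ℝ} (hm : Integrable m) {z₀ : ℂ} {r M s : ℝ}
    (hr : 0 < r) (hM : ∀ ζ ∈ ball z₀ r, |m ζ| ≤ M) (hs0 : 0 ≤ s) (hs : s < 2) :
    ∃ K, ∀ z ∈ ball z₀ (r / 2), Integrable (fun ζ => ‖ζ - z‖ ^ (-s) * m ζ) ∧
      ∫ ζ, ‖ζ - z‖ ^ (-s) * |m ζ| ≤ K := by
  have hM0 : 0 ≤ M := (abs_nonneg _).trans (hM z₀ (mem_ball_self hr))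
  -- The kernel is cut at distance `r / 2` from `z`. Inside, `ζ` lies in `ball z₀ r`, where `m` is
  -- bounded by `M`; outside, the kernel is at most `(r / 2) ^ (-s)`. Translation invariance makes
  -- the bound independent of `z`.
  set k : ℂ → ℝ := (ball (0 : ℂ) (r / 2)).indicator fun w => ‖w‖ ^ (-s) with hk
  have hki : Integrable k := integrable_indicator_norm_rpow_neg hs _
  refine ⟨M * (∫ w, k w) + (r / 2) ^ (-s) * ∫ ζ, |m ζ|, fun z hz => ?_⟩
  have hg : Integrable fun ζ => M * k (ζ - z) + (r / 2) ^ (-s) * |m ζ| :=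
    ((hki.comp_sub_right z).const_mul M).add (hm.abs.const_mul _)
  have hle : ∀ ζ, ‖ζ - z‖ ^ (-s) * |m ζ| ≤ M * k (ζ - z) + (r / 2) ^ (-s) * |m ζ| := by
    intro ζ
    by_cases h : ζ - z ∈ ball (0 : ℂ) (r / 2)
    · have h1 : ζ ∈ ball z₀ r := by
        rw [mem_ball_iff_norm] at hz ⊢
        rw [mem_ball_zero_iff] at h
        calc ‖ζ - z₀‖ = ‖(ζ - z) + (z - z₀)‖ := by ring_nf
          _ ≤ _ := norm_add_le _ _
          _ < r := by linarith
      have h2 : 0 ≤ (r / 2) ^ (-s) * |m ζ| := by positivity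
      have h3 : k (ζ - z) = ‖ζ - z‖ ^ (-s) := Set.indicator_of_mem h _
      rw [h3]
      nlinarith [mul_le_mul_of_nonneg_left (hM ζ h1) (by positivity : 0 ≤ ‖ζ - z‖ ^ (-s))]
    · have h3 : k (ζ - z) = 0 := Set.indicator_of_notMem h _
      rw [h3, mul_zero, zero_add]
      refine mul_le_mul_of_nonneg_right ?_ (abs_nonneg _)
      refine Real.rpow_le_rpow_of_nonpos (by positivity) ?_ (by linarith)
      simpa using h
  have hmeas : AEStronglyMeasurable (fun ζ => ‖ζ - z‖ ^ (-s)) (volume : Measure ℂ) :=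
    ((measurable_id.sub_const z).norm.pow_const _).aestronglyMeasurable
  have hi : Integrable (fun ζ => ‖ζ - z‖ ^ (-s) * m ζ) := by
    refine hg.mono' (hmeas.mul hm.aestronglyMeasurable) (.of_forall fun ζ => ?_)
    rw [Real.norm_eq_abs, abs_mul, abs_of_nonneg (by positivity : 0 ≤ ‖ζ - z‖ ^ (-s))]
    exact hle ζ
  refine ⟨hi, ?_⟩
  calc ∫ ζ, ‖ζ - z‖ ^ (-s) * |m ζ| ≤ ∫ ζ, (M * k (ζ - z) + (r / 2) ^ (-s) * |m ζ|) := by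
        refine integral_mono_of_nonneg (.of_forall fun ζ => by positivity) hg (.of_forall hle)
    _ = _ := by
        rw [integral_add ((hki.comp_sub_right z).const_mul M) (hm.abs.const_mul _),
          integral_const_mul, integral_const_mul, integral_sub_right_eq_self]

/-- Differentiation under the integral sign when the first order remainder of the integrand has a
weak singularity. -/
theorem hasFDerivAt_integral_of_remainder_le {k : ℂ → ℂ → ℂ} {p q : ℂ → ℂ} {m : ℂ → ℝ} {z₀ : ℂ}
    {r M s γ : ℝ} (hm : Integrable m) (hm0 : ∀ ζ, 0 ≤ m ζ) (hr : 0 < r)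
    (hM : ∀ ζ ∈ ball z₀ r, m ζ ≤ M) (hs0 : 0 ≤ s) (hs : s < 2) (hγ : 1 < γ)
    (hk : ∀ z ∈ ball z₀ (r / 2), Integrable (k z)) (hp : Integrable p) (hq : Integrable q)
    (h : ∀ z ∈ ball z₀ (r / 2), ∀ ζ, ζ ≠ z → ζ ≠ z₀ →
      ‖k z ζ - k z₀ ζ - (p ζ * (z - z₀) + q ζ * conj (z - z₀))‖ ≤
        ‖z - z₀‖ ^ γ * ((‖ζ - z‖ ^ (-s) + ‖ζ - z₀‖ ^ (-s)) * m ζ)) :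
    HasFDerivAt (fun z => ∫ ζ, k z ζ)
      ((∫ ζ, p ζ) • (1 : ℂ →L[ℝ] ℂ) + (∫ ζ, q ζ) • (conjCLE : ℂ →L[ℝ] ℂ)) z₀ := by
  obtain ⟨K, hK⟩ := exists_integral_rpow_neg_mul_le hm hr
    (fun ζ hζ => (abs_of_nonneg (hm0 ζ)).trans_le (hM ζ hζ)) hs0 hs
  have hz₀ : z₀ ∈ ball z₀ (r / 2) := mem_ball_self (by positivity)
  have key : ∀ z ∈ ball z₀ (r / 2), ‖(∫ ζ, k z ζ) - (∫ ζ, k z₀ ζ) -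
      ((∫ ζ, p ζ) * (z - z₀) + (∫ ζ, q ζ) * conj (z - z₀))‖ ≤ ‖z - z₀‖ ^ γ * (K + K) := by
    intro z hz
    have hpz := hp.mul_const (z - z₀)
    have hqz := hq.mul_const (conj (z - z₀))
    rw [← integral_mul_const, ← integral_mul_const, ← integral_add hpz hqz,
      ← integral_sub (hk z hz) (hk z₀ hz₀),
      ← integral_sub (f := fun ζ => k z ζ - k z₀ ζ)
        (g := fun ζ => p ζ * (z - z₀) + q ζ * conj (z - z₀))
        ((hk z hz).sub (hk z₀ hz₀)) (hpz.add hqz)]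
    have hi : Integrable fun ζ => ‖z - z₀‖ ^ γ * ((‖ζ - z‖ ^ (-s) + ‖ζ - z₀‖ ^ (-s)) * m ζ) := by
      simp only [add_mul]
      exact ((hK z hz).1.add (hK z₀ hz₀).1).const_mul _
    refine (norm_integral_le_of_norm_le hi ?_).trans ?_
    · filter_upwards [(measure_eq_zero_iff_ae_notMem.1 (measure_singleton z)),
        (measure_eq_zero_iff_ae_notMem.1 (measure_singleton z₀))] with ζ h1 h2
      exact h z hz ζ h1 h2
    · rw [integral_const_mul]
      refine mul_le_mul_of_nonneg_left ?_ (by positivity)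
      simp only [add_mul]
      rw [integral_add (hK z hz).1 (hK z₀ hz₀).1]
      have e : ∀ w, ∫ ζ, ‖ζ - w‖ ^ (-s) * m ζ = ∫ ζ, ‖ζ - w‖ ^ (-s) * |m ζ| := fun w => by
        simp only [abs_of_nonneg (hm0 _)]
      rw [e, e]
      exact add_le_add (hK z hz).2 (hK z₀ hz₀).2
  refine .of_isLittleO ?_
  have hO : (fun z => (∫ ζ, k z ζ) - (∫ ζ, k z₀ ζ) -
      ((∫ ζ, p ζ) * (z - z₀) + (∫ ζ, q ζ) * conj (z - z₀))) =O[nhds z₀]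
      fun z => ‖z - z₀‖ ^ γ := by
    refine .of_bound (K + K) ?_
    filter_upwards [ball_mem_nhds z₀ (by positivity : 0 < r / 2)] with z hz
    rw [Real.norm_of_nonneg (by positivity), mul_comm (K + K)]
    exact key z hz
  -- The assumption `1 < γ` is what makes the remainder smaller than first order.
  have ho : (fun z => ‖z - z₀‖ ^ γ) =o[nhds z₀] fun z => z - z₀ := by
    rw [← Asymptotics.isLittleO_norm_right]
    have e : ∀ z, ‖z - z₀‖ ^ γ = ‖z - z₀‖ ^ (γ - 1) * ‖z - z₀‖ := fun z => by
      rcases eq_or_lt_of_le (norm_nonneg (z - z₀)) with h0 | h0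
      · rw [← h0]
        simp [Real.zero_rpow (by linarith : γ ≠ 0)]
      · rw [Real.rpow_sub_one h0.ne', div_mul_cancel₀ _ h0.ne']
    simp only [e]
    have ht : Filter.Tendsto (fun z => ‖z - z₀‖ ^ (γ - 1)) (nhds z₀) (nhds 0) := by
      have : Continuous fun z => ‖z - z₀‖ ^ (γ - 1) :=
        (continuous_id.sub continuous_const).norm.rpow_const fun _ => Or.inr (by linarith)
      simpa [Real.zero_rpow (by linarith : γ - 1 ≠ 0)] using this.tendsto z₀
    simpa using ((Asymptotics.isLittleO_one_iff ℝ).2 ht).mul_isBigO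
      (Asymptotics.isBigO_refl (fun z => ‖z - z₀‖) (nhds z₀))
  simpa using hO.trans_isLittleO ho

/-! ### The integral of `(ζ - z)⁻¹` over a disk. -/

theorem integral_eq_integral_circleAverage {f : ℂ → ℂ} (hfm : Measurable f) (hf : Integrable f) :
    ∫ ζ, f ζ = ∫ ρ in Set.Ioi (0 : ℝ), (2 * Real.pi * ρ) • Real.circleAverage f 0 ρ := by
  have hsymm : Measurable fun p : ℝ × ℝ => Complex.polarCoord.symm p := by
    have : (fun p : ℝ × ℝ => Complex.polarCoord.symm p) =
        fun p : ℝ × ℝ => (p.1 : ℂ) * (Real.cos p.2 + Real.sin p.2 * I) := by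
      funext p
      exact Complex.polarCoord_symm_apply p
    rw [this]
    fun_prop
  have hint : IntegrableOn (fun p : ℝ × ℝ => p.1 • f (Complex.polarCoord.symm p))
      (Set.Ioi (0 : ℝ) ×ˢ Set.Ioo (-Real.pi) Real.pi) (volume.prod volume) := by
    refine ⟨(measurable_fst.smul (hfm.comp hsymm)).aestronglyMeasurable, ?_⟩
    rw [hasFiniteIntegral_iff_enorm]
    refine lt_of_eq_of_lt ?_ (hasFiniteIntegral_iff_enorm.1 hf.2)
    rw [← Complex.lintegral_comp_polarCoord_symm, polarCoord_target]
    refine setLIntegral_congr_fun (measurableSet_Ioi.prod measurableSet_Ioo) fun p hp => ?_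
    have h0 : 0 < p.1 := hp.1
    rw [enorm_smul, smul_eq_mul, Real.enorm_eq_ofReal h0.le]
  rw [← Complex.integral_comp_polarCoord_symm, polarCoord_target, Measure.volume_eq_prod,
    setIntegral_prod _ hint]
  refine setIntegral_congr_fun measurableSet_Ioi fun ρ hρ => ?_
  have e : ∀ θ : ℝ, Complex.polarCoord.symm (ρ, θ) = circleMap 0 ρ θ := fun θ => by
    rw [Complex.polarCoord_symm_apply, circleMap, zero_add, exp_mul_I]
    push_cast
    rfl
  simp only [e, integral_smul]
  rw [Real.circleAverage_def, smul_smul,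
    show 2 * Real.pi * ρ * (2 * Real.pi)⁻¹ = ρ by field_simp]
  congr 1
  -- Periodicity moves the angular interval `(-π, π)` of `polarCoord` to the interval `(0, 2π)` of
  -- circle averages.
  have hper : Function.Periodic (fun θ => f (circleMap 0 ρ θ)) (2 * Real.pi) := fun θ => by
    simp only [periodic_circleMap 0 ρ θ]
  rw [← integral_Ioc_eq_integral_Ioo, ← intervalIntegral.integral_of_le (by linarith [Real.pi_pos])]
  have := hper.intervalIntegral_add_eq (-Real.pi) 0
  rw [zero_add, show -Real.pi + 2 * Real.pi = Real.pi by ring] at this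
  exact this

theorem circleAverage_inv_sub_of_lt {a : ℂ} {ρ : ℝ} (hρ : 0 < ρ) (h : ρ < ‖a‖) :
    Real.circleAverage (fun ζ => (ζ - a)⁻¹) 0 ρ = -a⁻¹ := by
  have : DiffContOnCl ℂ (fun ζ => (ζ - a)⁻¹) (ball (0 : ℂ) |ρ|) := by
    refine DifferentiableOn.diffContOnCl fun ζ hζ => ?_
    refine DifferentiableAt.differentiableWithinAt ?_
    refine (differentiableAt_id.sub_const a).inv ?_
    have h1 := closure_ball_subset_closedBall hζ
    rw [mem_closedBall_zero_iff, abs_of_pos hρ] at h1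
    intro h2
    rw [show ζ = a from sub_eq_zero.1 h2] at h1
    linarith
  rw [this.circleAverage, zero_sub, inv_neg]

/-- On the circle `conj ζ = ρ² / ζ`, so `(ζ - a)⁻¹` is the conjugate of `ζ / (ρ² - ā ζ)`. That
function is holomorphic on the disk and vanishes at the centre, so the mean value property applies.
-/
theorem circleAverage_inv_sub_of_gt {a : ℂ} {ρ : ℝ} (hρ : 0 < ρ) (h : ‖a‖ < ρ) :
    Real.circleAverage (fun ζ => (ζ - a)⁻¹) 0 ρ = 0 := by
  have hd : DiffContOnCl ℂ (fun ζ => ζ * ((ρ : ℂ) ^ 2 - conj a * ζ)⁻¹) (ball (0 : ℂ) |ρ|) := by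
    refine DifferentiableOn.diffContOnCl fun ζ hζ => ?_
    refine DifferentiableAt.differentiableWithinAt ?_
    refine differentiableAt_id.mul (DifferentiableAt.inv (by fun_prop) ?_)
    have h1 := closure_ball_subset_closedBall hζ
    rw [mem_closedBall_zero_iff, abs_of_pos hρ] at h1
    intro h2
    have h3 : ‖(ρ : ℂ) ^ 2‖ = ‖conj a * ζ‖ := by rw [sub_eq_zero.1 h2]
    rw [norm_pow, norm_real, norm_mul, RCLike.norm_conj, Real.norm_of_nonneg hρ.le] at h3
    nlinarith [norm_nonneg a]
  have h1 := hd.circleAverage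
  rw [zero_mul] at h1
  have h2 : Real.circleAverage (fun ζ => (ζ - a)⁻¹) 0 ρ =
      Real.circleAverage (fun ζ => conj (ζ * ((ρ : ℂ) ^ 2 - conj a * ζ)⁻¹)) 0 ρ := by
    refine Real.circleAverage_congr_sphere fun ζ hζ => ?_
    rw [mem_sphere_zero_iff_norm, abs_of_pos hρ] at hζ
    have h3 : ζ * conj ζ = (ρ : ℂ) ^ 2 := by rw [mul_conj, normSq_eq_norm_sq, hζ]; push_cast; rfl
    have h4 : conj ζ ≠ 0 := by
      intro h5
      rw [h5, mul_zero] at h3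
      exact hρ.ne' (by simpa using h3.symm)
    simp only [map_mul, map_inv₀, map_sub, map_pow, conj_ofReal, conj_conj]
    rw [← h3, ← sub_mul, mul_inv, mul_comm, mul_assoc, inv_mul_cancel₀ h4, mul_one]
  rw [h2, Real.circleAverage_def]
  rw [Real.circleAverage_def] at h1
  have h5 : ∫ θ in (0 : ℝ)..2 * Real.pi, conj ((fun ζ => ζ * ((ρ : ℂ) ^ 2 - conj a * ζ)⁻¹)
      (circleMap 0 ρ θ)) = conj (∫ θ in (0 : ℝ)..2 * Real.pi,
        (fun ζ => ζ * ((ρ : ℂ) ^ 2 - conj a * ζ)⁻¹) (circleMap 0 ρ θ)) := by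
    simp only [intervalIntegral.integral_of_le Real.two_pi_pos.le]
    exact integral_conj
  rw [smul_eq_zero] at h1
  rw [h5, h1.resolve_left (inv_ne_zero Real.two_pi_pos.ne'), map_zero, smul_zero]

theorem integrable_indicator_ball_inv_sub (r : ℝ) (a : ℂ) :
    Integrable ((ball (0 : ℂ) r).indicator fun ζ => (ζ - a)⁻¹) := by
  have h := (integrable_indicator_norm_rpow_neg (s := 1) (by norm_num) (r + ‖a‖)).comp_sub_right a
  refine h.mono' ?_ (.of_forall fun ζ => ?_)
  · exact ((measurable_id.sub_const a).inv.indicator measurableSet_ball).aestronglyMeasurable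
  · by_cases hζ : ζ ∈ ball (0 : ℂ) r
    · have h1 : ζ - a ∈ ball (0 : ℂ) (r + ‖a‖) := by
        rw [mem_ball_zero_iff] at hζ ⊢
        linarith [norm_sub_le ζ a]
      rw [Set.indicator_of_mem hζ, Set.indicator_of_mem h1, norm_inv, Real.rpow_neg_one]
    · rw [Set.indicator_of_notMem hζ, norm_zero]
      exact Set.indicator_nonneg (fun w _ => by positivity) _

/-- Only the circles of radius less than `‖a‖` contribute, each with average `-a⁻¹`; integrating
`2πρ` over `(0, ‖a‖)` gives `-π ‖a‖² / a`. This is the source of the constant `-π` in the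
`∂̄`-derivative of the Cauchy transform. -/
theorem integral_ball_inv_sub {r : ℝ} {a : ℂ} (ha : ‖a‖ < r) :
    ∫ ζ in ball (0 : ℂ) r, (ζ - a)⁻¹ = -Real.pi * conj a := by
  rw [← integral_indicator measurableSet_ball, integral_eq_integral_circleAverage
    (f := (ball (0 : ℂ) r).indicator fun ζ => (ζ - a)⁻¹)
    (((measurable_id'.sub_const a).inv).indicator measurableSet_ball)
    (integrable_indicator_ball_inv_sub r a)]
  have key : ∀ᵐ ρ : ℝ, ρ ∈ Set.Ioi (0 : ℝ) → (2 * Real.pi * ρ) • Real.circleAverage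
      ((ball (0 : ℂ) r).indicator fun ζ => (ζ - a)⁻¹) 0 ρ =
      (Set.Ioc 0 ‖a‖).indicator (fun ρ : ℝ => (ρ : ℂ) * (-(2 * Real.pi) * a⁻¹)) ρ := by
    filter_upwards [measure_eq_zero_iff_ae_notMem.1 (measure_singleton ‖a‖)] with ρ hne hρ
    have hρ0 : 0 < ρ := hρ
    have hne : ρ ≠ ‖a‖ := hne
    by_cases hr : ρ < r
    · have e : Real.circleAverage ((ball (0 : ℂ) r).indicator fun ζ => (ζ - a)⁻¹) 0 ρ =
          Real.circleAverage (fun ζ => (ζ - a)⁻¹) 0 ρ := by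
        refine Real.circleAverage_congr_sphere fun ζ hζ => ?_
        rw [mem_sphere_zero_iff_norm, abs_of_pos hρ0] at hζ
        exact Set.indicator_of_mem (by rw [mem_ball_zero_iff, hζ]; exact hr) _
      rw [e]
      rcases lt_or_gt_of_ne hne with h | h
      · rw [circleAverage_inv_sub_of_lt hρ0 h, Set.indicator_of_mem (Set.mem_Ioc.2 ⟨hρ0, h.le⟩), real_smul]
        push_cast
        ring
      · rw [circleAverage_inv_sub_of_gt hρ0 h, Set.indicator_of_notMem (fun h' => by
          linarith [h'.2]), smul_zero]
    · have e : Real.circleAverage ((ball (0 : ℂ) r).indicator fun ζ => (ζ - a)⁻¹) 0 ρ =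
          Real.circleAverage (fun _ => (0 : ℂ)) 0 ρ := by
        refine Real.circleAverage_congr_sphere fun ζ hζ => ?_
        rw [mem_sphere_zero_iff_norm, abs_of_pos hρ0] at hζ
        exact Set.indicator_of_notMem (by rw [mem_ball_zero_iff, hζ]; exact hr) _
      rw [e, Set.indicator_of_notMem (fun h' => by linarith [h'.2])]
      simp [Real.circleAverage_def]
  rw [setIntegral_congr_ae measurableSet_Ioi key, setIntegral_indicator measurableSet_Ioc,
    Set.inter_eq_self_of_subset_right (Set.Ioc_subset_Ioi_self : Set.Ioc 0 ‖a‖ ⊆ Set.Ioi 0),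
    ← intervalIntegral.integral_of_le (norm_nonneg a), intervalIntegral.integral_mul_const,
    intervalIntegral.integral_ofReal, integral_id]
  by_cases h0 : a = 0
  · simp [h0]
  · have : ((‖a‖ ^ 2 : ℝ) : ℂ) = a * conj a := by rw [mul_conj, normSq_eq_norm_sq]
    push_cast at this ⊢
    rw [this]
    field_simp
    simp

theorem integral_ball_inv_sub_center {r : ℝ} {z₀ z : ℂ} (hz : z ∈ ball z₀ r) :
    ∫ ζ in ball z₀ r, (ζ - z)⁻¹ = -Real.pi * conj (z - z₀) := by
  rw [mem_ball_iff_norm] at hz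
  rw [← integral_ball_inv_sub hz, ← integral_indicator measurableSet_ball,
    ← integral_indicator measurableSet_ball, ← integral_add_right_eq_self _ z₀]
  congr 1
  funext ζ
  simp only [Set.indicator, mem_ball_iff_norm, add_sub_cancel_right, sub_zero]
  split_ifs <;> ring_nf

/-! ### First derivatives of the Cauchy transform. -/

/-- The Cauchy transform of `h`, without its normalizing factor. -/
noncomputable def cauchyT (h : ℂ → ℂ) (z : ℂ) : ℂ := ∫ ζ, h ζ * (ζ - z)⁻¹

theorem rpow_neg_mul_rpow_neg_le {x y a b : ℝ} (hx : 0 < x) (hy : 0 < y) (ha : 0 ≤ a)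
    (hb : 0 ≤ b) : x ^ (-a) * y ^ (-b) ≤ x ^ (-(a + b)) + y ^ (-(a + b)) := by
  have hX : x ^ (-(a + b)) = x ^ (-a) * x ^ (-b) := by rw [← Real.rpow_add hx]; ring_nf
  have hY : y ^ (-(a + b)) = y ^ (-a) * y ^ (-b) := by rw [← Real.rpow_add hy]; ring_nf
  rcases le_total x y with h | h
  · have h1 : y ^ (-b) ≤ x ^ (-b) := Real.rpow_le_rpow_of_nonpos hx h (by linarith)
    have h2 : 0 ≤ y ^ (-(a + b)) := by positivity
    rw [hX]
    nlinarith [mul_le_mul_of_nonneg_left h1 (by positivity : 0 ≤ x ^ (-a))]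
  · have h1 : x ^ (-a) ≤ y ^ (-a) := Real.rpow_le_rpow_of_nonpos hy h (by linarith)
    have h2 : 0 ≤ x ^ (-(a + b)) := by positivity
    rw [hY]
    nlinarith [mul_le_mul_of_nonneg_right h1 (by positivity : 0 ≤ y ^ (-b))]

/-- Meant for `x = ‖ζ - z‖`, `y = ‖ζ - z₀‖`, `d = ‖z - z₀‖`: the left side is the first-order Taylor
remainder of `(ζ - z)⁻¹` at `z₀`. Splitting off `d ^ (1 - α / 2)` by subadditivity leaves a power of
`d` above 1 and singularities of order `2 - α / 2`, below the critical order 2. The factor `y ^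
(-α)` is to be absorbed by a Hölder numerator. -/
theorem sq_div_mul_sq_le {x y d α : ℝ} (hx : 0 < x) (hy : 0 < y) (hd : 0 < d) (h : d ≤ x + y)
    (hα : 0 < α) (hα1 : α ≤ 1) :
    d ^ 2 * (x⁻¹ * (y ^ 2)⁻¹) ≤ d ^ (1 + α / 2) *
      ((x ^ (-(2 - α / 2)) + y ^ (-(2 - α / 2))) * (2 * y ^ (-α))) := by
  have h1 : d ^ (1 - α / 2) ≤ x ^ (1 - α / 2) + y ^ (1 - α / 2) :=
    (Real.rpow_le_rpow hd.le h (by linarith)).trans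
      (Real.rpow_add_le_add_rpow hx.le hy.le (by linarith) (by linarith))
  have h2 : d ^ 2 = d ^ (1 + α / 2) * d ^ (1 - α / 2) := by
    rw [← Real.rpow_add hd, ← Real.rpow_natCast]
    norm_num
  have h3 : (y ^ 2)⁻¹ = y ^ (-(2 - α)) * y ^ (-α) := by
    rw [← Real.rpow_add hy, ← Real.rpow_natCast, ← Real.rpow_neg hy.le]
    congr 1
    push_cast
    ring
  have h4 : x⁻¹ = x ^ (-(1 : ℝ)) := (Real.rpow_neg_one x).symm
  have h5 : x ^ (1 - α / 2) * x ^ (-(1 : ℝ)) = x ^ (-(α / 2)) := by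
    rw [← Real.rpow_add hx]; ring_nf
  have h6 : y ^ (1 - α / 2) * y ^ (-(2 - α)) = y ^ (-(1 - α / 2)) := by
    rw [← Real.rpow_add hy]; ring_nf
  have h7 := rpow_neg_mul_rpow_neg_le hx hy (by linarith : 0 ≤ α / 2) (by linarith : 0 ≤ 2 - α)
  have h8 := rpow_neg_mul_rpow_neg_le hx hy (by linarith : (0 : ℝ) ≤ 1)
    (by linarith : 0 ≤ 1 - α / 2)
  rw [show α / 2 + (2 - α) = 2 - α / 2 by ring] at h7
  rw [show 1 + (1 - α / 2) = 2 - α / 2 by ring] at h8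
  rw [h2, h3, h4, mul_assoc]
  refine mul_le_mul_of_nonneg_left ?_ (by positivity)
  calc d ^ (1 - α / 2) * (x ^ (-(1 : ℝ)) * (y ^ (-(2 - α)) * y ^ (-α)))
      ≤ (x ^ (1 - α / 2) + y ^ (1 - α / 2)) * (x ^ (-(1 : ℝ)) * (y ^ (-(2 - α)) * y ^ (-α))) :=
        mul_le_mul_of_nonneg_right h1 (by positivity)
    _ = (x ^ (1 - α / 2) * x ^ (-(1 : ℝ)) * y ^ (-(2 - α)) +
        x ^ (-(1 : ℝ)) * (y ^ (1 - α / 2) * y ^ (-(2 - α)))) * y ^ (-α) := by ring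
    _ ≤ ((x ^ (-(2 - α / 2)) + y ^ (-(2 - α / 2))) +
        (x ^ (-(2 - α / 2)) + y ^ (-(2 - α / 2)))) * y ^ (-α) := by
        rw [h5, h6]
        exact mul_le_mul_of_nonneg_right (add_le_add h7 h8) (by positivity)
    _ = _ := by ring

theorem integrable_mul_inv_sub {H : ℂ → ℂ} (hH : Integrable H) {z : ℂ} {r M : ℝ} (hr : 0 < r)
    (hM : ∀ ζ ∈ ball z r, ‖H ζ‖ ≤ M) : Integrable fun ζ => H ζ * (ζ - z)⁻¹ := by
  obtain ⟨K, hK⟩ := exists_integral_rpow_neg_mul_le (s := 1) hH.norm hr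
    (fun ζ hζ => by rw [abs_norm]; exact hM ζ hζ) zero_le_one one_lt_two
  refine (hK z (mem_ball_self (by positivity))).1.mono'
    (hH.aestronglyMeasurable.mul (measurable_id.sub_const z).inv.aestronglyMeasurable)
    (.of_forall fun ζ => ?_)
  rw [norm_mul, norm_inv, Real.rpow_neg_one, mul_comm]

/-- The Cauchy transform of an integrable function is real-differentiable wherever the function
satisfies a Hölder condition. -/
theorem hasFDerivAt_cauchyT {h : ℂ → ℂ} (hh : Integrable h) {z₀ : ℂ} {r C α : ℝ} (hr : 0 < r)
    (hα : 0 < α) (hα1 : α ≤ 1) (hC : ∀ ζ ∈ ball z₀ r, ‖h ζ - h z₀‖ ≤ C * ‖ζ - z₀‖ ^ α) :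
    HasFDerivAt (cauchyT h)
      ((∫ ζ, (h ζ - (ball z₀ r).indicator (fun _ => h z₀) ζ) * ((ζ - z₀) ^ 2)⁻¹) •
        (1 : ℂ →L[ℝ] ℂ) + (-Real.pi * h z₀) • (conjCLE : ℂ →L[ℝ] ℂ)) z₀ := by
  -- The density splits into the constant `h z₀` on a disk, whose transform is explicit and produces
  -- the whole `conj` part, and a remainder `H` that is `O(‖ζ - z₀‖ ^ α)`, for which one may
  -- differentiate under the integral.
  set χ : ℂ → ℂ := (ball z₀ r).indicator fun _ => h z₀ with hχ
  have hχi : Integrable χ :=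
    (integrable_indicator_iff measurableSet_ball).2 (integrableOn_const measure_ball_lt_top.ne)
  set H : ℂ → ℂ := fun ζ => h ζ - χ ζ with hHdef
  have hH : Integrable H := hh.sub hχi
  have hHb : ∀ ζ ∈ ball z₀ r, ‖H ζ‖ ≤ C * ‖ζ - z₀‖ ^ α := fun ζ hζ => by
    simp only [hHdef, hχ, Set.indicator_of_mem hζ]
    exact hC ζ hζ
  have hC' : ∀ ζ ∈ ball z₀ r, ‖H ζ‖ ≤ |C| * r ^ α := fun ζ hζ => by
    refine (hHb ζ hζ).trans ?_
    rw [mem_ball_iff_norm] at hζ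
    exact mul_le_mul (le_abs_self C) (Real.rpow_le_rpow (norm_nonneg _) hζ.le hα.le)
      (by positivity) (abs_nonneg _)
  obtain ⟨_, hK⟩ := exists_integral_rpow_neg_mul_le (s := α) hH.norm hr
    (fun ζ hζ => by rw [abs_norm]; exact hC' ζ hζ) hα.le (by linarith)
  have hm0 : Integrable fun ζ => ‖ζ - z₀‖ ^ (-α) * ‖H ζ‖ := (hK z₀ (mem_ball_self (by positivity))).1
  have hm0b : ∀ ζ ∈ ball z₀ r, ‖ζ - z₀‖ ^ (-α) * ‖H ζ‖ ≤ |C| := fun ζ hζ => by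
    by_cases h0 : ζ = z₀
    · subst h0
      have : H ζ = 0 := by simp only [hHdef, hχ, Set.indicator_of_mem hζ, sub_self]
      simp [this]
    · have hp : 0 < ‖ζ - z₀‖ := norm_pos_iff.2 (sub_ne_zero.2 h0)
      calc ‖ζ - z₀‖ ^ (-α) * ‖H ζ‖ ≤ ‖ζ - z₀‖ ^ (-α) * (C * ‖ζ - z₀‖ ^ α) :=
            mul_le_mul_of_nonneg_left (hHb ζ hζ) (by positivity)
        _ = C := by
            rw [Real.rpow_neg hp.le]
            field_simp
        _ ≤ |C| := le_abs_self C
  have hki : ∀ z ∈ ball z₀ (r / 2), Integrable fun ζ => H ζ * (ζ - z)⁻¹ := fun z hz => by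
    refine integrable_mul_inv_sub hH (by positivity : 0 < r / 2) fun ζ hζ => hC' ζ ?_
    rw [mem_ball] at hz hζ ⊢
    linarith [dist_triangle ζ z z₀]
  have hp : Integrable fun ζ => H ζ * ((ζ - z₀) ^ 2)⁻¹ := by
    obtain ⟨_, hK'⟩ := exists_integral_rpow_neg_mul_le (s := 2 - α) hm0 hr
      (fun ζ hζ => by rw [abs_of_nonneg (by positivity)]; exact hm0b ζ hζ) (by linarith)
      (by linarith)
    refine (hK' z₀ (mem_ball_self (by positivity))).1.mono'
      (hH.aestronglyMeasurable.mul
        ((measurable_id.sub_const z₀).pow_const 2).inv.aestronglyMeasurable)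
      (.of_forall fun ζ => ?_)
    by_cases h0 : ζ = z₀
    · subst h0
      simp only [sub_self, ne_eq, OfNat.ofNat_ne_zero, not_false_eq_true, zero_pow, inv_zero,
        mul_zero, norm_zero]
      positivity
    · have hp : 0 < ‖ζ - z₀‖ := norm_pos_iff.2 (sub_ne_zero.2 h0)
      rw [← mul_assoc, ← Real.rpow_add hp, norm_mul, norm_inv, norm_pow,
        show -(2 - α) + -α = -((2 : ℕ) : ℝ) by push_cast; ring, Real.rpow_neg hp.le,
        Real.rpow_natCast, mul_comm]
  -- The kernel is holomorphic in `z`, hence `q = 0`. The weight `‖ζ - z₀‖ ^ (-α) * ‖H ζ‖` is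
  -- bounded near `z₀` precisely by the Hölder condition.
  have hF := hasFDerivAt_integral_of_remainder_le (k := fun z ζ => H ζ * (ζ - z)⁻¹)
    (p := fun ζ => H ζ * ((ζ - z₀) ^ 2)⁻¹) (q := fun _ => 0)
    (m := fun ζ => 2 * (‖ζ - z₀‖ ^ (-α) * ‖H ζ‖)) (z₀ := z₀) (r := r) (M := 2 * |C|)
    (s := 2 - α / 2) (γ := 1 + α / 2) (hm0.const_mul 2) (fun ζ => by positivity) hr
    (fun ζ hζ => mul_le_mul_of_nonneg_left (hm0b ζ hζ) two_pos.le) (by linarith) (by linarith)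
    (by linarith) hki hp (integrable_zero _ _ _) (by
      intro z _ ζ hz hz0
      have h1 : ζ - z ≠ 0 := sub_ne_zero.2 hz
      have h2 : ζ - z₀ ≠ 0 := sub_ne_zero.2 hz0
      by_cases hzz : z = z₀
      · subst hzz
        simp only [sub_self, mul_zero, add_zero, zero_mul, norm_zero]
        positivity
      have e : H ζ * (ζ - z)⁻¹ - H ζ * (ζ - z₀)⁻¹ -
          (H ζ * ((ζ - z₀) ^ 2)⁻¹ * (z - z₀) + 0 * conj (z - z₀)) =
          H ζ * ((z - z₀) ^ 2 * ((ζ - z)⁻¹ * ((ζ - z₀) ^ 2)⁻¹)) := by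
        field_simp
        ring
      rw [e]
      simp only [norm_mul, norm_pow, norm_inv]
      have := sq_div_mul_sq_le (norm_pos_iff.2 h1) (norm_pos_iff.2 h2)
        (norm_pos_iff.2 (sub_ne_zero.2 hzz)) (by
          rw [norm_sub_rev ζ z]
          calc ‖z - z₀‖ = ‖(z - ζ) + (ζ - z₀)‖ := by ring_nf
            _ ≤ _ := norm_add_le _ _) hα hα1
      calc _ ≤ ‖H ζ‖ * _ := mul_le_mul_of_nonneg_left this (norm_nonneg _)
        _ = _ := by ring)
  replace hF := hF.congr_fderiv (g' := (∫ ζ, H ζ * ((ζ - z₀) ^ 2)⁻¹) • (1 : ℂ →L[ℝ] ℂ)) (by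
    ext v
    all_goals simp)
  have hL : HasFDerivAt (fun z => h z₀ * (-Real.pi * conj (z - z₀)))
      ((-Real.pi * h z₀) • (conjCLE : ℂ →L[ℝ] ℂ)) z₀ := by
    have h1 := (((conjCLE : ℂ →L[ℝ] ℂ).hasFDerivAt (x := z₀)).sub_const
      (conj z₀)).const_mul (-Real.pi * h z₀)
    refine h1.congr_of_eventuallyEq (.of_forall fun z => ?_)
    simp only [ContinuousLinearEquiv.coe_coe, conjCLE_apply, map_sub]
    ring
  refine (hF.add hL).congr_of_eventuallyEq ?_
  filter_upwards [ball_mem_nhds z₀ (by positivity : 0 < r / 2)] with z hz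
  have hz' : z ∈ ball z₀ r := ball_subset_ball (by linarith) hz
  simp only [Pi.add_apply]
  rw [← integral_ball_inv_sub_center hz', ← integral_const_mul,
    ← integral_indicator measurableSet_ball, cauchyT]
  have hχz : Integrable fun ζ => χ ζ * (ζ - z)⁻¹ :=
    integrable_mul_inv_sub hχi one_pos fun ζ _ => by
      simp only [hχ]
      exact norm_indicator_le_norm_self _ _
  have e : ∀ ζ, (ball z₀ r).indicator (fun ζ => h z₀ * (ζ - z)⁻¹) ζ = χ ζ * (ζ - z)⁻¹ := fun ζ => by
    simp only [hχ, Set.indicator]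
    split_ifs <;> simp
  simp only [e]
  rw [← integral_add (hki z hz) hχz]
  refine integral_congr_ae (.of_forall fun ζ => ?_)
  simp only [hHdef]
  ring

/-! ### Local Hölder classes and their algebra. -/

/-- `h` satisfies a Hölder condition in a neighbourhood of `z`. -/
def HolderNear (h : ℂ → ℂ) (z : ℂ) : Prop :=
  ∃ r > 0, ∃ C ≥ 0, ∃ α : ℝ, 0 < α ∧ α ≤ 1 ∧
    ∀ x ∈ ball z r, ∀ y ∈ ball z r, ‖h x - h y‖ ≤ C * ‖x - y‖ ^ α

theorem HolderNear.congr {h k : ℂ → ℂ} {z : ℂ} (hh : HolderNear h z) (e : k =ᶠ[nhds z] h) :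
    HolderNear k z := by
  obtain ⟨r, hr, C, hC, α, hα, hα1, H⟩ := hh
  obtain ⟨ε, hε, he⟩ := Metric.eventually_nhds_iff_ball.1 e
  refine ⟨min r ε, lt_min hr hε, C, hC, α, hα, hα1, fun x hx y hy => ?_⟩
  rw [he x (ball_subset_ball (min_le_right _ _) hx), he y (ball_subset_ball (min_le_right _ _) hy)]
  exact H x (ball_subset_ball (min_le_left _ _) hx) y (ball_subset_ball (min_le_left _ _) hy)

theorem HolderNear.continuousAt {h : ℂ → ℂ} {z : ℂ} (hh : HolderNear h z) : ContinuousAt h z := by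
  obtain ⟨r, hr, C, hC, α, hα, hα1, H⟩ := hh
  rw [ContinuousAt, tendsto_iff_norm_sub_tendsto_zero]
  have hc : Continuous fun x => C * ‖x - z‖ ^ α :=
    continuous_const.mul ((continuous_id.sub continuous_const).norm.rpow_const
      fun _ => Or.inr hα.le)
  have ht : Filter.Tendsto (fun x => C * ‖x - z‖ ^ α) (nhds z) (nhds 0) := by
    simpa [Real.zero_rpow hα.ne'] using hc.tendsto z
  refine squeeze_zero' (.of_forall fun x => norm_nonneg _) ?_ ht
  filter_upwards [ball_mem_nhds z hr] with x hx
  exact H x hx z (mem_ball_self hr)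

/-- Gives two functions a common exponent: within radius `1 / 2` all mutual distances are at most 1,
so lowering the exponent only weakens the condition. -/
theorem HolderNear.pair {h k : ℂ → ℂ} {z : ℂ} (hh : HolderNear h z) (hk : HolderNear k z) :
    ∃ r > 0, ∃ C ≥ 0, ∃ α : ℝ, 0 < α ∧ α ≤ 1 ∧ ∀ x ∈ ball z r, ∀ y ∈ ball z r,
      ‖h x - h y‖ ≤ C * ‖x - y‖ ^ α ∧ ‖k x - k y‖ ≤ C * ‖x - y‖ ^ α := by
  obtain ⟨r, hr, C, hC, α, hα, hα1, H⟩ := hh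
  obtain ⟨r', hr', C', hC', α', hα', hα1', H'⟩ := hk
  refine ⟨min (min r r') (1 / 2), by positivity, max C C', hC.le.trans (le_max_left _ _), min α α',
    lt_min hα hα', (min_le_left _ _).trans hα1, fun x hx y hy => ?_⟩
  have h1 : ‖x - y‖ ≤ 1 := by
    have hx' := ball_subset_ball (min_le_right _ _) hx
    have hy' := ball_subset_ball (min_le_right _ _) hy
    rw [mem_ball] at hx' hy'
    rw [← dist_eq_norm]
    linarith [dist_triangle_right x y z]
  have hs : min (min r r') (1 / 2) ≤ min r r' := min_le_left _ _
  have hx1 := ball_subset_ball hs hx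
  have hy1 := ball_subset_ball hs hy
  have mono : ∀ β, min α α' ≤ β → ‖x - y‖ ^ β ≤ ‖x - y‖ ^ (min α α') := fun β hβ => by
    rcases eq_or_lt_of_le (norm_nonneg (x - y)) with h0 | h0
    · rw [← h0, Real.zero_rpow (lt_of_lt_of_le (lt_min hα hα') hβ).ne',
        Real.zero_rpow (lt_min hα hα').ne']
    · exact Real.rpow_le_rpow_of_exponent_ge h0 h1 hβ
  constructor
  · exact (H x (ball_subset_ball (min_le_left _ _) hx1) y (ball_subset_ball (min_le_left _ _)
      hy1)).trans (mul_le_mul (le_max_left _ _) (mono α (min_le_left _ _)) (by positivity)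
        (hC.le.trans (le_max_left _ _)))
  · exact (H' x (ball_subset_ball (min_le_right _ _) hx1) y (ball_subset_ball (min_le_right _ _)
      hy1)).trans (mul_le_mul (le_max_right _ _) (mono α' (min_le_right _ _)) (by positivity)
        (hC.le.trans (le_max_left _ _)))

theorem HolderNear.add {h k : ℂ → ℂ} {z : ℂ} (hh : HolderNear h z) (hk : HolderNear k z) :
    HolderNear (fun w => h w + k w) z := by
  obtain ⟨r, hr, C, hC, α, hα, hα1, H⟩ := hh.pair hk
  refine ⟨r, hr, C + C, by positivity, α, hα, hα1, fun x hx y hy => ?_⟩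
  obtain ⟨h1, h2⟩ := H x hx y hy
  calc ‖h x + k x - (h y + k y)‖ = ‖(h x - h y) + (k x - k y)‖ := by ring_nf
    _ ≤ _ := norm_add_le _ _
    _ ≤ _ := by linarith

theorem HolderNear.mul {h k : ℂ → ℂ} {z : ℂ} (hh : HolderNear h z) (hk : HolderNear k z) :
    HolderNear (fun w => h w * k w) z := by
  have hhc : ∀ᶠ x in nhds z, ‖h x‖ < ‖h z‖ + 1 :=
    hh.continuousAt.norm.eventually_lt_const (by linarith)
  have hkc : ∀ᶠ x in nhds z, ‖k x‖ < ‖k z‖ + 1 :=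
    hk.continuousAt.norm.eventually_lt_const (by linarith)
  obtain ⟨ε, hε, he⟩ := Metric.eventually_nhds_iff_ball.1 (hhc.and hkc)
  obtain ⟨r, hr, C, hC, α, hα, hα1, H⟩ := hh.pair hk
  refine ⟨min r ε, by positivity, (‖h z‖ + 1) * C + (‖k z‖ + 1) * C, by positivity, α, hα, hα1,
    fun x hx y hy => ?_⟩
  obtain ⟨h1, h2⟩ := H x (ball_subset_ball (min_le_left _ _) hx) y
    (ball_subset_ball (min_le_left _ _) hy)
  have h3 := (he x (ball_subset_ball (min_le_right _ _) hx)).1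
  have h4 := (he y (ball_subset_ball (min_le_right _ _) hy)).2
  calc ‖h x * k x - h y * k y‖ = ‖h x * (k x - k y) + k y * (h x - h y)‖ := by ring_nf
    _ ≤ ‖h x‖ * ‖k x - k y‖ + ‖k y‖ * ‖h x - h y‖ := by
        simpa only [norm_mul] using norm_add_le (h x * (k x - k y)) (k y * (h x - h y))
    _ ≤ (‖h z‖ + 1) * (C * ‖x - y‖ ^ α) + (‖k z‖ + 1) * (C * ‖x - y‖ ^ α) := by gcongr
    _ = _ := by ring

theorem HolderNear.conj {h : ℂ → ℂ} {z : ℂ} (hh : HolderNear h z) :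
    HolderNear (fun w => conj (h w)) z := by
  obtain ⟨r, hr, C, hC, α, hα, hα1, H⟩ := hh
  refine ⟨r, hr, C, hC, α, hα, hα1, fun x hx y hy => ?_⟩
  rw [← map_sub, RCLike.norm_conj]
  exact H x hx y hy

theorem ContDiffAt.holderNear {h : ℂ → ℂ} {z : ℂ} (hh : ContDiffAt ℝ 1 h z) : HolderNear h z := by
  obtain ⟨K, t, ht, H⟩ := hh.exists_lipschitzOnWith
  obtain ⟨r, hr, hrt⟩ := Metric.mem_nhds_iff.1 ht
  refine ⟨r, hr, K, K.2, 1, one_pos, le_rfl, fun x hx y hy => ?_⟩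
  rw [Real.rpow_one]
  exact H.norm_sub_le (hrt hx) (hrt hy)

/-- The functions on `U` that have real derivatives of order `k` that are locally Hölder. -/
def IsHolderDiff : ℕ → (ℂ → ℂ) → Set ℂ → Prop
  | 0, h, U => ∀ z ∈ U, HolderNear h z
  | k + 1, h, U => (∀ z ∈ U, DifferentiableAt ℝ h z) ∧ IsHolderDiff k (wirtingerD h) U ∧
      IsHolderDiff k (wirtingerDbar h) U

theorem IsHolderDiff.congr {k : ℕ} {h h' : ℂ → ℂ} {U : Set ℂ} (hU : IsOpen U)
    (H : IsHolderDiff k h U) (e : Set.EqOn h' h U) : IsHolderDiff k h' U := by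
  induction k generalizing h h' with
  | zero => exact fun z hz => (H z hz).congr (e.eventuallyEq_of_mem (hU.mem_nhds hz))
  | succ k ih =>
    exact ⟨fun z hz => (H.1 z hz).congr_of_eventuallyEq (e.eventuallyEq_of_mem (hU.mem_nhds hz)),
      ih H.2.1 (wirtingerD_congr hU e), ih H.2.2 (wirtingerDbar_congr hU e)⟩

/-- The derivatives are taken in the whole plane, so the predicate is a condition at each point
separately; the sets `V` need not be open. -/
theorem IsHolderDiff.of_local {k : ℕ} {h : ℂ → ℂ} {U : Set ℂ}
    (H : ∀ z ∈ U, ∃ V, z ∈ V ∧ IsHolderDiff k h V) : IsHolderDiff k h U := by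
  induction k generalizing h with
  | zero =>
    intro z hz
    obtain ⟨V, hV, hk⟩ := H z hz
    exact hk z hV
  | succ k ih =>
    refine ⟨fun z hz => ?_, ih fun z hz => ?_, ih fun z hz => ?_⟩ <;>
      obtain ⟨V, hV, hk⟩ := H z hz
    · exact hk.1 z hV
    · exact ⟨V, hV, hk.2.1⟩
    · exact ⟨V, hV, hk.2.2⟩

theorem IsHolderDiff.mono {k : ℕ} {h : ℂ → ℂ} {U V : Set ℂ} (H : IsHolderDiff k h U) (hV : V ⊆ U) :
    IsHolderDiff k h V :=
  .of_local fun _ hz => ⟨U, hV hz, H⟩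

theorem IsHolderDiff.contDiffOn {k : ℕ} {h : ℂ → ℂ} {U : Set ℂ} (hU : IsOpen U)
    (H : IsHolderDiff k h U) : ContDiffOn ℝ k h U := by
  induction k generalizing h with
  | zero =>
    rw [Nat.cast_zero, contDiffOn_zero]
    exact fun z hz => (H z hz).continuousAt.continuousWithinAt
  | succ k ih =>
    rw [Nat.cast_succ, contDiffOn_succ_iff_fderiv_of_isOpen hU]
    refine ⟨fun z hz => (H.1 z hz).differentiableWithinAt, by simp, ?_⟩
    have e : fderiv ℝ h = fun z => wirtingerD h z • (1 : ℂ →L[ℝ] ℂ) +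
        wirtingerDbar h z • (conjCLE : ℂ →L[ℝ] ℂ) := funext fun z => fderiv_real_eq h z
    rw [e]
    exact ((ih H.2.1).smul contDiffOn_const).add ((ih H.2.2).smul contDiffOn_const)

/-- At the bottom level a `C¹` function is locally Lipschitz; the product rule needs this descent
for its undifferentiated factors. -/
theorem IsHolderDiff.of_succ {k : ℕ} {h : ℂ → ℂ} {U : Set ℂ} (hU : IsOpen U)
    (H : IsHolderDiff (k + 1) h U) : IsHolderDiff k h U := by
  induction k generalizing h with
  | zero =>
    intro z hz
    have := H.contDiffOn hU
    rw [zero_add, Nat.cast_one] at this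
    exact (this.contDiffAt (hU.mem_nhds hz)).holderNear
  | succ k ih => exact ⟨H.1, ih H.2.1, ih H.2.2⟩

theorem ContDiffOn.wirtinger {n : WithTop ℕ∞} {h : ℂ → ℂ} {U : Set ℂ} (hU : IsOpen U)
    (H : ContDiffOn ℝ (n + 1) h U) :
    ContDiffOn ℝ n (wirtingerD h) U ∧ ContDiffOn ℝ n (wirtingerDbar h) U := by
  have hf : ContDiffOn ℝ n (fderiv ℝ h) U := H.fderiv_of_isOpen hU le_rfl
  have h1 : ContDiffOn ℝ n (fun z => fderiv ℝ h z 1) U := hf.clm_apply contDiffOn_const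
  have h2 : ContDiffOn ℝ n (fun z => fderiv ℝ h z I) U := hf.clm_apply contDiffOn_const
  exact ⟨(h1.sub (contDiffOn_const.mul h2)).div_const 2,
    (h1.add (contDiffOn_const.mul h2)).div_const 2⟩

theorem ContDiffOn.isHolderDiff {k : ℕ} {h : ℂ → ℂ} {U : Set ℂ} (hU : IsOpen U)
    (H : ContDiffOn ℝ ((k + 1 : ℕ) : WithTop ℕ∞) h U) : IsHolderDiff k h U := by
  induction k generalizing h with
  | zero =>
    intro z hz
    rw [zero_add, Nat.cast_one] at H
    exact (H.contDiffAt (hU.mem_nhds hz)).holderNear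
  | succ k ih =>
    rw [Nat.cast_succ] at H
    exact ⟨fun z hz => (H.contDiffAt (hU.mem_nhds hz)).differentiableAt (by simp),
      ih (H.wirtinger hU).1, ih (H.wirtinger hU).2⟩

theorem DifferentiableOn.isHolderDiff {h : ℂ → ℂ} {U : Set ℂ} (hU : IsOpen U)
    (H : DifferentiableOn ℂ h U) (k : ℕ) : IsHolderDiff k h U :=
  ContDiffOn.isHolderDiff hU ((H.contDiffOn hU).restrict_scalars ℝ)

theorem wirtingerD_add {F G : ℂ → ℂ} {z : ℂ} (h : DifferentiableAt ℝ F z)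
    (k : DifferentiableAt ℝ G z) :
    wirtingerD (fun w => F w + G w) z = wirtingerD F z + wirtingerD G z := by
  have := fderiv_add h k
  unfold wirtingerD
  rw [show (fun w => F w + G w) = F + G from rfl, this]
  simp only [add_apply]
  ring

theorem wirtingerD_mul {F G : ℂ → ℂ} {z : ℂ} (h : DifferentiableAt ℝ F z)
    (k : DifferentiableAt ℝ G z) :
    wirtingerD (fun w => F w * G w) z = wirtingerD F z * G z + F z * wirtingerD G z := by
  have := fderiv_mul h k
  unfold wirtingerD
  rw [show (fun w => F w * G w) = F * G from rfl, this]
  simp only [add_apply, smul_apply, smul_eq_mul]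
  ring

theorem IsHolderDiff.add {k : ℕ} {h h' : ℂ → ℂ} {U : Set ℂ} (hU : IsOpen U)
    (H : IsHolderDiff k h U) (H' : IsHolderDiff k h' U) :
    IsHolderDiff k (fun z => h z + h' z) U := by
  induction k generalizing h h' with
  | zero => exact fun z hz => (H z hz).add (H' z hz)
  | succ k ih =>
    exact ⟨fun z hz => (H.1 z hz).add (H'.1 z hz),
      (ih H.2.1 H'.2.1).congr hU fun z hz => wirtingerD_add (H.1 z hz) (H'.1 z hz),
      (ih H.2.2 H'.2.2).congr hU fun z hz =>
        (HasDbarAt.add ⟨H.1 z hz, rfl⟩ ⟨H'.1 z hz, rfl⟩).2⟩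

theorem IsHolderDiff.mul {k : ℕ} {h h' : ℂ → ℂ} {U : Set ℂ} (hU : IsOpen U)
    (H : IsHolderDiff k h U) (H' : IsHolderDiff k h' U) :
    IsHolderDiff k (fun z => h z * h' z) U := by
  induction k generalizing h h' with
  | zero => exact fun z hz => (H z hz).mul (H' z hz)
  | succ k ih =>
    exact ⟨fun z hz => (H.1 z hz).mul (H'.1 z hz),
      ((ih H.2.1 (H'.of_succ hU)).add hU (ih (H.of_succ hU) H'.2.1)).congr hU fun z hz =>
        wirtingerD_mul (H.1 z hz) (H'.1 z hz),
      ((ih H.2.2 (H'.of_succ hU)).add hU (ih (H.of_succ hU) H'.2.2)).congr hU fun z hz =>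
        (HasDbarAt.mul ⟨H.1 z hz, rfl⟩ ⟨H'.1 z hz, rfl⟩).2⟩

theorem IsHolderDiff.conj {k : ℕ} {h : ℂ → ℂ} {U : Set ℂ} (hU : IsOpen U)
    (H : IsHolderDiff k h U) : IsHolderDiff k (fun z => conj (h z)) U := by
  induction k generalizing h with
  | zero => exact fun z hz => (H z hz).conj
  | succ k ih =>
    exact ⟨fun z hz => (H.1 z hz).conj_real,
      (ih H.2.2).congr hU fun z hz => (wirtinger_conj (H.1 z hz)).1,
      (ih H.2.1).congr hU fun z hz => (wirtinger_conj (H.1 z hz)).2⟩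

/-! ### Regularity of the Cauchy transform and of `∂̄`-primitives. -/

/-- Where the density vanishes the Hölder condition holds with constant 0, and the `∂̄`-derivative
`-π h` is zero. -/
theorem cauchyT_far {h : ℂ → ℂ} (hh : Integrable h) {z₀ : ℂ} {r : ℝ}
    (h0 : ∀ ζ ∈ ball z₀ r, h ζ = 0) : DifferentiableOn ℂ (cauchyT h) (ball z₀ r) := by
  intro z hz
  obtain ⟨ε, hε, hεr⟩ := Metric.isOpen_iff.1 isOpen_ball z hz
  have := hasFDerivAt_cauchyT hh (C := 0) hε one_pos le_rfl fun ζ hζ => by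
    rw [h0 ζ (hεr hζ), h0 z hz]
    simp
  exact ((HasDbarAt.of_hasFDerivAt this).congr_deriv (by
    rw [h0 z hz, mul_zero])).differentiableAt_complex.differentiableWithinAt

theorem cauchyT_holderNear {h : ℂ → ℂ} (hh : Integrable h) {z : ℂ} (hz : HolderNear h z) :
    HasDbarAt (cauchyT h) (-Real.pi * h z) z := by
  obtain ⟨r, hr, C, hC, α, hα, hα1, H⟩ := hz
  exact .of_hasFDerivAt (hasFDerivAt_cauchyT hh hr hα hα1 fun ζ hζ =>
    H ζ hζ z (mem_ball_self hr))

theorem continuous_of_holder {H : ℂ → ℂ} {C α : ℝ} (hC0 : 0 ≤ C) (hα : 0 < α) (hα1 : α ≤ 1)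
    (hC : ∀ x y, ‖H x - H y‖ ≤ C * ‖x - y‖ ^ α) : Continuous H :=
  continuous_iff_continuousAt.2 fun _ =>
    HolderNear.continuousAt ⟨1, one_pos, C, hC0, α, hα, hα1, fun x _ y _ => hC x y⟩

/-- The numerator of the singular integral that represents `∂` of the Cauchy transform. -/
noncomputable def beurlingNum (H : ℂ → ℂ) (z w : ℂ) : ℂ :=
  H (z + w) - (ball (0 : ℂ) 1).indicator (fun _ => H z) w

/-- Translation fixes the singularity at the origin, so that `z` enters only through the numerator
and values at two points can be compared under one integral. -/
theorem integral_beurling_eq (H : ℂ → ℂ) (z : ℂ) :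
    ∫ ζ, (H ζ - (ball z 1).indicator (fun _ => H z) ζ) * ((ζ - z) ^ 2)⁻¹ =
      ∫ w, beurlingNum H z w * (w ^ 2)⁻¹ := by
  rw [← integral_add_left_eq_self _ z]
  congr 1
  funext w
  have : (ball z 1).indicator (fun _ => H z) (z + w) =
      (ball (0 : ℂ) 1).indicator (fun _ => H z) w := by
    simp [Set.indicator]
  rw [beurlingNum, this, add_sub_cancel_left]

/-- For `‖w‖ < 1` the difference is bounded both by `‖z - z'‖ ^ α` and by `‖w‖ ^ α`, up to a factor
`2 * C`, hence by the geometric mean of the two. Half of the exponent is kept as Hölder modulus in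
`z`; the other half makes division by `w ^ 2` integrable. -/
theorem beurlingNum_sub_le {H : ℂ → ℂ} {C α M L : ℝ} (hC0 : 0 ≤ C) (hα : 0 < α)
    (hC : ∀ x y, ‖H x - H y‖ ≤ C * ‖x - y‖ ^ α) (hM : ∀ x, M ≤ ‖x‖ → H x = 0) (hL1 : 1 ≤ L)
    {z z' : ℂ} (hz : ‖z‖ + M ≤ L) (hz' : ‖z'‖ + M ≤ L) (hzz : ‖z - z'‖ ≤ 1) (w : ℂ) :
    ‖beurlingNum H z w - beurlingNum H z' w‖ ≤ 2 * C * ‖z - z'‖ ^ (α / 2) *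
      (ball (0 : ℂ) L).indicator (fun w => ‖w‖ ^ (α / 2)) w := by
  set d := ‖z - z'‖ with hd
  have hd0 : 0 ≤ d := norm_nonneg _
  have sq : ∀ x : ℝ, 0 ≤ x → x ^ α = x ^ (α / 2) * x ^ (α / 2) := fun x hx => by
    rw [← Real.rpow_add' hx (by linarith), add_halves]
  by_cases hwL : w ∈ ball (0 : ℂ) L
  · rw [Set.indicator_of_mem hwL]
    by_cases hw1 : w ∈ ball (0 : ℂ) 1
    · simp only [beurlingNum, Set.indicator_of_mem hw1]
      have h1 : ‖H (z + w) - H z - (H (z' + w) - H z')‖ ≤ 2 * (C * d ^ α) := by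
        calc _ = ‖(H (z + w) - H (z' + w)) - (H z - H z')‖ := by ring_nf
          _ ≤ ‖H (z + w) - H (z' + w)‖ + ‖H z - H z'‖ := norm_sub_le _ _
          _ ≤ C * d ^ α + C * d ^ α := by
              refine add_le_add ?_ (hC z z')
              simpa [hd] using hC (z + w) (z' + w)
          _ = _ := by ring
      have h2 : ‖H (z + w) - H z - (H (z' + w) - H z')‖ ≤ 2 * (C * ‖w‖ ^ α) := by
        calc _ ≤ ‖H (z + w) - H z‖ + ‖H (z' + w) - H z'‖ := norm_sub_le _ _
          _ ≤ C * ‖w‖ ^ α + C * ‖w‖ ^ α :=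
              add_le_add (by simpa using hC (z + w) z) (by simpa using hC (z' + w) z')
          _ = _ := by ring
      rcases le_total d ‖w‖ with h | h
      · refine h1.trans ?_
        rw [sq d hd0]
        have := Real.rpow_le_rpow hd0 h (by linarith : 0 ≤ α / 2)
        have h3 : 0 ≤ d ^ (α / 2) := by positivity
        nlinarith [mul_le_mul_of_nonneg_left this (mul_nonneg hC0 h3)]
      · refine h2.trans ?_
        rw [sq ‖w‖ (norm_nonneg _)]
        have := Real.rpow_le_rpow (norm_nonneg _) h (by linarith : 0 ≤ α / 2)
        have h3 : 0 ≤ ‖w‖ ^ (α / 2) := by positivity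
        nlinarith [mul_le_mul_of_nonneg_left this (mul_nonneg hC0 h3)]
    · simp only [beurlingNum, Set.indicator_of_notMem hw1, sub_zero]
      have h1 : ‖H (z + w) - H (z' + w)‖ ≤ C * d ^ α := by
        simpa [hd] using hC (z + w) (z' + w)
      refine h1.trans ?_
      have hw : 1 ≤ ‖w‖ := by simpa using hw1
      have h2 : 1 ≤ ‖w‖ ^ (α / 2) := Real.one_le_rpow hw (by linarith)
      have h3 : d ^ (α / 2) ≤ 1 := Real.rpow_le_one hd0 hzz (by linarith)
      have h4 : 0 ≤ d ^ (α / 2) := by positivity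
      rw [sq d hd0]
      calc C * (d ^ (α / 2) * d ^ (α / 2)) ≤ C * (d ^ (α / 2) * 1) := by gcongr
        _ ≤ 2 * C * d ^ (α / 2) * 1 := by nlinarith [mul_nonneg hC0 h4]
        _ ≤ _ := by gcongr
  · rw [Set.indicator_of_notMem hwL]
    have hw : L ≤ ‖w‖ := by simpa using hwL
    have hw1 : w ∉ ball (0 : ℂ) 1 := fun h => by
      rw [mem_ball_zero_iff] at h
      linarith
    have e : ∀ y : ℂ, ‖y‖ + M ≤ L → H (y + w) = 0 := fun y hy => hM _ (by
      have : ‖w‖ ≤ ‖y + w‖ + ‖y‖ := by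
        calc ‖w‖ = ‖(y + w) - y‖ := by ring_nf
          _ ≤ _ := norm_sub_le _ _
      linarith)
    simp [beurlingNum, Set.indicator_of_notMem hw1, e z hz, e z' hz']

theorem beurlingNum_le {H : ℂ → ℂ} {C α M L B : ℝ} (hC0 : 0 ≤ C) (hα : 0 < α) (hB0 : 0 ≤ B)
    (hC : ∀ x y, ‖H x - H y‖ ≤ C * ‖x - y‖ ^ α) (hM : ∀ x, M ≤ ‖x‖ → H x = 0) (hL1 : 1 ≤ L)
    (hB : ∀ x, ‖H x‖ ≤ B) {z : ℂ} (hz : ‖z‖ + M ≤ L) (w : ℂ) :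
    ‖beurlingNum H z w‖ ≤ (C + B) * (ball (0 : ℂ) L).indicator (fun w => ‖w‖ ^ α) w := by
  by_cases hwL : w ∈ ball (0 : ℂ) L
  · rw [Set.indicator_of_mem hwL]
    have h0 : 0 ≤ ‖w‖ ^ α := by positivity
    by_cases hw1 : w ∈ ball (0 : ℂ) 1
    · simp only [beurlingNum, Set.indicator_of_mem hw1]
      have := hC (z + w) z
      rw [add_sub_cancel_left] at this
      nlinarith
    · simp only [beurlingNum, Set.indicator_of_notMem hw1, sub_zero]
      have hw : 1 ≤ ‖w‖ := by simpa using hw1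
      have h2 : 1 ≤ ‖w‖ ^ α := Real.one_le_rpow hw hα.le
      nlinarith [hB (z + w)]
  · rw [Set.indicator_of_notMem hwL]
    have hw : L ≤ ‖w‖ := by simpa using hwL
    have hw1 : w ∉ ball (0 : ℂ) 1 := fun h => by
      rw [mem_ball_zero_iff] at h
      linarith
    have e : H (z + w) = 0 := hM _ (by
      have : ‖w‖ ≤ ‖z + w‖ + ‖z‖ := by
        calc ‖w‖ = ‖(z + w) - z‖ := by ring_nf
          _ ≤ _ := norm_sub_le _ _
      linarith)
    simp [beurlingNum, Set.indicator_of_notMem hw1, e]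

theorem norm_mul_inv_sq_le {β K L : ℝ} {N w : ℂ} (hK : 0 ≤ K)
    (h : ‖N‖ ≤ K * (ball (0 : ℂ) L).indicator (fun w => ‖w‖ ^ β) w) :
    ‖N * (w ^ 2)⁻¹‖ ≤ K * (ball (0 : ℂ) L).indicator (fun w => ‖w‖ ^ (-(2 - β))) w := by
  rcases eq_or_ne w 0 with rfl | hw0
  · have : 0 ≤ (ball (0 : ℂ) L).indicator (fun w => ‖w‖ ^ (-(2 - β))) 0 :=
      Set.indicator_nonneg (fun w _ => by positivity) _
    simpa using mul_nonneg hK this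
  · have h0 : 0 < ‖w‖ := norm_pos_iff.2 hw0
    rw [norm_mul, norm_inv, norm_pow]
    by_cases hw : w ∈ ball (0 : ℂ) L
    · rw [Set.indicator_of_mem hw] at h ⊢
      rw [show -(2 - β) = β - (2 : ℕ) by push_cast; ring, Real.rpow_sub_natCast h0.ne',
        div_eq_mul_inv, ← mul_assoc]
      exact mul_le_mul_of_nonneg_right h (by positivity)
    · rw [Set.indicator_of_notMem hw, mul_zero] at h ⊢
      rw [le_antisymm h (norm_nonneg _), zero_mul]

/-- The `∂̄`-derivative is `-π H`; the `∂`-derivative is a singular integral, shown to be Hölder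
with exponent `α / 2`. Losing half of the exponent is harmless, since the class admits every
positive exponent up to 1. -/
theorem isHolderDiff_one_cauchyT {H : ℂ → ℂ} {C α M : ℝ} (hC0 : 0 ≤ C) (hα : 0 < α)
    (hα1 : α ≤ 1) (hC : ∀ x y, ‖H x - H y‖ ≤ C * ‖x - y‖ ^ α) (hM : ∀ x, M ≤ ‖x‖ → H x = 0) :
    IsHolderDiff 1 (cauchyT H) Set.univ := by
  have hc : Continuous H := continuous_of_holder hC0 hα hα1 hC
  have hcs : HasCompactSupport H :=
    HasCompactSupport.intro (isCompact_closedBall (0 : ℂ) M) fun x hx => hM x (by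
      rw [mem_closedBall_zero_iff, not_le] at hx
      exact hx.le)
  have hi : Integrable H := hc.integrable_of_hasCompactSupport hcs
  obtain ⟨B, hB⟩ := hcs.exists_bound_of_continuous hc
  have hB0 : 0 ≤ B := (norm_nonneg _).trans (hB 0)
  have hd : ∀ z, HasFDerivAt (cauchyT H)
      ((∫ w, beurlingNum H z w * (w ^ 2)⁻¹) • (1 : ℂ →L[ℝ] ℂ) +
        (-Real.pi * H z) • (conjCLE : ℂ →L[ℝ] ℂ)) z := fun z => by
    rw [← integral_beurling_eq]
    exact hasFDerivAt_cauchyT hi one_pos hα hα1 fun ζ _ => hC ζ z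
  have hHn : ∀ z, HolderNear H z := fun z =>
    ⟨1, one_pos, C, hC0, α, hα, hα1, fun x _ y _ => hC x y⟩
  refine ⟨fun z _ => (hd z).differentiableAt, fun z₀ _ => ?_, fun z _ => ?_⟩
  · rw [show wirtingerD (cauchyT H) = fun z => ∫ w, beurlingNum H z w * (w ^ 2)⁻¹ from
      funext fun z => (wirtinger_of_hasFDerivAt (hd z)).1]
    -- Beyond radius `L` the numerator vanishes for every `z` within `1 / 2` of `z₀`.
    set L : ℝ := ‖z₀‖ + 1 + |M| with hL
    have hL1 : 1 ≤ L := by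
      have := norm_nonneg z₀
      have := abs_nonneg M
      linarith
    have hzL : ∀ z ∈ ball z₀ (1 / 2), ‖z‖ + M ≤ L := fun z hz => by
      rw [mem_ball_iff_norm] at hz
      have : ‖z‖ ≤ ‖z - z₀‖ + ‖z₀‖ := by simpa using norm_add_le (z - z₀) z₀
      linarith [le_abs_self M]
    have hint : ∀ z ∈ ball z₀ (1 / 2), Integrable fun w => beurlingNum H z w * (w ^ 2)⁻¹ := by
      intro z hz
      refine ((integrable_indicator_norm_rpow_neg (s := 2 - α) (by linarith) L).const_mul
        (C + B)).mono' ?_ (.of_forall fun w =>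
          norm_mul_inv_sq_le (by positivity) (beurlingNum_le hC0 hα hB0 hC hM hL1 hB (hzL z hz) w))
      have h1 : Measurable fun w => beurlingNum H z w :=
        (hc.measurable.comp (measurable_const_add z)).sub
          (measurable_const.indicator measurableSet_ball)
      exact (h1.mul (measurable_id.pow_const 2).inv).aestronglyMeasurable
    set J := ∫ w : ℂ, (ball (0 : ℂ) L).indicator (fun w => ‖w‖ ^ (-(2 - α / 2))) w
    have hJ : 0 ≤ J := integral_nonneg fun w =>
      Set.indicator_nonneg (fun w _ => by positivity) _
    refine ⟨1 / 2, by norm_num, 2 * C * J, by positivity, α / 2, by linarith, by linarith,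
      fun z hz z' hz' => ?_⟩
    have hzz : ‖z - z'‖ ≤ 1 := by
      rw [← dist_eq_norm]
      rw [mem_ball] at hz hz'
      linarith [dist_triangle_right z z' z₀]
    rw [← integral_sub (hint z hz) (hint z' hz')]
    refine (norm_integral_le_of_norm_le
      ((integrable_indicator_norm_rpow_neg (s := 2 - α / 2) (by linarith) L).const_mul
        (2 * C * ‖z - z'‖ ^ (α / 2))) (.of_forall fun w => ?_)).trans_eq ?_
    · rw [← sub_mul]
      exact norm_mul_inv_sq_le (by positivity)
        (beurlingNum_sub_le hC0 hα hC hM hL1 (hzL z hz) (hzL z' hz') hzz w)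
    · rw [integral_const_mul]
      ring
  · rw [show wirtingerDbar (cauchyT H) = fun z => -Real.pi * H z from
      funext fun z => (wirtinger_of_hasFDerivAt (hd z)).2]
    exact (contDiffAt_const.holderNear).mul (hHn z)

/-- A function that is Hölder near a point can be cut off to a globally Hölder function. -/
theorem HolderNear.exists_cutoff {h : ℂ → ℂ} {z₀ : ℂ} (hh : HolderNear h z₀) :
    ∃ φ : ℂ → ℂ, (∀ n : ℕ, ContDiff ℝ n φ) ∧ φ =ᶠ[nhds z₀] 1 ∧
      ∃ C ≥ 0, ∃ α : ℝ, 0 < α ∧ α ≤ 1 ∧ (∀ x y, ‖φ x * h x - φ y * h y‖ ≤ C * ‖x - y‖ ^ α) ∧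
        ∃ M, ∀ x, M ≤ ‖x‖ → φ x = 0 := by
  obtain ⟨r₁, hr₁, C, hC, α, hα, hα1, H₁⟩ := hh
  -- With `r ≤ 1 / 2` all distances in the ball are at most 1, so the Lipschitz bound of the bump is
  -- also a Hölder bound of exponent `α`.
  set r := min r₁ (1 / 2) with hr
  have hr0 : 0 < r := by positivity
  have H : ∀ x ∈ ball z₀ r, ∀ y ∈ ball z₀ r, ‖h x - h y‖ ≤ C * ‖x - y‖ ^ α := fun x hx y hy =>
    H₁ x (ball_subset_ball (min_le_left _ _) hx) y (ball_subset_ball (min_le_left _ _) hy)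
  have hd1 : ∀ x ∈ ball z₀ r, ∀ y ∈ ball z₀ r, ‖x - y‖ ≤ 1 := fun x hx y hy => by
    rw [← dist_eq_norm]
    rw [mem_ball] at hx hy
    have : r ≤ 1 / 2 := min_le_right _ _
    linarith [dist_triangle_right x y z₀]
  set B := ‖h z₀‖ + C with hB
  have hB0 : 0 ≤ B := by positivity
  have hhB : ∀ x ∈ ball z₀ r, ‖h x‖ ≤ B := fun x hx => by
    have h1 := H x hx z₀ (mem_ball_self hr0)
    have h2 : ‖x - z₀‖ ^ α ≤ 1 :=
      Real.rpow_le_one (norm_nonneg _) (hd1 x hx z₀ (mem_ball_self hr0)) hα.le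
    have h3 : ‖h x‖ ≤ ‖h x - h z₀‖ + ‖h z₀‖ := by simpa using norm_add_le (h x - h z₀) (h z₀)
    nlinarith
  let f : ContDiffBump z₀ := ⟨r / 4, r / 2, by linarith, by linarith⟩
  set φ : ℂ → ℂ := fun x => (f x : ℂ) with hφ
  have hφc : ∀ n : ℕ, ContDiff ℝ n φ := fun n => ofRealCLM.contDiff.comp f.contDiff
  have hφs : HasCompactSupport φ := f.hasCompactSupport.comp_left (g := ((↑) : ℝ → ℂ)) ofReal_zero
  have hφ0 : ∀ x, x ∉ ball z₀ (r / 2) → φ x = 0 := fun x hx => by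
    have : f x = 0 := f.zero_of_le_dist (by simpa using hx)
    simp [hφ, this]
  have hφ1 : ∀ x, ‖φ x‖ ≤ 1 := fun x => by
    simp only [hφ, norm_real, Real.norm_of_nonneg f.nonneg]
    exact f.le_one
  obtain ⟨K, hK⟩ := (hφc 1).lipschitzWith_of_hasCompactSupport hφs (by simp)
  have hφh : ∀ x ∈ ball z₀ r, ‖φ x * h x‖ ≤ B := fun x hx => by
    rw [norm_mul]
    calc ‖φ x‖ * ‖h x‖ ≤ 1 * B := mul_le_mul (hφ1 x) (hhB x hx) (norm_nonneg _) zero_le_one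
      _ = B := one_mul B
  -- The three terms account for the variation of `h`, the variation of the bump, and pairs at
  -- distance at least `r / 2`, where the bound `B` of the product suffices.
  set C' := C + B * K + B * (2 / r) ^ α with hC'
  have hfar : ∀ x ∈ ball z₀ (r / 2), ∀ y, y ∉ ball z₀ r →
      ‖φ x * h x - φ y * h y‖ ≤ C' * ‖x - y‖ ^ α := by
    intro x hx y hy
    rw [hφ0 y fun h' => hy (ball_subset_ball (by linarith) h'), zero_mul, sub_zero]
    refine (hφh x (ball_subset_ball (by linarith) hx)).trans ?_
    have h1 : r / 2 ≤ ‖x - y‖ := by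
      rw [← dist_eq_norm]
      rw [mem_ball] at hx hy
      linarith [dist_triangle_left y z₀ x]
    have h2 : 1 ≤ (2 / r) ^ α * ‖x - y‖ ^ α := by
      rw [← Real.mul_rpow (by positivity) (norm_nonneg _)]
      refine Real.one_le_rpow ?_ hα.le
      rw [div_mul_eq_mul_div, le_div_iff₀ hr0]
      linarith
    have h3 : 0 ≤ (C + B * K) * ‖x - y‖ ^ α := by positivity
    calc B ≤ B * ((2 / r) ^ α * ‖x - y‖ ^ α) := le_mul_of_one_le_right hB0 h2
      _ ≤ C' * ‖x - y‖ ^ α := by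
          rw [hC']
          nlinarith
  refine ⟨φ, hφc, ?_, C', by positivity, α, hα, hα1, fun x y => ?_, ‖z₀‖ + r, fun x hx => ?_⟩
  · filter_upwards [f.eventuallyEq_one] with x hx
    simp [hφ, hx]
  · by_cases hx : x ∈ ball z₀ (r / 2)
    · by_cases hy : y ∈ ball z₀ r
      · have hx' : x ∈ ball z₀ r := ball_subset_ball (by linarith) hx
        have h1 : ‖x - y‖ ≤ ‖x - y‖ ^ α := by
          rcases eq_or_lt_of_le (norm_nonneg (x - y)) with h0 | h0
          · rw [← h0, Real.zero_rpow hα.ne']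
          · simpa using Real.rpow_le_rpow_of_exponent_ge h0 (hd1 x hx' y hy) hα1
        have h2 : 0 ≤ B * (2 / r) ^ α * ‖x - y‖ ^ α := by positivity
        calc ‖φ x * h x - φ y * h y‖ = ‖φ x * (h x - h y) + (φ x - φ y) * h y‖ := by ring_nf
          _ ≤ ‖φ x‖ * ‖h x - h y‖ + ‖φ x - φ y‖ * ‖h y‖ := by
              simpa only [norm_mul] using norm_add_le (φ x * (h x - h y)) ((φ x - φ y) * h y)
          _ ≤ 1 * (C * ‖x - y‖ ^ α) + (K * ‖x - y‖ ^ α) * B := by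
              refine add_le_add (mul_le_mul (hφ1 x) (H x hx' y hy) (norm_nonneg _) zero_le_one)
                (mul_le_mul ?_ (hhB y hy) (norm_nonneg _) (by positivity))
              exact (hK.norm_sub_le x y).trans (mul_le_mul_of_nonneg_left h1 K.2)
          _ ≤ _ := by
              rw [hC']
              nlinarith
      · exact hfar x hx y hy
    · by_cases hy : y ∈ ball z₀ (r / 2)
      · by_cases hx' : x ∈ ball z₀ r
        · have h1 : ‖x - y‖ ≤ ‖x - y‖ ^ α := by
            have hy' : y ∈ ball z₀ r := ball_subset_ball (by linarith) hy
            rcases eq_or_lt_of_le (norm_nonneg (x - y)) with h0 | h0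
            · rw [← h0, Real.zero_rpow hα.ne']
            · simpa using Real.rpow_le_rpow_of_exponent_ge h0 (hd1 x hx' y hy') hα1
          have h2 : 0 ≤ (C + B * (2 / r) ^ α) * ‖x - y‖ ^ α := by positivity
          have h3 : ‖φ x * h x - φ y * h y‖ = ‖φ x - φ y‖ * ‖h y‖ := by
            rw [hφ0 x hx, zero_mul, zero_sub, zero_sub, norm_neg, norm_neg, norm_mul]
          rw [h3]
          calc _ ≤ (K * ‖x - y‖ ^ α) * B :=
                mul_le_mul ((hK.norm_sub_le x y).trans (mul_le_mul_of_nonneg_left h1 K.2))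
                  (hhB y (ball_subset_ball (by linarith) hy)) (norm_nonneg _) (by positivity)
            _ ≤ _ := by
                rw [hC']
                nlinarith
        · rw [norm_sub_rev, norm_sub_rev x y]
          exact hfar y hy x hx'
      · rw [hφ0 x hx, hφ0 y hy]
        simp only [zero_mul, sub_zero, norm_zero]
        positivity
  · refine hφ0 x fun h' => ?_
    rw [mem_ball_iff_norm] at h'
    have : ‖x‖ ≤ ‖x - z₀‖ + ‖z₀‖ := by simpa using norm_add_le (x - z₀) z₀
    linarith

theorem integrable_mul_inv_sub_of_hasCompactSupport {H : ℂ → ℂ} (hc : Continuous H)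
    (hs : HasCompactSupport H) (z : ℂ) : Integrable fun ζ => H ζ * (ζ - z)⁻¹ := by
  obtain ⟨B, hB⟩ := hs.exists_bound_of_continuous hc
  exact integrable_mul_inv_sub (hc.integrable_of_hasCompactSupport hs) one_pos fun ζ _ => hB ζ

theorem cauchyT_add {H K : ℂ → ℂ} (hc : Continuous H) (hs : HasCompactSupport H)
    (kc : Continuous K) (ks : HasCompactSupport K) (z : ℂ) :
    cauchyT (fun ζ => H ζ + K ζ) z = cauchyT H z + cauchyT K z := by
  simp only [cauchyT, add_mul]
  exact integral_add (integrable_mul_inv_sub_of_hasCompactSupport hc hs z)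
    (integrable_mul_inv_sub_of_hasCompactSupport kc ks z)

theorem cauchyT_const_mul (c : ℂ) (H : ℂ → ℂ) (z : ℂ) :
    cauchyT (fun ζ => c * H ζ) z = c * cauchyT H z := by
  simp only [cauchyT, mul_assoc]
  exact integral_const_mul _ _

theorem IsHolderDiff.holderNear {k : ℕ} {h : ℂ → ℂ} {U : Set ℂ} (hU : IsOpen U)
    (H : IsHolderDiff k h U) {z : ℂ} (hz : z ∈ U) : HolderNear h z := by
  induction k with
  | zero => exact H z hz
  | succ k ih => exact ih (H.of_succ hU)

/-- Near a given point, the cut-off density is globally Hölder and the rest of the density vanishes,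
so the rest has a holomorphic transform there. -/
theorem isHolderDiff_one_cauchyT_of_hasCompactSupport {H : ℂ → ℂ} (hH : ∀ z, HolderNear H z)
    (hs : HasCompactSupport H) : IsHolderDiff 1 (cauchyT H) Set.univ := by
  have hc : Continuous H := continuous_iff_continuousAt.2 fun z => (hH z).continuousAt
  refine .of_local fun z₀ _ => ?_
  obtain ⟨φ, hφ, hφ1, C, hC, α, hα, hα1, hl, M, hM⟩ := (hH z₀).exists_cutoff
  obtain ⟨ε, hε, he⟩ := Metric.eventually_nhds_iff_ball.1 hφ1
  have hφc : Continuous φ := (hφ 0).continuous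
  refine ⟨ball z₀ ε, mem_ball_self hε, ?_⟩
  have h1 : IsHolderDiff 1 (cauchyT fun ζ => φ ζ * H ζ) (ball z₀ ε) :=
    (isHolderDiff_one_cauchyT hC hα hα1 hl fun x hx => by rw [hM x hx, zero_mul]).mono
      (Set.subset_univ _)
  have h2 : IsHolderDiff 1 (cauchyT fun ζ => (1 - φ ζ) * H ζ) (ball z₀ ε) := by
    refine DifferentiableOn.isHolderDiff isOpen_ball (cauchyT_far ?_ fun ζ hζ => ?_) 1
    · exact ((continuous_const.sub hφc).mul hc).integrable_of_hasCompactSupport hs.mul_left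
    · rw [he ζ hζ]
      simp
  refine (h1.add isOpen_ball h2).congr isOpen_ball fun z _ => ?_
  rw [← cauchyT_add (H := fun ζ => φ ζ * H ζ) (K := fun ζ => (1 - φ ζ) * H ζ) (hφc.mul hc)
    hs.mul_left ((continuous_const.sub hφc).mul hc) hs.mul_left]
  congr 1
  funext ζ
  ring

/-- The transform is the convolution of `H` with the locally integrable kernel `-t⁻¹`, so the
derivative may be put on `H`. -/
theorem hasFDerivAt_cauchyT_of_contDiff {H : ℂ → ℂ} (hH : ContDiff ℝ 1 H)
    (hs : HasCompactSupport H) (z : ℂ) :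
    ∃ D : ℂ →L[ℝ] ℂ, HasFDerivAt (cauchyT H) D z ∧
      ∀ v, D v = cauchyT (fun ζ => fderiv ℝ H ζ v) z := by
  have e : ∀ K : ℂ → ℂ, ∀ x, cauchyT K x =
      (convolution (fun t => -t⁻¹) K (ContinuousLinearMap.mul ℝ ℂ) volume) x := fun K x => by
    rw [convolution_def, cauchyT, ← integral_sub_left_eq_self _ volume x]
    congr 1
    funext t
    rw [sub_sub_cancel_left, inv_neg, mul_comm, ContinuousLinearMap.mul_apply']
  have hli : LocallyIntegrable (fun t : ℂ => -t⁻¹) := by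
    refine locallyIntegrable_of_norm_le_rpow (C := 1) (α := 1) (by simp) (by simp)
      (.of_forall fun t => ?_) measurable_inv.neg.aestronglyMeasurable
    rw [norm_neg, norm_inv, one_mul, Real.rpow_neg_one]
  have h := hs.hasFDerivAt_convolution_right (ContinuousLinearMap.mul ℝ ℂ) hli hH z
  refine ⟨_, h.congr_of_eventuallyEq (.of_forall (e H)), fun v => ?_⟩
  rw [convolution_precompR_apply _ hli (hs.fderiv ℝ) (hH.continuous_fderiv one_ne_zero), e]

theorem wirtinger_cauchyT {H : ℂ → ℂ} (hH : ContDiff ℝ 1 H) (hs : HasCompactSupport H) (z : ℂ) :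
    DifferentiableAt ℝ (cauchyT H) z ∧ wirtingerD (cauchyT H) z = cauchyT (wirtingerD H) z ∧
      wirtingerDbar (cauchyT H) z = cauchyT (wirtingerDbar H) z := by
  obtain ⟨D, hD, hDv⟩ := hasFDerivAt_cauchyT_of_contDiff hH hs z
  have hc : ∀ v, Continuous fun ζ => fderiv ℝ H ζ v := fun v =>
    (hH.continuous_fderiv one_ne_zero).clm_apply continuous_const
  have hsv : ∀ v, HasCompactSupport fun ζ => fderiv ℝ H ζ v := fun v => hs.fderiv_apply ℝ v
  have key : ∀ c : ℂ, cauchyT (fun ζ => (1 / 2) * (fderiv ℝ H ζ 1 + c * fderiv ℝ H ζ I)) z =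
      (1 / 2) * (D 1 + c * D I) := fun c => by
    rw [cauchyT_const_mul, cauchyT_add (K := fun ζ => c * fderiv ℝ H ζ I) (hc 1) (hsv 1) (continuous_const.mul (hc I))
      (hsv I).mul_left, cauchyT_const_mul, hDv, hDv]
  refine ⟨hD.differentiableAt, ?_, ?_⟩
  · rw [show wirtingerD H = fun ζ => (1 / 2) * (fderiv ℝ H ζ 1 + (-I) * fderiv ℝ H ζ I) from
      funext fun ζ => by unfold wirtingerD; ring, key, wirtingerD, hD.fderiv]
    ring
  · rw [show wirtingerDbar H = fun ζ => (1 / 2) * (fderiv ℝ H ζ 1 + I * fderiv ℝ H ζ I) from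
      funext fun ζ => by unfold wirtingerDbar; ring, key, wirtingerDbar, hD.fderiv]
    ring

theorem HasCompactSupport.wirtinger {H : ℂ → ℂ} (hs : HasCompactSupport H) :
    HasCompactSupport (wirtingerD H) ∧ HasCompactSupport (wirtingerDbar H) := by
  constructor
  · exact (hs.fderiv ℝ).comp_left (g := fun L : ℂ →L[ℝ] ℂ => (L 1 - I * L I) / 2) (by simp)
  · exact (hs.fderiv ℝ).comp_left (g := fun L : ℂ →L[ℝ] ℂ => (L 1 + I * L I) / 2) (by simp)

/-- The Cauchy transform gains one derivative. -/
theorem IsHolderDiff.cauchyT_succ {k : ℕ} {H : ℂ → ℂ} (hH : IsHolderDiff k H Set.univ)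
    (hs : HasCompactSupport H) : IsHolderDiff (k + 1) (cauchyT H) Set.univ := by
  induction k generalizing H with
  | zero => exact isHolderDiff_one_cauchyT_of_hasCompactSupport (fun z => hH z trivial) hs
  | succ k ih =>
    have h1 : ContDiff ℝ 1 H := by
      have := hH.contDiffOn isOpen_univ
      rw [contDiffOn_univ] at this
      exact this.of_le (by exact_mod_cast Nat.le_add_left 1 k)
    -- Both Wirtinger derivatives commute with the transform, so the induction passes to the
    -- derivatives of `H`.
    have h2 := wirtinger_cauchyT h1 hs
    exact ⟨fun z _ => (h2 z).1,
      (ih hH.2.1 hs.wirtinger.1).congr isOpen_univ fun z _ => (h2 z).2.1,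
      (ih hH.2.2 hs.wirtinger.2).congr isOpen_univ fun z _ => (h2 z).2.2⟩

/-- Regularity for the inhomogeneous Cauchy–Riemann equation. -/
theorem IsHolderDiff.of_dbar {k : ℕ} {w : ℂ → ℂ} {U : Set ℂ} (hU : IsOpen U)
    (hd : ∀ z ∈ U, DifferentiableAt ℝ w z) (hk : IsHolderDiff k (wirtingerDbar w) U) :
    IsHolderDiff (k + 1) w U := by
  refine .of_local fun z₀ hz₀ => ?_
  obtain ⟨r, hr, hrU⟩ := Metric.isOpen_iff.1 hU z₀ hz₀
  let f : ContDiffBump z₀ := ⟨r / 4, r / 2, by linarith, by linarith⟩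
  set φ : ℂ → ℂ := fun x => (f x : ℂ) with hφ
  have hφc : ∀ n : ℕ, ContDiff ℝ n φ := fun n => ofRealCLM.contDiff.comp f.contDiff
  have hφs : HasCompactSupport φ := f.hasCompactSupport.comp_left (g := ((↑) : ℝ → ℂ)) ofReal_zero
  have hφ0 : ∀ x, x ∉ ball z₀ (r / 2) → φ x = 0 := fun x hx => by
    have : f x = 0 := f.zero_of_le_dist (by simpa using hx)
    simp [hφ, this]
  have hφ1 : ∀ x ∈ ball z₀ (r / 4), φ x = 1 := fun x hx => by
    have : f x = 1 := f.one_of_mem_closedBall (ball_subset_closedBall hx)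
    simp [hφ, this]
  set H : ℂ → ℂ := fun ζ => φ ζ * wirtingerDbar w ζ with hHdef
  have hHk : IsHolderDiff k H Set.univ := by
    refine .of_local fun z _ => ?_
    by_cases hz : z ∈ U
    · exact ⟨U, hz, (ContDiffOn.isHolderDiff hU (hφc _).contDiffOn).mul hU hk⟩
    · refine ⟨(closedBall z₀ (r / 2))ᶜ, fun h' => hz (hrU (closedBall_subset_ball (by linarith) h')),
        ?_⟩
      refine (DifferentiableOn.isHolderDiff (h := fun _ => 0) isClosed_closedBall.isOpen_compl
        (differentiableOn_const 0) k).congr isClosed_closedBall.isOpen_compl fun x hx => ?_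
      simp only [hHdef]
      rw [hφ0 x fun h' => hx (ball_subset_closedBall h'), zero_mul]
  have hHs : HasCompactSupport H := hφs.mul_right
  have hHc : Continuous H := continuous_iff_continuousAt.2 fun z =>
    (hHk.holderNear isOpen_univ trivial).continuousAt
  have hT := hHk.cauchyT_succ hHs
  have hπ : (Real.pi : ℂ) ≠ 0 := ofReal_ne_zero.2 Real.pi_ne_zero
  have hV : ball z₀ (r / 4) ⊆ U := (ball_subset_ball (by linarith)).trans hrU
  -- Where the cutoff equals 1, `-π⁻¹ * cauchyT H` has the same `∂̄`-derivative as `w`. The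
  -- difference is holomorphic, so `w` inherits the smoothness of the transform.
  have hhol : DifferentiableOn ℂ (fun z => w z + (Real.pi : ℂ)⁻¹ * cauchyT H z)
      (ball z₀ (r / 4)) := fun z hz => by
    have h1 : HasDbarAt w (wirtingerDbar w z) z := ⟨hd z (hV hz), rfl⟩
    have h2 := (cauchyT_holderNear (hHc.integrable_of_hasCompactSupport hHs)
      (hHk.holderNear isOpen_univ (Set.mem_univ z))).const_mul (Real.pi : ℂ)⁻¹
    refine ((h1.add h2).congr_deriv ?_).differentiableAt_complex.differentiableWithinAt
    simp only [hHdef]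
    rw [hφ1 z hz]
    field_simp
    ring
  refine ⟨ball z₀ (r / 4), mem_ball_self (by positivity), ?_⟩
  have hc : IsHolderDiff (k + 1) (fun _ => -(Real.pi : ℂ)⁻¹) (ball z₀ (r / 4)) :=
    DifferentiableOn.isHolderDiff isOpen_ball (differentiableOn_const _) _
  refine ((hhol.isHolderDiff isOpen_ball (k + 1)).add isOpen_ball
    (hc.mul isOpen_ball (hT.mono (Set.subset_univ _)))).congr isOpen_ball fun z _ => ?_
  ring

/-! ### Potentials with weakly singular kernels and the calculus of their `∂̄`-derivatives. -/

/-- The potential of `h` over the closed disk with respect to the kernel `K`. -/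
noncomputable def diskPotential (R : ℝ) (K : ℂ → ℂ → ℂ) (h : ℂ → ℂ) (z : ℂ) : ℂ :=
  ∫ ζ in closedBall (0 : ℂ) R, K z ζ * h ζ

/-- Kernels on the closed disk with a weak singularity on the diagonal. -/
structure WeakKernel (R : ℝ) (K : ℂ → ℂ → ℂ) : Prop where
  meas : Measurable (Function.uncurry K)
  bound : ∃ C, ∀ z ∈ closedBall (0 : ℂ) R, ∀ ζ ∈ closedBall (0 : ℂ) R, z ≠ ζ →
    ‖K z ζ‖ ≤ C * ‖ζ - z‖⁻¹
  cont : ∀ z ∈ closedBall (0 : ℂ) R, ∀ ζ ∈ closedBall (0 : ℂ) R, z ≠ ζ →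
    ContinuousWithinAt (Function.uncurry K) (closedBall (0 : ℂ) R ×ˢ closedBall (0 : ℂ) R) (z, ζ)

theorem WeakKernel.add {R : ℝ} {K L : ℂ → ℂ → ℂ} (hK : WeakKernel R K) (hL : WeakKernel R L) :
    WeakKernel R fun z ζ => K z ζ + L z ζ := by
  obtain ⟨C, hC⟩ := hK.bound
  obtain ⟨C', hC'⟩ := hL.bound
  refine ⟨hK.meas.add hL.meas, ⟨C + C', fun z hz ζ hζ h => ?_⟩, fun z hz ζ hζ h =>
    (hK.cont z hz ζ hζ h).add (hL.cont z hz ζ hζ h)⟩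
  rw [add_mul]
  exact (norm_add_le _ _).trans (add_le_add (hC z hz ζ hζ h) (hC' z hz ζ hζ h))

theorem exists_bound_of_continuous_uncurry {φ : ℂ → ℂ → ℂ} (hφ : Continuous (Function.uncurry φ))
    (R : ℝ) : ∃ B, 0 ≤ B ∧ ∀ z ∈ closedBall (0 : ℂ) R, ∀ ζ ∈ closedBall (0 : ℂ) R, ‖φ z ζ‖ ≤ B := by
  obtain ⟨B, hB⟩ := ((isCompact_closedBall (0 : ℂ) R).prod
    (isCompact_closedBall (0 : ℂ) R)).exists_bound_of_continuousOn hφ.continuousOn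
  exact ⟨|B|, abs_nonneg B, fun z hz ζ hζ => (hB (z, ζ) ⟨hz, hζ⟩).trans (le_abs_self B)⟩

theorem WeakKernel.continuous_mul {R : ℝ} {K φ : ℂ → ℂ → ℂ} (hK : WeakKernel R K)
    (hφ : Continuous (Function.uncurry φ)) : WeakKernel R fun z ζ => φ z ζ * K z ζ := by
  obtain ⟨C, hC⟩ := hK.bound
  obtain ⟨B, hB0, hB⟩ := exists_bound_of_continuous_uncurry hφ R
  refine ⟨hφ.measurable.mul hK.meas, ⟨B * C, fun z hz ζ hζ h => ?_⟩, fun z hz ζ hζ h =>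
    hφ.continuousWithinAt.mul (hK.cont z hz ζ hζ h)⟩
  rw [norm_mul, mul_assoc]
  exact mul_le_mul (hB z hz ζ hζ) (hC z hz ζ hζ h) (norm_nonneg _) hB0

theorem weakKernel_of_continuous (R : ℝ) {φ : ℂ → ℂ → ℂ} (hφ : Continuous (Function.uncurry φ)) :
    WeakKernel R φ := by
  obtain ⟨B, hB0, hB⟩ := exists_bound_of_continuous_uncurry hφ R
  refine ⟨hφ.measurable, ⟨B * (2 * R), fun z hz ζ hζ h => ?_⟩, fun z hz ζ hζ h =>
    hφ.continuousWithinAt⟩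
  refine (hB z hz ζ hζ).trans ?_
  have h1 : 0 < ‖ζ - z‖ := norm_pos_iff.2 (sub_ne_zero.2 h.symm)
  have h2 : ‖ζ - z‖ ≤ 2 * R := by
    rw [mem_closedBall_zero_iff] at hz hζ
    linarith [norm_sub_le ζ z]
  rw [mul_assoc]
  refine le_mul_of_one_le_right hB0 ?_
  rwa [← div_eq_mul_inv, one_le_div h1]

theorem integrable_indicator_of_integrableOn_closedBall {R : ℝ} {h : ℂ → ℂ}
    (hh : IntegrableOn h (closedBall 0 R)) : Integrable ((closedBall (0 : ℂ) R).indicator h) :=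
  (integrable_indicator_iff measurableSet_closedBall).2 hh

theorem WeakKernel.integrableOn {R : ℝ} {K : ℂ → ℂ → ℂ} (hK : WeakKernel R K) {h : ℂ → ℂ}
    (hh : IntegrableOn h (closedBall 0 R)) {z : ℂ} (hz : z ∈ closedBall (0 : ℂ) R) {r M : ℝ}
    (hr : 0 < r) (hM : ∀ ζ ∈ ball z r ∩ closedBall 0 R, ‖h ζ‖ ≤ M) :
    IntegrableOn (fun ζ => K z ζ * h ζ) (closedBall 0 R) := by
  obtain ⟨C, hC⟩ := hK.bound
  have h1 := (integrable_indicator_of_integrableOn_closedBall hh).norm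
  obtain ⟨_, hI⟩ := exists_integral_rpow_neg_mul_le (s := 1) (M := |M|) h1 hr (fun ζ hζ => by
    rw [abs_norm]
    by_cases hζR : ζ ∈ closedBall (0 : ℂ) R
    · rw [Set.indicator_of_mem hζR]
      exact (hM ζ ⟨hζ, hζR⟩).trans (le_abs_self M)
    · rw [Set.indicator_of_notMem hζR, norm_zero]
      exact abs_nonneg M) zero_le_one one_lt_two
  have h2 := ((hI z (mem_ball_self (by positivity))).1.const_mul C).integrableOn
    (s := closedBall (0 : ℂ) R)
  refine Integrable.mono' h2 ((hK.meas.comp measurable_prodMk_left).aestronglyMeasurable.mul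
    hh.aestronglyMeasurable) ?_
  filter_upwards [ae_restrict_mem measurableSet_closedBall,
    ae_restrict_of_ae (measure_eq_zero_iff_ae_notMem.1 (measure_singleton z))] with ζ hζ hne
  rw [Set.indicator_of_mem hζ, Real.rpow_neg_one, norm_mul, ← mul_assoc]
  exact mul_le_mul_of_nonneg_right (hC z hz ζ hζ fun e => hne e.symm) (norm_nonneg _)

/-- Functions that are integrable over the disk and locally Hölder in its interior. -/
structure IsAdmissible (R : ℝ) (h : ℂ → ℂ) : Prop where
  integrableOn : IntegrableOn h (closedBall 0 R)
  holder : ∀ z ∈ ball (0 : ℂ) R, HolderNear h z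

theorem IsAdmissible.continuous_mul {R : ℝ} {h φ : ℂ → ℂ} (hh : IsAdmissible R h)
    (hφ : ContDiff ℝ 1 φ) : IsAdmissible R fun ζ => φ ζ * h ζ :=
  ⟨hh.integrableOn.continuousOn_mul hφ.continuous.continuousOn (isCompact_closedBall _ _),
    fun z hz => (hφ.contDiffAt.holderNear).mul (hh.holder z hz)⟩

theorem IsAdmissible.conj {R : ℝ} {h : ℂ → ℂ} (hh : IsAdmissible R h) :
    IsAdmissible R fun ζ => conj (h ζ) :=
  ⟨(conjCLE : ℂ →L[ℝ] ℂ).integrable_comp hh.integrableOn, fun z hz => (hh.holder z hz).conj⟩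

theorem IsAdmissible.exists_bound {R : ℝ} {h : ℂ → ℂ} (hh : IsAdmissible R h) {z : ℂ}
    (hz : z ∈ ball (0 : ℂ) R) : ∃ r > 0, ∃ M, ∀ ζ ∈ ball z r, ‖h ζ‖ ≤ M := by
  have : ∀ᶠ ζ in nhds z, ‖h ζ‖ < ‖h z‖ + 1 :=
    (hh.holder z hz).continuousAt.norm.eventually_lt_const (by linarith)
  obtain ⟨r, hr, H⟩ := Metric.eventually_nhds_iff_ball.1 this
  exact ⟨r, hr, _, fun ζ hζ => (H ζ hζ).le⟩

theorem WeakKernel.integrableOn_admissible {R : ℝ} {K : ℂ → ℂ → ℂ} (hK : WeakKernel R K)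
    {h : ℂ → ℂ} (hh : IsAdmissible R h) {z : ℂ} (hz : z ∈ ball (0 : ℂ) R) :
    IntegrableOn (fun ζ => K z ζ * h ζ) (closedBall 0 R) := by
  obtain ⟨r, hr, M, hM⟩ := hh.exists_bound hz
  exact hK.integrableOn hh.integrableOn (ball_subset_closedBall hz) hr fun ζ hζ => hM ζ hζ.1

/-- `∂̄` of the potential with kernel `K` is the potential with kernel `K'` plus `c` times the
density. -/
structure DbarKernel (R : ℝ) (K K' : ℂ → ℂ → ℂ) (c : ℂ → ℂ) : Prop where
  weak : WeakKernel R K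
  weak' : WeakKernel R K'
  dbar : ∀ h, IsAdmissible R h → ∀ z ∈ ball (0 : ℂ) R,
    HasDbarAt (diskPotential R K h) (diskPotential R K' h z + c z * h z) z

theorem diskPotential_add {R : ℝ} {K L : ℂ → ℂ → ℂ} (hK : WeakKernel R K) (hL : WeakKernel R L)
    {h : ℂ → ℂ} (hh : IsAdmissible R h) {z : ℂ} (hz : z ∈ ball (0 : ℂ) R) :
    diskPotential R (fun z ζ => K z ζ + L z ζ) h z = diskPotential R K h z + diskPotential R L h z := by
  simp only [diskPotential, add_mul]
  exact integral_add (hK.integrableOn_admissible hh hz) (hL.integrableOn_admissible hh hz)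

theorem diskPotential_left_mul (R : ℝ) (K : ℂ → ℂ → ℂ) (a h : ℂ → ℂ) (z : ℂ) :
    diskPotential R (fun z ζ => a z * K z ζ) h z = a z * diskPotential R K h z := by
  simp only [diskPotential, mul_assoc]
  exact integral_const_mul _ _

theorem diskPotential_right_mul (R : ℝ) (K : ℂ → ℂ → ℂ) (a h : ℂ → ℂ) (z : ℂ) :
    diskPotential R (fun z ζ => a ζ * K z ζ) h z = diskPotential R K (fun ζ => a ζ * h ζ) z := by
  simp only [diskPotential]
  congr 1
  funext ζ
  ring

theorem diskPotential_congr {R : ℝ} {K L : ℂ → ℂ → ℂ} {h k : ℂ → ℂ} {z : ℂ}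
    (hKL : ∀ ζ, z ≠ ζ → K z ζ = L z ζ) (hhk : Set.EqOn h k (ball 0 R)) :
    diskPotential R K h z = diskPotential R L k z := by
  refine setIntegral_congr_ae measurableSet_closedBall ?_
  filter_upwards [measure_eq_zero_iff_ae_notMem.1 (measure_singleton z),
    measure_eq_zero_iff_ae_notMem.1 (Measure.addHaar_sphere volume (0 : ℂ) R)] with ζ h1 h2 h3
  rw [hKL ζ fun e => h1 e.symm, hhk]
  rw [mem_ball]
  exact lt_of_le_of_ne h3 h2

/-- The derivative kernel matters only off the diagonal, which is a null set for each fixed `z`.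
`WeakKernel`, however, involves measurability of all its values, so it is assumed for `L'`
separately. -/
theorem DbarKernel.congr {R : ℝ} {K K' L L' : ℂ → ℂ → ℂ} {c d : ℂ → ℂ} (H : DbarKernel R K K' c)
    (e : ∀ z ζ, L z ζ = K z ζ) (hL' : WeakKernel R L') (e' : ∀ z ζ, z ≠ ζ → L' z ζ = K' z ζ)
    (ec : ∀ z, d z = c z) : DbarKernel R L L' d := by
  obtain rfl : L = K := funext fun z => funext fun ζ => e z ζ
  obtain rfl : d = c := funext ec
  refine ⟨H.weak, hL', fun h hh z hz => (H.dbar h hh z hz).congr_deriv ?_⟩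
  rw [diskPotential_congr (e' z) fun _ _ => rfl]

theorem DbarKernel.congr' {R : ℝ} {K K' L L' : ℂ → ℂ → ℂ} {c d : ℂ → ℂ} (H : DbarKernel R K K' c)
    (e : ∀ z ζ, L z ζ = K z ζ) (e' : ∀ z ζ, L' z ζ = K' z ζ) (ec : ∀ z, d z = c z) :
    DbarKernel R L L' d := by
  obtain rfl : L' = K' := funext fun z => funext fun ζ => e' z ζ
  exact H.congr e H.weak' (fun _ _ _ => rfl) ec

theorem DbarKernel.add {R : ℝ} {K K' L L' : ℂ → ℂ → ℂ} {c d : ℂ → ℂ} (H : DbarKernel R K K' c)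
    (J : DbarKernel R L L' d) :
    DbarKernel R (fun z ζ => K z ζ + L z ζ) (fun z ζ => K' z ζ + L' z ζ) fun z => c z + d z := by
  refine ⟨H.weak.add J.weak, H.weak'.add J.weak', fun h hh z hz => ?_⟩
  refine (((H.dbar h hh z hz).add (J.dbar h hh z hz)).congr ?_).congr_deriv ?_
  · filter_upwards [isOpen_ball.mem_nhds hz] with w hw
    exact diskPotential_add H.weak J.weak hh hw
  · rw [diskPotential_add H.weak' J.weak' hh hz]
    ring

theorem DbarKernel.holomorphic_mul {R : ℝ} {K K' : ℂ → ℂ → ℂ} {c a : ℂ → ℂ}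
    (H : DbarKernel R K K' c) (ha : Differentiable ℂ a) :
    DbarKernel R (fun z ζ => a z * K z ζ) (fun z ζ => a z * K' z ζ) fun z => a z * c z := by
  have hc : Continuous (Function.uncurry fun z (_ : ℂ) => a z) := ha.continuous.comp continuous_fst
  refine ⟨H.weak.continuous_mul hc, H.weak'.continuous_mul hc, fun h hh z hz => ?_⟩
  refine (((ha z).hasDbarAt_zero.mul (H.dbar h hh z hz)).congr (.of_forall fun w =>
    diskPotential_left_mul R K a h w)).congr_deriv ?_
  rw [diskPotential_left_mul]
  ring

theorem DbarKernel.const_mul {R : ℝ} {K K' : ℂ → ℂ → ℂ} {c : ℂ → ℂ} (H : DbarKernel R K K' c)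
    (a : ℂ) : DbarKernel R (fun z ζ => a * K z ζ) (fun z ζ => a * K' z ζ) fun z => a * c z :=
  H.holomorphic_mul (differentiable_const a)

theorem DbarKernel.conj_mul {R : ℝ} {K K' : ℂ → ℂ → ℂ} {c : ℂ → ℂ} (H : DbarKernel R K K' c) :
    DbarKernel R (fun z ζ => conj z * K z ζ) (fun z ζ => K z ζ + conj z * K' z ζ)
      fun z => conj z * c z := by
  have hc : Continuous (Function.uncurry fun z (_ : ℂ) => conj z) :=
    continuous_conj.comp continuous_fst
  have hw := H.weak'.continuous_mul hc
  refine ⟨H.weak.continuous_mul hc, H.weak.add hw, fun h hh z hz => ?_⟩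
  refine (((hasDbarAt_conj z).mul (H.dbar h hh z hz)).congr (.of_forall fun w =>
    diskPotential_left_mul R K (fun z => conj z) h w)).congr_deriv ?_
  rw [diskPotential_add H.weak hw hh hz, diskPotential_left_mul R K' (fun z => conj z)]
  ring

theorem DbarKernel.density_mul {R : ℝ} {K K' : ℂ → ℂ → ℂ} {c a : ℂ → ℂ} (H : DbarKernel R K K' c)
    (ha : ContDiff ℝ 1 a) :
    DbarKernel R (fun z ζ => a ζ * K z ζ) (fun z ζ => a ζ * K' z ζ) fun z => a z * c z := by
  have hc : Continuous (Function.uncurry fun (_ : ℂ) ζ => a ζ) := ha.continuous.comp continuous_snd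
  refine ⟨H.weak.continuous_mul hc, H.weak'.continuous_mul hc, fun h hh z hz => ?_⟩
  refine ((H.dbar _ (hh.continuous_mul ha) z hz).congr (.of_forall fun w =>
    diskPotential_right_mul R K a h w)).congr_deriv ?_
  rw [diskPotential_right_mul]
  ring

theorem contDiff_conj {n : WithTop ℕ∞} : ContDiff ℝ n fun z : ℂ => conj z :=
  (conjCLE : ℂ →L[ℝ] ℂ).contDiff

/-- The term carrying the density itself disappears because the factor `ζ̄ - z̄` vanishes on the
diagonal. -/
theorem DbarKernel.conj_sub_mul {R : ℝ} {K K' : ℂ → ℂ → ℂ} {c : ℂ → ℂ} (H : DbarKernel R K K' c) :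
    DbarKernel R (fun z ζ => (conj ζ - conj z) * K z ζ)
      (fun z ζ => (conj ζ - conj z) * K' z ζ - K z ζ) 0 :=
  ((H.density_mul contDiff_conj).add (H.conj_mul.const_mul (-1))).congr' (fun z ζ => by ring)
    (fun z ζ => by ring) fun z => by simp

theorem DbarKernel.conj_sub_pow_mul {R : ℝ} {K K' : ℂ → ℂ → ℂ} (H : DbarKernel R K K' 0) (k : ℕ) :
    DbarKernel R (fun z ζ => (conj ζ - conj z) ^ k * K z ζ)
      (fun z ζ => (conj ζ - conj z) ^ k * K' z ζ - k * (conj ζ - conj z) ^ (k - 1) * K z ζ) 0 := by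
  induction k with
  | zero => simpa using H
  | succ k ih =>
    refine ih.conj_sub_mul.congr' (fun z ζ => by ring) (fun z ζ => ?_) fun _ => rfl
    -- The exponent `k - 1` is truncated at `k = 0`, where its coefficient is zero.
    rcases k with _ | k
    · simp
    · simp only [Nat.add_sub_cancel]
      push_cast
      ring

theorem DbarKernel.sub_mul {R : ℝ} {K K' : ℂ → ℂ → ℂ} (H : DbarKernel R K K' 0) :
    DbarKernel R (fun z ζ => (z - ζ) * K z ζ) (fun z ζ => (z - ζ) * K' z ζ) 0 :=
  ((H.holomorphic_mul differentiable_id).add ((H.density_mul contDiff_id).const_mul (-1))).congr'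
    (fun z ζ => by simp only [id]; ring) (fun z ζ => by simp only [id]; ring) fun z => by simp

theorem DbarKernel.sub_pow_mul {R : ℝ} {K K' : ℂ → ℂ → ℂ} (H : DbarKernel R K K' 0) (k : ℕ) :
    DbarKernel R (fun z ζ => (z - ζ) ^ k * K z ζ) (fun z ζ => (z - ζ) ^ k * K' z ζ) 0 := by
  induction k with
  | zero => simpa using H
  | succ k ih =>
    exact ih.sub_mul.congr' (fun z ζ => by ring) (fun z ζ => by ring) fun _ => rfl

theorem dbarKernel_zero (R : ℝ) : DbarKernel R (fun _ _ => 0) (fun _ _ => 0) 0 := by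
  have : WeakKernel R fun _ _ => 0 := weakKernel_of_continuous R continuous_const
  refine ⟨this, this, fun h _ z _ => ?_⟩
  have e : diskPotential R (fun _ _ => 0) h = fun _ => 0 := by
    funext w
    simp [diskPotential]
  rw [e]
  exact (hasDbarAt_const 0 z).congr_deriv (by simp)

theorem dbarKernel_one (R : ℝ) : DbarKernel R (fun _ _ => 1) (fun _ _ => 0) 0 := by
  refine ⟨weakKernel_of_continuous R continuous_const, (dbarKernel_zero R).weak, fun h _ z _ => ?_⟩
  refine (hasDbarAt_const (∫ ζ in closedBall (0 : ℂ) R, h ζ) z).congr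
    (.of_forall fun w => by simp [diskPotential]) |>.congr_deriv (by simp [diskPotential])

theorem DbarKernel.sum {R : ℝ} {ι : Type*} {s : Finset ι} {K K' : ι → ℂ → ℂ → ℂ}
    (H : ∀ i ∈ s, DbarKernel R (K i) (K' i) 0) :
    DbarKernel R (fun z ζ => ∑ i ∈ s, K i z ζ) (fun z ζ => ∑ i ∈ s, K' i z ζ) 0 := by
  classical
  induction s using Finset.induction_on with
  | empty => simpa using dbarKernel_zero R
  | insert a s ha ih =>
    refine ((H a (by simp)).add (ih fun i hi => H i (by simp [hi]))).congr'
      (fun z ζ => Finset.sum_insert ha) (fun z ζ => Finset.sum_insert ha) fun z => by simp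

/-- Kernels holomorphic in the first variable, of the form `a z * b ζ`. -/
theorem dbarKernel_separated (R : ℝ) {a b : ℂ → ℂ} (ha : Differentiable ℂ a) (hb : ContDiff ℝ 1 b) :
    DbarKernel R (fun z ζ => a z * b ζ) (fun _ _ => 0) 0 :=
  (((dbarKernel_one R).density_mul hb).holomorphic_mul ha).congr' (fun z ζ => by ring)
    (fun z ζ => by ring) fun z => by simp

/-! ### The two basic kernels: Cauchy and logarithmic. -/

theorem weakKernel_inv_sub (R : ℝ) : WeakKernel R fun z ζ => (ζ - z)⁻¹ := by
  refine ⟨(measurable_snd.sub measurable_fst).inv, ⟨1, fun z _ ζ _ _ => by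
    rw [norm_inv, one_mul]⟩, fun z _ ζ _ h => ?_⟩
  exact ((continuousAt_snd.sub continuousAt_fst).inv₀ (sub_ne_zero.2 h.symm)).continuousWithinAt

theorem weakKernel_inv_conj_sub (R : ℝ) : WeakKernel R fun z ζ => (conj ζ - conj z)⁻¹ := by
  have e : (fun z ζ : ℂ => (conj ζ - conj z)⁻¹) = fun z ζ => conj ((ζ - z)⁻¹) := by
    funext z ζ
    simp
  rw [e]
  obtain ⟨hm, ⟨C, hC⟩, hc⟩ := weakKernel_inv_sub R
  refine ⟨continuous_conj.measurable.comp hm, ⟨C, fun z hz ζ hζ h => ?_⟩, fun z hz ζ hζ h =>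
    continuous_conj.continuousAt.comp_continuousWithinAt (hc z hz ζ hζ h)⟩
  rw [RCLike.norm_conj]
  exact hC z hz ζ hζ h

theorem diskPotential_eq_integral_indicator (R : ℝ) (K : ℂ → ℂ → ℂ) (h : ℂ → ℂ) (z : ℂ) :
    diskPotential R K h z = ∫ ζ, K z ζ * (closedBall (0 : ℂ) R).indicator h ζ := by
  rw [diskPotential, ← integral_indicator measurableSet_closedBall]
  congr 1
  funext ζ
  simp only [Set.indicator]
  split_ifs <;> simp

theorem indicator_closedBall_eventuallyEq {R : ℝ} (h : ℂ → ℂ) {z : ℂ} (hz : z ∈ ball (0 : ℂ) R) :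
    (closedBall (0 : ℂ) R).indicator h =ᶠ[nhds z] h := by
  filter_upwards [isOpen_ball.mem_nhds hz] with w hw
  exact Set.indicator_of_mem (ball_subset_closedBall hw) h

theorem dbarKernel_inv_sub (R : ℝ) :
    DbarKernel R (fun z ζ => (ζ - z)⁻¹) (fun _ _ => 0) fun _ => -Real.pi := by
  refine ⟨weakKernel_inv_sub R, (dbarKernel_zero R).weak, fun h hh z hz => ?_⟩
  have e := indicator_closedBall_eventuallyEq h hz
  refine ((cauchyT_holderNear (integrable_indicator_of_integrableOn_closedBall hh.integrableOn)
    ((hh.holder z hz).congr e)).congr (.of_forall fun w => ?_)).congr_deriv ?_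
  · rw [diskPotential_eq_integral_indicator, cauchyT]
    simp only [mul_comm]
  · rw [e.eq_of_nhds]
    simp [diskPotential]

/-- First-order expansion of `log ‖1 - w‖`. For `‖w‖ ≤ 1 / 2` it follows from `1 - 1/x ≤ log x ≤ x -
1` at `x = ‖1 - w‖²`. For larger `w` it is crude, the pole at `w = 1` being absorbed by `‖1 - w‖ ^
(-1/2)`. -/
theorem abs_log_norm_one_sub_add_re_le {w : ℂ} (hw : w ≠ 1) :
    |Real.log ‖1 - w‖ + w.re| ≤ 13 * (‖w‖ ^ (3 / 2 : ℝ) * (1 + ‖1 - w‖ ^ (-(1 / 2) : ℝ))) := by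
  set ω := ‖w‖ with hω
  set t := ‖1 - w‖ with ht
  have hω0 : 0 ≤ ω := norm_nonneg _
  have ht0 : 0 < t := norm_pos_iff.2 (sub_ne_zero.2 hw.symm)
  have hre : |w.re| ≤ ω := abs_re_le_norm w
  have htsq : t ^ 2 = 1 - 2 * w.re + ω ^ 2 := by
    rw [ht, hω, ← normSq_eq_norm_sq, ← normSq_eq_norm_sq, normSq_apply, normSq_apply]
    simp only [sub_re, one_re, sub_im, one_im]
    ring
  have ht1 : t ≤ 1 + ω := by simpa [ht, hω] using norm_sub_le 1 w
  have ht2 : 1 - ω ≤ t := by simpa [ht, hω] using norm_sub_norm_le 1 w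
  have h32 : ω ^ (3 / 2 : ℝ) = ω * √ω := by
    rw [show (3 / 2 : ℝ) = 1 + 1 / 2 by norm_num, Real.rpow_add' hω0 (by norm_num), Real.rpow_one,
      Real.sqrt_eq_rpow]
  set s := √ω
  have hs0 : 0 ≤ s := Real.sqrt_nonneg _
  have hs : s * s = ω := Real.mul_self_sqrt hω0
  set τ := t ^ (-(1 / 2) : ℝ)
  have hτ : 0 < τ := by positivity
  rw [h32]
  have hre' := abs_le.1 hre
  rcases le_total ω (1 / 2) with h | h
  · have hs1 : s ≤ 1 := by
      rw [← Real.sqrt_one]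
      exact Real.sqrt_le_sqrt (by linarith)
    have hωs : ω ^ 2 ≤ ω * s := by nlinarith [mul_nonneg hω0 hs0]
    have hlog : Real.log t = Real.log (t ^ 2) / 2 := by
      rw [Real.log_pow]
      push_cast
      ring
    have hup := Real.log_le_sub_one_of_pos (pow_pos ht0 2)
    have hlow := Real.one_sub_inv_le_log_of_pos (pow_pos ht0 2)
    have htq : 1 / 4 ≤ t ^ 2 := by nlinarith
    have hinv : 1 - (t ^ 2)⁻¹ - (t ^ 2 - 1) = -((t ^ 2 - 1) ^ 2 * (t ^ 2)⁻¹) := by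
      field_simp
      ring
    have hinv4 : (t ^ 2)⁻¹ ≤ 4 := by
      rw [inv_le_comm₀ (by positivity) (by norm_num)]
      linarith
    have hsq : (t ^ 2 - 1) ^ 2 ≤ 25 / 4 * ω ^ 2 := by
      rw [htsq]
      have h1 : |1 - 2 * w.re + ω ^ 2 - 1| ≤ 5 / 2 * ω := by
        rw [abs_le]
        constructor <;> nlinarith
      have := sq_le_sq' (by linarith [(abs_le.1 h1).1]) (abs_le.1 h1).2
      nlinarith
    have hprod : (t ^ 2 - 1) ^ 2 * (t ^ 2)⁻¹ ≤ 25 / 4 * ω ^ 2 * 4 :=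
      mul_le_mul hsq hinv4 (by positivity) (by positivity)
    have hfin : ω * s ≤ ω * s * (1 + τ) := le_mul_of_one_le_right (by positivity) (by linarith)
    rw [hlog, abs_le]
    constructor <;> nlinarith
  · have hs1 : 1 / 2 ≤ s := by nlinarith
    have hωs : ω ≤ 2 * (ω * s) := by nlinarith
    have h1s : 1 ≤ 4 * (ω * s) := by nlinarith
    have hup := Real.log_le_sub_one_of_pos ht0
    -- This is `log τ ≤ τ - 1` at `τ = t ^ (-1/2)`, where `log τ = -(log t) / 2`.
    have hlow : -(2 * τ) ≤ Real.log t := by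
      have h1 := Real.log_le_sub_one_of_pos hτ
      rw [Real.log_rpow ht0] at h1
      linarith
    have h2 : 0 ≤ ω * s := by positivity
    have h3 : τ ≤ 4 * (ω * s) * τ := le_mul_of_one_le_left hτ.le h1s
    have h4 : 0 ≤ ω * s * τ := by positivity
    rw [abs_le]
    constructor <;> nlinarith

/-- The expansion at `w = (z - z₀) / (ζ - z₀)`. The exponent `3 / 2` serves twice: it exceeds 1 as a
power of the increment and stays below 2 as a singularity. -/
theorem log_norm_remainder_le {ζ z z₀ : ℂ} (hz : ζ ≠ z) (hz₀ : ζ ≠ z₀) :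
    |Real.log ‖ζ - z‖ - Real.log ‖ζ - z₀‖ + ((z - z₀) / (ζ - z₀)).re| ≤
      ‖z - z₀‖ ^ (3 / 2 : ℝ) *
        ((‖ζ - z‖ ^ (-(3 / 2) : ℝ) + ‖ζ - z₀‖ ^ (-(3 / 2) : ℝ)) * 26) := by
  have h1 : ζ - z ≠ 0 := sub_ne_zero.2 hz
  have h2 : ζ - z₀ ≠ 0 := sub_ne_zero.2 hz₀
  set x := ‖ζ - z‖ with hx
  set y := ‖ζ - z₀‖ with hy
  set d := ‖z - z₀‖ with hd
  have hx0 : 0 < x := norm_pos_iff.2 h1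
  have hy0 : 0 < y := norm_pos_iff.2 h2
  have hd0 : 0 ≤ d := norm_nonneg _
  have e : 1 - (z - z₀) / (ζ - z₀) = (ζ - z) / (ζ - z₀) := by
    field_simp
    ring
  have h3 : (z - z₀) / (ζ - z₀) ≠ 1 := by
    intro h
    rw [h, sub_self] at e
    exact div_ne_zero h1 h2 e.symm
  have h4 := abs_log_norm_one_sub_add_re_le h3
  rw [e, norm_div, norm_div, ← hx, ← hy, ← hd, Real.log_div hx0.ne' hy0.ne'] at h4
  refine h4.trans ?_
  have e1 : (d / y) ^ (3 / 2 : ℝ) = d ^ (3 / 2 : ℝ) * y ^ (-(3 / 2) : ℝ) := by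
    rw [Real.div_rpow hd0 hy0.le, Real.rpow_neg hy0.le, div_eq_mul_inv]
  have e2 : y ^ (-(3 / 2) : ℝ) * (x / y) ^ (-(1 / 2) : ℝ) =
      x ^ (-(1 / 2) : ℝ) * y ^ (-(1 : ℝ)) := by
    rw [Real.div_rpow hx0.le hy0.le, div_eq_mul_inv (x ^ _), ← Real.rpow_neg hy0.le (-(1 / 2)),
      mul_left_comm, ← Real.rpow_add hy0]
    norm_num
  have h5 := rpow_neg_mul_rpow_neg_le hx0 hy0 (by norm_num : (0 : ℝ) ≤ 1 / 2) zero_le_one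
  rw [show (1 / 2 + 1 : ℝ) = 3 / 2 by norm_num] at h5
  have h6 : 0 ≤ x ^ (-(3 / 2) : ℝ) := by positivity
  calc 13 * ((d / y) ^ (3 / 2 : ℝ) * (1 + (x / y) ^ (-(1 / 2) : ℝ)))
      = d ^ (3 / 2 : ℝ) * (13 * (y ^ (-(3 / 2) : ℝ) +
          y ^ (-(3 / 2) : ℝ) * (x / y) ^ (-(1 / 2) : ℝ))) := by
        rw [e1]
        ring
    _ ≤ _ := by
        rw [e2]
        refine mul_le_mul_of_nonneg_left ?_ (by positivity)
        linarith

theorem abs_log_le_add_inv {x : ℝ} (hx : 0 ≤ x) : |Real.log x| ≤ x + x⁻¹ := by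
  rcases eq_or_lt_of_le hx with rfl | hx
  · simp
  · have h1 := Real.log_le_sub_one_of_pos hx
    have h2 := Real.one_sub_inv_le_log_of_pos hx
    have h3 : 0 < x⁻¹ := by positivity
    rw [abs_le]
    constructor <;> linarith

theorem integrable_log_norm_mul {H : ℂ → ℂ} (hH : Integrable H) {R : ℝ}
    (hR : ∀ ζ, ζ ∉ closedBall (0 : ℂ) R → H ζ = 0) {z : ℂ} {r M : ℝ} (hr : 0 < r)
    (hM : ∀ ζ ∈ ball z r, ‖H ζ‖ ≤ M) : Integrable fun ζ => (Real.log ‖ζ - z‖ : ℂ) * H ζ := by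
  have h1 := (integrable_mul_inv_sub hH hr hM).norm.add (hH.norm.const_mul (R + ‖z‖))
  refine h1.mono' (((measurable_ofReal.comp (Real.measurable_log.comp
    (measurable_id.sub_const z).norm)).aestronglyMeasurable).mul hH.aestronglyMeasurable)
    (.of_forall fun ζ => ?_)
  rw [norm_mul, norm_real, Real.norm_eq_abs, Pi.add_apply, norm_mul, norm_inv]
  by_cases hζ : ζ ∈ closedBall (0 : ℂ) R
  · have h2 := abs_log_le_add_inv (norm_nonneg (ζ - z))
    have h3 : ‖ζ - z‖ ≤ R + ‖z‖ := by
      rw [mem_closedBall_zero_iff] at hζ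
      linarith [norm_sub_le ζ z]
    have h4 := norm_nonneg (H ζ)
    nlinarith [mul_le_mul_of_nonneg_right (h2.trans (add_le_add_left h3 _)) h4]
  · simp [hR ζ hζ]

/-- The logarithmic potential. -/
theorem hasDbarAt_logPotential {H : ℂ → ℂ} (hH : Integrable H) {R : ℝ}
    (hR : ∀ ζ, ζ ∉ closedBall (0 : ℂ) R → H ζ = 0) {z₀ : ℂ} {r M : ℝ} (hr : 0 < r)
    (hM : ∀ ζ ∈ ball z₀ r, ‖H ζ‖ ≤ M) :
    HasDbarAt (fun z => ∫ ζ, (Real.log ‖ζ - z‖ : ℂ) * H ζ)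
      (∫ ζ, -(1 / 2) * ((conj ζ - conj z₀)⁻¹ * H ζ)) z₀ := by
  have hp0 := integrable_mul_inv_sub hH hr hM
  have hp : Integrable fun ζ => -(1 / 2 : ℂ) * ((ζ - z₀)⁻¹ * H ζ) := by
    refine Integrable.const_mul ?_ _
    simpa only [mul_comm] using hp0
  have hq : Integrable fun ζ => -(1 / 2 : ℂ) * ((conj ζ - conj z₀)⁻¹ * H ζ) := by
    refine Integrable.const_mul (hp0.mono (((continuous_conj.measurable.sub_const
      (conj z₀)).inv.aestronglyMeasurable).mul hH.aestronglyMeasurable)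
      (.of_forall fun ζ => ?_)) _
    change ‖(conj ζ - conj z₀)⁻¹ * H ζ‖ ≤ _
    rw [norm_mul, norm_mul, norm_inv, norm_inv, ← map_sub, RCLike.norm_conj, mul_comm]
  -- The logarithm is one order milder than the Cauchy kernel, so a bounded density is enough here
  -- and no Hölder condition enters.
  refine .of_hasFDerivAt (hasFDerivAt_integral_of_remainder_le
    (k := fun z ζ => (Real.log ‖ζ - z‖ : ℂ) * H ζ) (m := fun ζ => 26 * ‖H ζ‖) (r := r)
    (M := 26 * M) (s := 3 / 2) (γ := 3 / 2) (hH.norm.const_mul 26) (fun ζ => by positivity) hr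
    (fun ζ hζ => mul_le_mul_of_nonneg_left (hM ζ hζ) (by norm_num)) (by norm_num) (by norm_num)
    (by norm_num) (fun z hz => integrable_log_norm_mul hH hR (by positivity : 0 < r / 2)
      fun ζ hζ => hM ζ ?_) hp hq fun z _ ζ hz hz₀ => ?_)
  · rw [mem_ball] at hz hζ ⊢
    linarith [dist_triangle ζ z z₀]
  · have h2 : ζ - z₀ ≠ 0 := sub_ne_zero.2 hz₀
    have hre : (((z - z₀) / (ζ - z₀)).re : ℂ) =
        (1 / 2) * ((z - z₀) * (ζ - z₀)⁻¹ + conj (z - z₀) * (conj ζ - conj z₀)⁻¹) := by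
      rw [re_eq_add_conj]
      simp only [map_mul, map_inv₀, map_sub, div_eq_mul_inv]
      ring
    have e : (Real.log ‖ζ - z‖ : ℂ) * H ζ - (Real.log ‖ζ - z₀‖ : ℂ) * H ζ -
        (-(1 / 2) * ((ζ - z₀)⁻¹ * H ζ) * (z - z₀) +
          -(1 / 2) * ((conj ζ - conj z₀)⁻¹ * H ζ) * conj (z - z₀)) =
        ((Real.log ‖ζ - z‖ - Real.log ‖ζ - z₀‖ + ((z - z₀) / (ζ - z₀)).re : ℝ) : ℂ) * H ζ := by
      push_cast
      rw [hre]
      ring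
    rw [e, norm_mul, norm_real, Real.norm_eq_abs]
    calc _ ≤ _ := mul_le_mul_of_nonneg_right (log_norm_remainder_le hz hz₀) (norm_nonneg _)
      _ = _ := by ring

/-- The logarithmic part of the Green kernel. -/
noncomputable def logKernel (R : ℝ) (z ζ : ℂ) : ℂ :=
  Complex.log (((R : ℂ) ^ 2 - z * conj ζ) / ((‖z - ζ‖ ^ 2 : ℝ) : ℂ))

/-- Twice the real part minus `‖z - ζ‖²` equals `2R² - ‖z‖² - ‖ζ‖²`. -/
theorem norm_sub_sq_le_re {R : ℝ} {z ζ : ℂ} (hz : z ∈ closedBall (0 : ℂ) R)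
    (hζ : ζ ∈ closedBall (0 : ℂ) R) : ‖z - ζ‖ ^ 2 ≤ 2 * ((R : ℂ) ^ 2 - z * conj ζ).re := by
  rw [mem_closedBall_zero_iff] at hz hζ
  have h1 : ‖z‖ ^ 2 ≤ R ^ 2 := pow_le_pow_left₀ (norm_nonneg _) hz 2
  have h2 : ‖ζ‖ ^ 2 ≤ R ^ 2 := pow_le_pow_left₀ (norm_nonneg _) hζ 2
  have h3 : ((R : ℂ) ^ 2 - z * conj ζ).re = R ^ 2 - (z.re * ζ.re + z.im * ζ.im) := by
    rw [← ofReal_pow, sub_re, ofReal_re, mul_re, conj_re, conj_im]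
    ring
  rw [← normSq_eq_norm_sq, normSq_apply] at h1 h2 ⊢
  rw [h3]
  simp only [sub_re, sub_im]
  nlinarith

/-- Keeps the argument of the logarithm in a right half-plane, for boundary points as well, so the
principal branch is continuous off the diagonal. -/
theorem logKernel_arg_mem_slitPlane {R : ℝ} {z ζ : ℂ} (hz : z ∈ closedBall (0 : ℂ) R)
    (hζ : ζ ∈ closedBall (0 : ℂ) R) (h : z ≠ ζ) :
    1 / 2 ≤ (((R : ℂ) ^ 2 - z * conj ζ) / ((‖z - ζ‖ ^ 2 : ℝ) : ℂ)).re := by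
  have h1 : 0 < ‖z - ζ‖ ^ 2 := by
    have := norm_pos_iff.2 (sub_ne_zero.2 h)
    positivity
  rw [div_ofReal_re, le_div_iff₀ h1]
  linarith [norm_sub_sq_le_re hz hζ]

theorem weakKernel_logKernel (R : ℝ) : WeakKernel R (logKernel R) := by
  refine ⟨?_, ⟨(1 + Real.pi) * (2 * R) + 4 * R, fun z hz ζ hζ h => ?_⟩, fun z hz ζ hζ h => ?_⟩
  · have h1 : Measurable fun p : ℂ × ℂ => (R : ℂ) ^ 2 - p.1 * conj p.2 :=
      measurable_const.sub (measurable_fst.mul (continuous_conj.measurable.comp measurable_snd))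
    have h2 : Measurable fun p : ℂ × ℂ => ((‖p.1 - p.2‖ ^ 2 : ℝ) : ℂ) :=
      measurable_ofReal.comp ((measurable_fst.sub measurable_snd).norm.pow_const 2)
    exact measurable_log.comp (h1.div h2)
  · have hd : 0 < ‖z - ζ‖ := norm_pos_iff.2 (sub_ne_zero.2 h)
    have hre := logKernel_arg_mem_slitPlane hz hζ h
    set q := ((R : ℂ) ^ 2 - z * conj ζ) / ((‖z - ζ‖ ^ 2 : ℝ) : ℂ) with hq
    have hq1 : 1 / 2 ≤ ‖q‖ := hre.trans ((le_abs_self _).trans (abs_re_le_norm q))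
    have hR0 : 0 ≤ R := by
      rw [mem_closedBall_zero_iff] at hz
      exact (norm_nonneg _).trans hz
    have hd2 : ‖z - ζ‖ ≤ 2 * R := by
      rw [mem_closedBall_zero_iff] at hz hζ
      linarith [norm_sub_le z ζ]
    have hq2 : ‖q‖ ≤ (2 * R / ‖z - ζ‖) ^ 2 := by
      rw [hq, norm_div, norm_real, Real.norm_of_nonneg (by positivity), div_pow]
      refine div_le_div_of_nonneg_right ?_ (by positivity)
      rw [mem_closedBall_zero_iff] at hz hζ
      calc ‖(R : ℂ) ^ 2 - z * conj ζ‖ ≤ ‖(R : ℂ) ^ 2‖ + ‖z * conj ζ‖ := norm_sub_le _ _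
        _ = R ^ 2 + ‖z‖ * ‖ζ‖ := by
            rw [norm_pow, norm_real, norm_mul, RCLike.norm_conj, Real.norm_of_nonneg hR0]
        _ ≤ R ^ 2 + R * R := by gcongr
        _ ≤ _ := by nlinarith
    have hlow : -1 ≤ Real.log ‖q‖ := by
      have h1 := Real.one_sub_inv_le_log_of_pos (by linarith : 0 < ‖q‖)
      have h2 : ‖q‖⁻¹ ≤ 2 := by
        rw [inv_le_comm₀ (by linarith) (by norm_num)]
        linarith
      linarith
    have hx0 : 0 < 2 * R / ‖z - ζ‖ := by
      have : 0 < R := by linarith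
      positivity
    have hup : Real.log ‖q‖ ≤ 2 * (2 * R / ‖z - ζ‖) := by
      have h1 := Real.log_le_log (by linarith : 0 < ‖q‖) hq2
      rw [Real.log_pow] at h1
      have h2 := Real.log_le_sub_one_of_pos hx0
      push_cast at h1
      linarith
    have habs : |Real.log ‖q‖| ≤ 1 + 2 * (2 * R / ‖z - ζ‖) := by
      rw [abs_le]
      constructor <;> linarith
    have h1 : ‖logKernel R z ζ‖ ≤ |Real.log ‖q‖| + Real.pi := by
      refine (norm_le_abs_re_add_abs_im _).trans ?_
      rw [logKernel, log_re, log_im]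
      exact add_le_add_right (abs_arg_le_pi _) _
    have h2 : 1 ≤ 2 * R * ‖z - ζ‖⁻¹ := by
      rwa [← div_eq_mul_inv, one_le_div hd]
    rw [norm_sub_rev ζ z]
    rw [div_eq_mul_inv] at habs
    nlinarith [Real.pi_pos]
  · have hre := logKernel_arg_mem_slitPlane hz hζ h
    have h1 : ContinuousAt (fun p : ℂ × ℂ => ((R : ℂ) ^ 2 - p.1 * conj p.2) /
        ((‖p.1 - p.2‖ ^ 2 : ℝ) : ℂ)) (z, ζ) := by
      refine ContinuousAt.div ?_ ?_ ?_
      · exact (continuous_const.sub (continuous_fst.mul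
          (continuous_conj.comp continuous_snd))).continuousAt
      · exact (continuous_ofReal.comp ((continuous_fst.sub continuous_snd).norm.pow 2)).continuousAt
      · have := norm_pos_iff.2 (sub_ne_zero.2 h)
        exact ofReal_ne_zero.2 (by positivity)
    exact (h1.clog (Or.inl (by linarith))).continuousWithinAt

/-- For `z` in a smaller disk of radius `ρ` the real part of `R² - z ζ̄` is at least `R² - ρR > 0`,
which dominates the `z`-derivative uniformly in `ζ`. -/
theorem differentiableAt_integral_log {H : ℂ → ℂ} (hH : Integrable H) {R : ℝ}
    (hR : ∀ ζ, ζ ∉ closedBall (0 : ℂ) R → H ζ = 0) {z₀ : ℂ} (hz₀ : z₀ ∈ ball (0 : ℂ) R) :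
    DifferentiableAt ℂ (fun z => ∫ ζ, Complex.log ((R : ℂ) ^ 2 - z * conj ζ) * H ζ) z₀ ∧
      ∀ᶠ z in nhds z₀, Integrable fun ζ => Complex.log ((R : ℂ) ^ 2 - z * conj ζ) * H ζ := by
  have hz₀' := mem_ball_zero_iff.1 hz₀
  obtain ⟨ρ, hρ1, hρ2⟩ := exists_between hz₀'
  have hR0 : 0 < R := (norm_nonneg z₀).trans_lt hz₀'
  have hρ0 : 0 ≤ ρ := (norm_nonneg z₀).trans hρ1.le
  set δ := R ^ 2 - ρ * R with hδ
  have hδ0 : 0 < δ := by nlinarith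
  have hs : ball (0 : ℂ) ρ ∈ nhds z₀ := isOpen_ball.mem_nhds (mem_ball_zero_iff.2 hρ1)
  have hre : ∀ z ∈ ball (0 : ℂ) ρ, ∀ ζ ∈ closedBall (0 : ℂ) R,
      δ ≤ ((R : ℂ) ^ 2 - z * conj ζ).re := fun z hz ζ hζ => by
    rw [mem_ball_zero_iff] at hz
    rw [mem_closedBall_zero_iff] at hζ
    have h1 : (z * conj ζ).re ≤ ρ * R := by
      refine (re_le_norm _).trans ?_
      rw [norm_mul, RCLike.norm_conj]
      exact mul_le_mul hz.le hζ (norm_nonneg _) hρ0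
    rw [sub_re, ← ofReal_pow, ofReal_re]
    linarith
  have hmeas : ∀ z, AEStronglyMeasurable (fun ζ => Complex.log ((R : ℂ) ^ 2 - z * conj ζ) * H ζ) :=
    fun z => ((measurable_log.comp (measurable_const.sub (measurable_const.mul
      continuous_conj.measurable))).aestronglyMeasurable).mul hH.aestronglyMeasurable
  have hint : ∀ z ∈ ball (0 : ℂ) ρ,
      Integrable fun ζ => Complex.log ((R : ℂ) ^ 2 - z * conj ζ) * H ζ := fun z hz => by
    have hc : ContinuousOn (fun ζ => Complex.log ((R : ℂ) ^ 2 - z * conj ζ)) (closedBall 0 R) := by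
      refine ContinuousOn.clog ?_ fun ζ hζ => Or.inl (hδ0.trans_le (hre z hz ζ hζ))
      exact (continuous_const.sub (continuous_const.mul continuous_conj)).continuousOn
    obtain ⟨B, hB⟩ := (isCompact_closedBall (0 : ℂ) R).exists_bound_of_continuousOn hc
    refine (hH.norm.const_mul B).mono' (hmeas z) (.of_forall fun ζ => ?_)
    rw [norm_mul]
    by_cases hζ : ζ ∈ closedBall (0 : ℂ) R
    · exact mul_le_mul_of_nonneg_right (hB ζ hζ) (norm_nonneg _)
    · simp [hR ζ hζ]
  refine ⟨?_, by filter_upwards [hs] with z hz using hint z hz⟩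
  refine (hasDerivAt_integral_of_dominated_loc_of_deriv_le (μ := volume)
    (F := fun z ζ => Complex.log ((R : ℂ) ^ 2 - z * conj ζ) * H ζ)
    (F' := fun z ζ => -conj ζ / ((R : ℂ) ^ 2 - z * conj ζ) * H ζ)
    (bound := fun ζ => R / δ * ‖H ζ‖) hs (.of_forall hmeas) (hint z₀ (mem_of_mem_nhds hs)) ?_
    (.of_forall fun ζ z hz => ?_) (hH.norm.const_mul _)
    (.of_forall fun ζ z hz => ?_)).2.differentiableAt
  · exact ((continuous_conj.measurable.neg.div (measurable_const.sub (measurable_const.mul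
      continuous_conj.measurable))).aestronglyMeasurable).mul hH.aestronglyMeasurable
  · by_cases hζ : ζ ∈ closedBall (0 : ℂ) R
    · rw [norm_mul, norm_div, norm_neg, RCLike.norm_conj]
      refine mul_le_mul_of_nonneg_right ?_ (norm_nonneg _)
      exact div_le_div₀ hR0.le (mem_closedBall_zero_iff.1 hζ) hδ0
        ((hre z hz ζ hζ).trans (re_le_norm _))
    · simp [hR ζ hζ]
  · by_cases hζ : ζ ∈ closedBall (0 : ℂ) R
    · have h1 : HasDerivAt (fun z => (R : ℂ) ^ 2 - z * conj ζ) (-conj ζ) z := by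
        simpa using ((hasDerivAt_id z).mul_const (conj ζ)).const_sub ((R : ℂ) ^ 2)
      exact (h1.clog (Or.inl (hδ0.trans_le (hre z hz ζ hζ)))).mul_const _
    · simp only [hR ζ hζ, mul_zero]
      exact hasDerivAt_const z 0

/-- The kernel is `log (R² - z ζ̄) - 2 log ‖ζ - z‖`: the first term is holomorphic in `z`, and the
second contributes `-2 * (-1/2)` times `(ζ̄ - z̄)⁻¹`. -/
theorem dbarKernel_logKernel (R : ℝ) :
    DbarKernel R (logKernel R) (fun z ζ => (conj ζ - conj z)⁻¹) 0 := by
  refine ⟨weakKernel_logKernel R, weakKernel_inv_conj_sub R, fun h hh z₀ hz₀ => ?_⟩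
  set H := (closedBall (0 : ℂ) R).indicator h with hHdef
  have hH : Integrable H := integrable_indicator_of_integrableOn_closedBall hh.integrableOn
  have hR : ∀ ζ, ζ ∉ closedBall (0 : ℂ) R → H ζ = 0 := fun ζ hζ => Set.indicator_of_notMem hζ h
  obtain ⟨r, hr, M, hM⟩ := hh.exists_bound hz₀
  have hM' : ∀ ζ ∈ ball z₀ r, ‖H ζ‖ ≤ M := fun ζ hζ =>
    (norm_indicator_le_norm_self _ _).trans (hM ζ hζ)
  obtain ⟨h1, h2⟩ := differentiableAt_integral_log hH hR hz₀
  have h3 := (hasDbarAt_logPotential hH hR hr hM').const_mul (-2)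
  refine ((h1.hasDbarAt_zero.add h3).congr ?_).congr_deriv ?_
  · filter_upwards [h2, isOpen_ball.mem_nhds hz₀, ball_mem_nhds z₀ (by positivity : 0 < r / 2)]
      with z hz hzR hzr
    have h4 : Integrable fun ζ => (Real.log ‖ζ - z‖ : ℂ) * H ζ :=
      integrable_log_norm_mul hH hR (by positivity : 0 < r / 2) fun ζ hζ => hM' ζ (by
        rw [mem_ball] at hzr hζ ⊢
        linarith [dist_triangle ζ z z₀])
    rw [diskPotential_eq_integral_indicator, ← integral_const_mul,
      ← integral_add hz (h4.const_mul _)]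
    refine integral_congr_ae ?_
    filter_upwards [measure_eq_zero_iff_ae_notMem.1 (measure_singleton z)] with ζ hne
    have hne : z ≠ ζ := fun e => hne e.symm
    by_cases hζ : ζ ∈ closedBall (0 : ℂ) R
    · have hd : 0 < ‖z - ζ‖ := norm_pos_iff.2 (sub_ne_zero.2 hne)
      have h5 : (R : ℂ) ^ 2 - z * conj ζ ≠ 0 := fun h0 => by
        have := norm_sub_sq_le_re (ball_subset_closedBall hzR) hζ
        rw [h0, zero_re] at this
        nlinarith [pow_pos hd 2]
      -- The principal logarithm splits here because the denominator is a positive real.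
      rw [logKernel, div_eq_mul_inv, ← ofReal_inv, log_mul_ofReal _ (by positivity) _ h5,
        Real.log_inv, Real.log_pow, norm_sub_rev ζ z]
      push_cast
      ring
    · change logKernel R z ζ * H ζ = _
      rw [hR ζ hζ]
      ring
  · rw [diskPotential_eq_integral_indicator, ← integral_const_mul]
    simp only [Pi.zero_apply, zero_mul, add_zero, zero_add]
    congr 1
    funext ζ
    ring

/-! ### The `∂̄`-recursions of the Green kernels. -/

/-- The constant `(2 * I)⁻¹` cancels the factor `2 * I` in `dζ̄ ∧ dζ`. -/
theorem dbarKernel_greenKer_one (R : ℝ) :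
    DbarKernel R (fun z ζ => greenKer z ζ 1) (fun _ _ => 0) fun _ => (2 * I)⁻¹ := by
  refine ((dbarKernel_inv_sub R).const_mul (-(2 * Real.pi * I)⁻¹)).congr' (fun z ζ => ?_)
    (fun z ζ => by ring) fun z => ?_
  · simp only [greenKer, Nat.sub_self, pow_zero, pow_one, Nat.factorial_zero, Nat.cast_one,
      div_eq_mul_inv, mul_inv]
    ring
  · have : (Real.pi : ℂ) ≠ 0 := ofReal_ne_zero.2 Real.pi_ne_zero
    field_simp

/-- One factor `ζ̄ - z̄` removes the term with the density; the remaining powers obey the usual rule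
and the factorial absorbs `l + 1`. -/
theorem dbarKernel_greenKer (R : ℝ) (l : ℕ) :
    DbarKernel R (fun z ζ => greenKer z ζ (l + 2)) (fun z ζ => greenKer z ζ (l + 1)) 0 := by
  refine (((dbarKernel_inv_sub R).conj_sub_mul.conj_sub_pow_mul l).const_mul
    ((-1) ^ (l + 2) / (2 * Real.pi * I * ((l + 1).factorial : ℂ)))).congr' (fun z ζ => ?_)
    (fun z ζ => ?_) fun z => by simp
  · simp only [greenKer, Nat.add_succ_sub_one, div_eq_mul_inv, mul_inv]
    ring
  · have e : (conj ζ - conj z) ^ l * ((conj ζ - conj z) * 0 - (ζ - z)⁻¹) -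
        l * (conj ζ - conj z) ^ (l - 1) * ((conj ζ - conj z) * (ζ - z)⁻¹) =
        -((l + 1) * ((conj ζ - conj z) ^ l * (ζ - z)⁻¹)) := by
      rcases l with _ | l
      · simp
      · simp only [Nat.add_sub_cancel]
        push_cast
        ring
    rw [e]
    have hl : (l : ℂ) + 1 ≠ 0 := by exact_mod_cast Nat.succ_ne_zero l
    simp only [greenKer, Nat.add_sub_cancel, Nat.factorial_succ, div_eq_mul_inv, mul_inv]
    push_cast
    field_simp
    ring

theorem weakKernel_greenKer (R : ℝ) (l : ℕ) : WeakKernel R fun z ζ => greenKer z ζ (l + 1) :=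
  (dbarKernel_greenKer R l).weak'

/-- Every summand is a power of `z` times a smooth function of `ζ`. Holomorphy in `z` is all that
the recursion for `kerC3` needs from `kerC1`, and likewise from `kerC2`. -/
theorem dbarKernel_kerC1 (R : ℝ) (k : ℕ) :
    DbarKernel R (fun z ζ => kerC1 z ζ k) (fun _ _ => 0) 0 := by
  refine (DbarKernel.sum (s := Finset.Ico 1 k)
    (K := fun l z ζ => (-(ζ ^ l) / (l : ℂ)) * ∑ j ∈ Finset.range (k - l),
      (((k - 1).choose j : ℂ) * z ^ (k - 1 - l - j)) * (-ζ) ^ j)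
    (K' := fun l _ ζ => (-(ζ ^ l) / (l : ℂ)) * ∑ j ∈ Finset.range (k - l), 0) fun l _ =>
    (DbarKernel.sum fun j _ => dbarKernel_separated R (by fun_prop) (by fun_prop)).density_mul
      (by fun_prop) |>.congr' (fun _ _ => rfl) (fun _ _ => rfl) fun z => by simp).congr'
    (fun z ζ => rfl) (fun z ζ => by simp) fun z => rfl

theorem dbarKernel_kerC2 (R : ℝ) (l k : ℕ) :
    DbarKernel R (fun z ζ => kerC2 R z ζ l k) (fun _ _ => 0) 0 := by
  refine (DbarKernel.sum (s := Finset.range (l + 1))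
    (K := fun p z ζ => ∑ q ∈ Finset.range k, if p ≤ q then
      (l.choose p : ℂ) * ((k - 1).choose q : ℂ) * (R : ℂ) ^ (2 * p) * (-(conj ζ)) ^ (l - p) *
        (-ζ) ^ (k - 1 - q) * z ^ (q - p) else 0)
    (K' := fun p _ ζ => ∑ q ∈ Finset.range k, 0) fun p _ => DbarKernel.sum fun q _ => ?_).congr'
    (fun z ζ => rfl) (fun z ζ => by simp) fun z => rfl
  by_cases h : p ≤ q
  · simp only [h, if_true]
    refine (dbarKernel_separated R (a := fun z => z ^ (q - p)) (b := fun ζ =>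
      (l.choose p : ℂ) * ((k - 1).choose q : ℂ) * (R : ℂ) ^ (2 * p) * (-(conj ζ)) ^ (l - p) *
        (-ζ) ^ (k - 1 - q)) (by fun_prop) ?_).congr' (fun z ζ => by ring) (fun _ _ => rfl)
      fun _ => rfl
    exact (contDiff_const.mul (contDiff_conj.neg.pow _)).mul (contDiff_id.neg.pow _)
  · simp only [h, if_false]
    exact dbarKernel_zero R

/-- The summands of `kerC3`, without their binomial factor. -/
noncomputable def kerC3Summand (R : ℝ) (k l : ℕ) (z ζ : ℂ) : ℂ :=
  1 / (l : ℂ) * (kerC2 R z ζ l k - (-1) ^ l * ((conj ζ - conj z) ^ l * (z - ζ) ^ (k - 1)))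

theorem kerC3_succ_eq (R : ℝ) (a b : ℂ) (m k : ℕ) :
    kerC3 R a b (m + 1) k = (conj b - conj a) ^ m *
        (kerC1 a b k + (a - b) ^ (k - 1) * logKernel R a b) +
      ∑ l ∈ Finset.Ico 1 (m + 1), (m.choose l : ℂ) * ((conj b - conj a) ^ (m - l) *
        kerC3Summand R k l a b) := by
  unfold kerC3 logKernel kerC3Summand
  simp only [Nat.add_sub_cancel]
  congr 1
  refine Finset.sum_congr rfl fun l _ => ?_
  rw [← neg_sub (conj b) (conj a), neg_pow]
  ring

theorem dbarKernel_kerC3_main (R : ℝ) (k : ℕ) :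
    DbarKernel R (fun z ζ => kerC1 z ζ k + (z - ζ) ^ (k - 1) * logKernel R z ζ)
      (fun z ζ => (z - ζ) ^ (k - 1) * (conj ζ - conj z)⁻¹) 0 :=
  ((dbarKernel_kerC1 R k).add ((dbarKernel_logKernel R).sub_pow_mul (k - 1))).congr'
    (fun _ _ => rfl) (fun z ζ => by ring) fun _ => by simp

theorem dbarKernel_kerC3_one (R : ℝ) (k : ℕ) :
    DbarKernel R (fun z ζ => kerC3 R z ζ 1 k)
      (fun z ζ => (z - ζ) ^ (k - 1) * (conj ζ - conj z)⁻¹) 0 :=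
  (dbarKernel_kerC3_main R k).congr' (fun z ζ => by simp [kerC3_succ_eq R z ζ 0 k])
    (fun _ _ => rfl) fun _ => rfl

theorem dbarKernel_kerC3Summand (R : ℝ) {l : ℕ} (hl : 1 ≤ l) (k : ℕ) :
    DbarKernel R (kerC3Summand R k l)
      (fun z ζ => -((-1) ^ l * ((conj ζ - conj z) ^ (l - 1) * ((z - ζ) ^ (k - 1) * -1)))) 0 := by
  have hl : (l : ℂ) ≠ 0 := by exact_mod_cast (by omega : l ≠ 0)
  have h1 := ((dbarKernel_one R).sub_pow_mul (k - 1)).conj_sub_pow_mul l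
  refine (((dbarKernel_kerC2 R l k).add (h1.const_mul (-(-1) ^ l))).const_mul
    (1 / (l : ℂ))).congr' (fun z ζ => ?_) (fun z ζ => ?_) fun z => by simp
  · unfold kerC3Summand
    ring
  · field_simp
    ring

/-- The expansion of `(-1 + 1) ^ (m + 1) = 0` without its term `l = 0`. -/
theorem sum_Ico_choose_mul_neg_one_pow (m : ℕ) :
    ∑ l ∈ Finset.Ico 1 (m + 2), ((m + 1).choose l : ℂ) * (-1) ^ l = -1 := by
  have h := (Commute.one_right (-1 : ℂ)).add_pow (m + 1)
  simp only [neg_add_cancel, one_pow, mul_one] at h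
  rw [zero_pow (Nat.succ_ne_zero m), Finset.range_eq_Ico,
    Finset.sum_eq_sum_Ico_succ_bot (by omega)] at h
  simp only [pow_zero, Nat.choose_zero_right, Nat.cast_one, mul_one] at h
  rw [← sub_eq_zero, sub_neg_eq_add, add_comm, h]
  congr 1
  exact Finset.sum_congr rfl fun l _ => mul_comm ((m + 1).choose l : ℂ) _

/-- The `∂̄`-derivative of `kerC3`, before simplification. -/
theorem dbarKernel_kerC3_aux (R : ℝ) (m k : ℕ) :
    DbarKernel R (fun z ζ => kerC3 R z ζ (m + 1) k)
      (fun z ζ => ((conj ζ - conj z) ^ m * ((z - ζ) ^ (k - 1) * (conj ζ - conj z)⁻¹) -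
          m * (conj ζ - conj z) ^ (m - 1) *
            (kerC1 z ζ k + (z - ζ) ^ (k - 1) * logKernel R z ζ)) +
        ∑ l ∈ Finset.Ico 1 (m + 1), (m.choose l : ℂ) * ((conj ζ - conj z) ^ (m - l) *
            -((-1) ^ l * ((conj ζ - conj z) ^ (l - 1) * ((z - ζ) ^ (k - 1) * -1))) -
          (m - l : ℕ) * (conj ζ - conj z) ^ (m - l - 1) * kerC3Summand R k l z ζ)) 0 :=
  (((dbarKernel_kerC3_main R k).conj_sub_pow_mul m).add (DbarKernel.sum fun l hl =>
    (((dbarKernel_kerC3Summand R (Finset.mem_Ico.1 hl).1 k).conj_sub_pow_mul (m - l)).const_mul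
      (m.choose l : ℂ)).congr' (fun _ _ => rfl) (fun _ _ => rfl) fun _ => by simp)).congr'
    (fun z ζ => kerC3_succ_eq R z ζ m k) (fun _ _ => rfl) fun _ => by simp

/-- Differentiating the leading power and the binomial coefficients produces the factor `-(m + 1)`.
The new term `(ζ̄ - z̄)^m (z - ζ)^(k-1)` from the logarithm is cancelled by the derivatives of the
summands, because their alternating binomial sum is `-1`. -/
theorem dbarKernel_kerC3 (R : ℝ) (m k : ℕ) :
    DbarKernel R (fun z ζ => kerC3 R z ζ (m + 2) k)
      (fun z ζ => -(m + 1) * kerC3 R z ζ (m + 1) k) 0 := by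
  -- The cancellation of `ζ̄ - z̄` against its inverse is valid only off the diagonal, so weakness
  -- of the simplified kernel is supplied from the preceding order.
  have hw := ((dbarKernel_kerC3_aux R m k).const_mul (-(m + 1))).weak
  refine (dbarKernel_kerC3_aux R (m + 1) k).congr (fun _ _ => rfl) hw (fun z ζ hne => ?_)
    fun _ => rfl
  have hX : conj ζ - conj z ≠ 0 := by
    rw [← map_sub]
    exact (map_ne_zero _).2 (sub_ne_zero.2 hne.symm)
  rw [kerC3_succ_eq]
  set X := conj ζ - conj z
  set Y := (z - ζ) ^ (k - 1)
  set P := kerC1 z ζ k + Y * logKernel R z ζ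
  have h1 : X ^ (m + 1) * (Y * X⁻¹) = X ^ m * Y := by
    field_simp
    ring
  have h2 : ∑ l ∈ Finset.Ico 1 (m + 2), ((m + 1).choose l : ℂ) *
      (X ^ (m + 1 - l) * -((-1) ^ l * (X ^ (l - 1) * (Y * -1))) -
        (m + 1 - l : ℕ) * X ^ (m + 1 - l - 1) * kerC3Summand R k l z ζ) =
      X ^ m * Y * ∑ l ∈ Finset.Ico 1 (m + 2), ((m + 1).choose l : ℂ) * (-1) ^ l -
      (m + 1) * ∑ l ∈ Finset.Ico 1 (m + 1), (m.choose l : ℂ) *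
        (X ^ (m - l) * kerC3Summand R k l z ζ) := by
    have h3 : ∑ l ∈ Finset.Ico 1 (m + 2), ((m + 1).choose l : ℂ) *
        ((m + 1 - l : ℕ) * X ^ (m + 1 - l - 1) * kerC3Summand R k l z ζ) =
        (m + 1) * ∑ l ∈ Finset.Ico 1 (m + 1), (m.choose l : ℂ) *
        (X ^ (m - l) * kerC3Summand R k l z ζ) := by
      rw [Finset.sum_Ico_succ_top (by omega), Nat.sub_self, Finset.mul_sum]
      simp only [Nat.cast_zero, zero_mul, mul_zero, add_zero]
      refine Finset.sum_congr rfl fun l hl => ?_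
      have hc : (m.choose l : ℂ) * (m + 1) = ((m + 1).choose l : ℂ) * ((m + 1 - l : ℕ) : ℂ) := by
        exact_mod_cast Nat.choose_mul_succ_eq m l
      rw [show m + 1 - l - 1 = m - l by omega]
      linear_combination (-(X ^ (m - l) * kerC3Summand R k l z ζ)) * hc
    rw [← h3, Finset.mul_sum, ← Finset.sum_sub_distrib]
    refine Finset.sum_congr rfl fun l hl => ?_
    have hl' := Finset.mem_Ico.1 hl
    have hx : X ^ (m + 1 - l) * X ^ (l - 1) = X ^ m := by
      rw [← pow_add]
      congr 1
      omega
    rw [← hx]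
    ring
  rw [h1, h2, sum_Ico_choose_mul_neg_one_pow]
  push_cast
  ring

theorem dbarKernel_greenKer₂ (R : ℝ) (m k : ℕ) :
    DbarKernel R (fun z ζ => greenKer₂ R z ζ (m + 2) k) (fun z ζ => greenKer₂ R z ζ (m + 1) k) 0 := by
  have hm : (m : ℂ) + 1 ≠ 0 := by exact_mod_cast Nat.succ_ne_zero m
  refine ((dbarKernel_kerC3 R m k).const_mul ((-1) ^ (m + 2) / (2 * (Real.pi : ℂ) * I *
    ((m + 2 - 1).factorial : ℂ) * ((k - 1).factorial : ℂ)))).congr' (fun _ _ => rfl) (fun z ζ => ?_)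
    fun _ => by simp
  rw [greenKer₂, show m + 2 - 1 = m + 1 from rfl, Nat.add_sub_cancel, Nat.factorial_succ]
  simp only [div_eq_mul_inv, mul_inv]
  push_cast
  field_simp
  ring

theorem weakKernel_greenKer₂ (R : ℝ) (m k : ℕ) :
    WeakKernel R fun z ζ => greenKer₂ R z ζ (m + 1) k :=
  (dbarKernel_greenKer₂ R m k).weak'

/-- The derivative of the logarithm supplies `(ζ̄ - z̄)⁻¹`, the conjugate Cauchy kernel. This is the
junction at which the `∂̄`-steps end and the conjugated `∂`-steps begin. -/
theorem dbarKernel_greenKer₂_one (R : ℝ) (k : ℕ) :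
    DbarKernel R (fun z ζ => greenKer₂ R z ζ 1 (k + 1))
      (fun z ζ => -conj (greenKer z ζ (k + 1))) 0 := by
  refine ((dbarKernel_kerC3_one R (k + 1)).const_mul ((-1) ^ 1 / (2 * (Real.pi : ℂ) * I *
    ((1 - 1).factorial : ℂ) * ((k + 1 - 1).factorial : ℂ)))).congr'
    (fun z ζ => by rw [greenKer₂]) (fun z ζ => ?_) fun _ => by simp
  simp only [greenKer, Nat.add_sub_cancel, Nat.sub_self, Nat.factorial_zero, Nat.cast_one,
    map_inv₀, map_mul, map_pow, map_sub, map_neg, map_one, conj_conj, conj_I, conj_ofReal,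
    map_natCast, map_ofNat, div_eq_mul_inv, mul_inv]
  rw [← neg_sub ζ z, neg_pow (ζ - z), inv_neg]
  ring

/-! ### Mapping properties of potentials over the disk. -/

/-- On the product of the disks the integrand is dominated by the convolution integrand of `‖h‖`
with a truncation of `‖w‖⁻¹`; Fubini gives the rest. -/
theorem WeakKernel.integrableOn_diskPotential {R : ℝ} {K : ℂ → ℂ → ℂ} (hK : WeakKernel R K)
    {h : ℂ → ℂ} (hh : IntegrableOn h (closedBall 0 R)) :
    IntegrableOn (diskPotential R K h) (closedBall 0 R) := by
  classical
  obtain ⟨C, hC⟩ := hK.bound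
  -- The bound of a weak kernel says nothing on the diagonal, so the value there is replaced by 0.
  set L : ℂ → ℂ → ℂ := fun z ζ => if z = ζ then 0 else K z ζ with hL
  have hLm : Measurable (Function.uncurry L) :=
    Measurable.ite (measurableSet_eq_fun measurable_fst measurable_snd) measurable_const hK.meas
  have e : diskPotential R K h = fun z => ∫ ζ in closedBall (0 : ℂ) R, L z ζ * h ζ := by
    funext z
    exact diskPotential_congr (L := L) (fun ζ hne => by simp [hL, hne]) fun _ _ => rfl
  have hconv := ((integrable_indicator_of_integrableOn_closedBall hh).norm.convolution_integrand
    (ContinuousLinearMap.mul ℝ ℝ)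
    (integrable_indicator_norm_rpow_neg (s := 1) (by norm_num) (2 * R + 1))).const_mul |C|
  rw [e]
  refine Integrable.integral_prod_left (f := fun p : ℂ × ℂ => L p.1 p.2 * h p.2)
    (μ := volume.restrict (closedBall (0 : ℂ) R)) (ν := volume.restrict (closedBall (0 : ℂ) R)) ?_
  refine Integrable.mono' (g := fun p : ℂ × ℂ => |C| * (ContinuousLinearMap.mul ℝ ℝ
    ‖(closedBall (0 : ℂ) R).indicator h p.2‖ ((ball (0 : ℂ) (2 * R + 1)).indicator
      (fun w => ‖w‖ ^ (-(1 : ℝ))) (p.1 - p.2)))) ?_ ?_ ?_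
  · rw [Measure.prod_restrict]
    exact hconv.integrableOn
  · exact hLm.aestronglyMeasurable.mul hh.aestronglyMeasurable.comp_snd
  · rw [Measure.prod_restrict]
    filter_upwards [ae_restrict_mem (measurableSet_closedBall.prod measurableSet_closedBall)]
      with p hp
    obtain ⟨h1, h2⟩ := hp
    have h3 : p.1 - p.2 ∈ ball (0 : ℂ) (2 * R + 1) := by
      rw [mem_closedBall_zero_iff] at h1 h2
      rw [mem_ball_zero_iff]
      linarith [norm_sub_le p.1 p.2]
    rw [ContinuousLinearMap.mul_apply', Set.indicator_of_mem h2, Set.indicator_of_mem h3,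
      Real.rpow_neg_one, norm_mul]
    by_cases hne : p.1 = p.2
    · simp [hL, hne]
    · have h4 := hC _ h1 _ h2 hne
      have h5 : ‖L p.1 p.2‖ ≤ |C| * ‖p.1 - p.2‖⁻¹ := by
        simp only [hL, hne, if_false]
        rw [norm_sub_rev] at h4
        exact h4.trans (mul_le_mul_of_nonneg_right (le_abs_self C) (by positivity))
      calc ‖L p.1 p.2‖ * ‖h p.2‖ ≤ |C| * ‖p.1 - p.2‖⁻¹ * ‖h p.2‖ :=
            mul_le_mul_of_nonneg_right h5 (norm_nonneg _)
        _ = _ := by ring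

/-- After the substitution `ζ = z + w` the singularity sits at `w = 0` for every `z`, and one
integrable majorant allows dominated convergence up to the boundary. -/
theorem WeakKernel.continuousOn_diskPotential {R : ℝ} {K : ℂ → ℂ → ℂ} (hK : WeakKernel R K)
    {h : ℂ → ℂ} (hh : ContinuousOn h (closedBall 0 R)) :
    ContinuousOn (diskPotential R K h) (closedBall 0 R) := by
  obtain ⟨C, hC⟩ := hK.bound
  obtain ⟨M, hM⟩ := (isCompact_closedBall (0 : ℂ) R).exists_bound_of_continuousOn hh
  have e : diskPotential R K h = fun z => ∫ w, (closedBall (0 : ℂ) R).indicator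
      (fun ζ => K z ζ * h ζ) (z + w) := by
    funext z
    rw [integral_add_left_eq_self (fun ζ => (closedBall (0 : ℂ) R).indicator
      (fun ζ => K z ζ * h ζ) ζ) z, integral_indicator measurableSet_closedBall]
    rfl
  rw [e]
  intro z₀ hz₀
  refine continuousWithinAt_of_dominated (bound := fun w => |C| * |M| *
    (ball (0 : ℂ) (2 * R + 1)).indicator (fun w => ‖w‖ ^ (-(1 : ℝ))) w) ?_ ?_ ?_ ?_
  · refine .of_forall fun z => ?_
    have h1 : AEStronglyMeasurable ((closedBall (0 : ℂ) R).indicator fun ζ => K z ζ * h ζ) :=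
      (aestronglyMeasurable_indicator_iff measurableSet_closedBall).2
        ((hK.meas.comp measurable_prodMk_left).aestronglyMeasurable.mul
          (hh.aestronglyMeasurable measurableSet_closedBall))
    exact h1.comp_quasiMeasurePreserving
      (measurePreserving_add_left volume z).quasiMeasurePreserving
  · filter_upwards [self_mem_nhdsWithin] with z hz
    filter_upwards [measure_eq_zero_iff_ae_notMem.1 (measure_singleton (0 : ℂ))] with w hw
    have hw0 : w ≠ 0 := hw
    by_cases hzw : z + w ∈ closedBall (0 : ℂ) R
    · have h3 : w ∈ ball (0 : ℂ) (2 * R + 1) := by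
        have : ‖w‖ ≤ ‖z + w‖ + ‖z‖ := by simpa using norm_sub_le (z + w) z
        rw [mem_closedBall_zero_iff] at hz hzw
        rw [mem_ball_zero_iff]
        linarith
      rw [Set.indicator_of_mem hzw, Set.indicator_of_mem h3, norm_mul, Real.rpow_neg_one]
      have h4 := hC z hz _ hzw fun h' => hw0 (by simpa using h')
      rw [add_sub_cancel_left] at h4
      calc ‖K z (z + w)‖ * ‖h (z + w)‖ ≤ (|C| * ‖w‖⁻¹) * |M| := by
            refine mul_le_mul (h4.trans ?_) ((hM _ hzw).trans (le_abs_self M)) (norm_nonneg _)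
              (by positivity)
            exact mul_le_mul_of_nonneg_right (le_abs_self C) (by positivity)
        _ = _ := by ring
    · rw [Set.indicator_of_notMem hzw, norm_zero]
      exact mul_nonneg (by positivity) (Set.indicator_nonneg (fun w _ => by positivity) _)
  · exact (integrable_indicator_norm_rpow_neg (by norm_num) _).const_mul _
  -- The indicator of the disk may jump when `z₀ + w` lies on the boundary circle; these `w` form a
  -- null set.
  · have hsph : ∀ᵐ w : ℂ, z₀ + w ∉ sphere (0 : ℂ) R :=
      (measurePreserving_add_left volume z₀).quasiMeasurePreserving.ae
        (measure_eq_zero_iff_ae_notMem.1 (Measure.addHaar_sphere volume (0 : ℂ) R))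
    filter_upwards [hsph, measure_eq_zero_iff_ae_notMem.1 (measure_singleton (0 : ℂ))] with w hs hw
    have hw0 : w ≠ 0 := hw
    have hcont : ContinuousAt (fun z : ℂ => z + w) z₀ := by fun_prop
    by_cases hzw : z₀ + w ∈ closedBall (0 : ℂ) R
    · have hb : z₀ + w ∈ ball (0 : ℂ) R := lt_of_le_of_ne hzw hs
      have hev : ∀ᶠ z in nhdsWithin z₀ (closedBall 0 R), z + w ∈ closedBall (0 : ℂ) R := by
        filter_upwards [nhdsWithin_le_nhds (hcont.preimage_mem_nhds (isOpen_ball.mem_nhds hb))]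
          with z hz using ball_subset_closedBall hz
      have h1 : ContinuousWithinAt (fun z => K z (z + w)) (closedBall 0 R) z₀ := by
        have h2 := hK.cont z₀ hz₀ _ hzw fun h' => hw0 (by simpa using h')
        refine ContinuousWithinAt.tendsto (h2.tendsto.comp (f := fun z => (z, z + w)) ?_)
        refine tendsto_nhdsWithin_iff.2 ⟨?_, ?_⟩
        · exact (continuousAt_id.prodMk hcont).continuousWithinAt
        · filter_upwards [hev, self_mem_nhdsWithin] with z h3 h4 using ⟨h4, h3⟩
      have h2 : ContinuousWithinAt (fun z => h (z + w)) (closedBall 0 R) z₀ := by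
        have h3 : ContinuousAt h (z₀ + w) :=
          (hh.mono ball_subset_closedBall).continuousAt (isOpen_ball.mem_nhds hb)
        exact (ContinuousAt.comp (f := fun z => z + w) h3 hcont).continuousWithinAt
      refine (h1.mul h2).congr_of_eventuallyEq ?_ (Set.indicator_of_mem hzw _)
      filter_upwards [hev] with z hz
      exact Set.indicator_of_mem hz _
    · refine continuousWithinAt_const (b := (0 : ℂ)) |>.congr_of_eventuallyEq ?_
        (Set.indicator_of_notMem hzw _)
      filter_upwards [nhdsWithin_le_nhds (hcont.preimage_mem_nhds
        (isClosed_closedBall.isOpen_compl.mem_nhds hzw))] with z hz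
      exact Set.indicator_of_notMem hz _

theorem ball_ae_eq_closedBall (R : ℝ) : (ball (0 : ℂ) R : Set ℂ) =ᵐ[volume] closedBall (0 : ℂ) R := by
  filter_upwards [measure_eq_zero_iff_ae_notMem.1 (Measure.addHaar_sphere volume (0 : ℂ) R)]
    with ζ hζ
  refine propext ⟨fun h => ball_subset_closedBall h, fun h => lt_of_le_of_ne h hζ⟩

theorem integrableOn_ball_iff {R : ℝ} {h : ℂ → ℂ} :
    IntegrableOn h (ball 0 R) ↔ IntegrableOn h (closedBall 0 R) :=
  integrableOn_congr_set_ae (ball_ae_eq_closedBall R)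

theorem WeakKernel.integrableOn_of_continuousOn {R : ℝ} {K : ℂ → ℂ → ℂ} (hK : WeakKernel R K)
    {h : ℂ → ℂ} (hh : ContinuousOn h (closedBall 0 R)) {z : ℂ} (hz : z ∈ closedBall (0 : ℂ) R) :
    IntegrableOn (fun ζ => K z ζ * h ζ) (closedBall 0 R) := by
  obtain ⟨M, hM⟩ := (isCompact_closedBall (0 : ℂ) R).exists_bound_of_continuousOn hh
  exact hK.integrableOn (hh.integrableOn_compact (isCompact_closedBall _ _)) hz one_pos
    fun ζ hζ => hM ζ hζ.2

/-- Classes of functions on the open disk that are preserved by the potential operators. -/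
structure IsPotentialClass (R : ℝ) (X : (ℂ → ℂ) → Prop) : Prop where
  integrableOn : ∀ v, X v → IntegrableOn v (closedBall 0 R)
  congr : ∀ v w, X v → Set.EqOn w v (ball 0 R) → X w
  add : ∀ v w, X v → X w → X fun z => v z + w z
  const_mul : ∀ (c : ℂ) v, X v → X fun z => c * v z
  conj_mem : ∀ v, X v → X fun z => conj (v z)
  potential : ∀ K v, WeakKernel R K → X v → X (diskPotential R K v)

theorem IsPotentialClass.sub {R : ℝ} {X : (ℂ → ℂ) → Prop} (hX : IsPotentialClass R X) {v w : ℂ → ℂ}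
    (hv : X v) (hw : X w) : X fun z => v z - w z := by
  simpa [sub_eq_add_neg] using hX.add _ _ hv (hX.const_mul (-1) _ hw)

theorem IsPotentialClass.sum {R : ℝ} {X : (ℂ → ℂ) → Prop} (hX : IsPotentialClass R X) {ι : Type*}
    {s : Finset ι} {v : ι → ℂ → ℂ} (h0 : X fun _ => 0) (hv : ∀ i ∈ s, X (v i)) :
    X fun z => ∑ i ∈ s, v i z := by
  classical
  induction s using Finset.induction_on with
  | empty => simpa using h0
  | insert a s ha ih =>
    simp only [Finset.sum_insert ha]
    exact hX.add _ _ (hv a (by simp)) (ih fun i hi => hv i (by simp [hi]))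

theorem isPotentialClass_integrableOn (R : ℝ) :
    IsPotentialClass R fun v => IntegrableOn v (ball 0 R) where
  integrableOn _ hv := integrableOn_ball_iff.1 hv
  congr _ _ hv e := hv.congr_fun e.symm measurableSet_ball
  add _ _ hv hw := Integrable.add hv hw
  const_mul c _ hv := Integrable.const_mul hv c
  conj_mem _ hv := (conjCLE : ℂ →L[ℝ] ℂ).integrable_comp hv
  potential _ _ hK hv := integrableOn_ball_iff.2
    (hK.integrableOn_diskPotential (integrableOn_ball_iff.1 hv))

theorem isPotentialClass_extends (R : ℝ) : IsPotentialClass R (ExtendsToClosedDisk R) where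
  integrableOn := by
    rintro v ⟨w, hw, e⟩
    rw [← integrableOn_ball_iff]
    exact (integrableOn_ball_iff.2 (hw.integrableOn_compact (isCompact_closedBall _ _))).congr_fun e
      measurableSet_ball
  congr := by
    rintro v v' ⟨w, hw, e⟩ e'
    exact ⟨w, hw, e.trans e'.symm⟩
  add := by
    rintro v v' ⟨w, hw, e⟩ ⟨w', hw', e'⟩
    exact ⟨_, hw.add hw', fun z hz => congrArg₂ (· + ·) (e hz) (e' hz)⟩
  const_mul := by
    rintro c v ⟨w, hw, e⟩
    exact ⟨_, continuousOn_const.mul hw, fun z hz => congrArg (c * ·) (e hz)⟩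
  conj_mem := by
    rintro v ⟨w, hw, e⟩
    exact ⟨_, continuous_conj.comp_continuousOn hw, fun z hz => congrArg conj (e hz)⟩
  potential := by
    rintro K v hK ⟨w, hw, e⟩
    exact ⟨diskPotential R K w, hK.continuousOn_diskPotential hw, fun z _ =>
      diskPotential_congr (fun _ _ => rfl) e⟩

/-! ### Chains of `∂̄`-derivatives and polyanalytic functions. -/

/-- The sum of the iterated potentials of the densities `g 0, …, g (N - 1)`. -/
noncomputable def greenSum (R : ℝ) (N : ℕ) (g : ℕ → ℂ → ℂ) (z : ℂ) : ℂ :=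
  2 * I * ∑ i ∈ Finset.range N, diskPotential R (fun z ζ => greenKer z ζ (i + 1)) (g i) z

/-- `∂̄ U₀ = U₁`, …, `∂̄ U_{N-1} = U_N` in the open disk. -/
def DbarChain (R : ℝ) (N : ℕ) (U : ℕ → ℂ → ℂ) : Prop :=
  ∀ k < N, ∀ z ∈ ball (0 : ℂ) R, HasDbarAt (U k) (U (k + 1) z) z

theorem hasDbarAt_potential_greenKer_one {R : ℝ} {h : ℂ → ℂ} (hh : IsAdmissible R h) {z : ℂ}
    (hz : z ∈ ball (0 : ℂ) R) :
    HasDbarAt (fun w => 2 * I * diskPotential R (fun z ζ => greenKer z ζ 1) h w) (h z) z := by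
  refine (((dbarKernel_greenKer_one R).dbar h hh z hz).const_mul (2 * I)).congr_deriv ?_
  simp only [diskPotential, zero_mul, integral_zero, zero_add]
  rw [← mul_assoc, mul_inv_cancel₀ (mul_ne_zero two_ne_zero I_ne_zero), one_mul]

/-- The first potential returns its density, and the order of each other kernel drops by one. -/
theorem hasDbarAt_greenSum {R : ℝ} {N : ℕ} {g : ℕ → ℂ → ℂ}
    (hg : ∀ i < N + 1, IsAdmissible R (g i)) {z : ℂ} (hz : z ∈ ball (0 : ℂ) R) :
    HasDbarAt (greenSum R (N + 1) g) (g 0 z + greenSum R N (fun i => g (i + 1)) z) z := by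
  have h1 := (HasDbarAt.sum (s := Finset.range N) fun i hi =>
    (dbarKernel_greenKer R i).dbar (g (i + 1)) (hg _ (by
      have := Finset.mem_range.1 hi
      omega)) z hz).const_mul (2 * I)
  refine (((hasDbarAt_potential_greenKer_one (hg 0 (by omega)) hz).add h1).congr
    (.of_forall fun w => ?_)).congr_deriv ?_
  · rw [greenSum, Finset.sum_range_succ', mul_add, add_comm]
  · simp [greenSum]

/-- Holomorphic functions in the open disk of class `X`. -/
def IsHolomorphicOfClass (R : ℝ) (X : (ℂ → ℂ) → Prop) (h : ℂ → ℂ) : Prop :=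
  DifferentiableOn ℂ h (ball 0 R) ∧ X h

theorem IsHolomorphicOfClass.isAdmissible {R : ℝ} {X : (ℂ → ℂ) → Prop} (hX : IsPotentialClass R X)
    {h : ℂ → ℂ} (hh : IsHolomorphicOfClass R X h) : IsAdmissible R h :=
  ⟨hX.integrableOn h hh.2, fun _ hz => hh.1.isHolderDiff isOpen_ball 0 _ hz⟩

theorem IsPotentialClass.greenSum {R : ℝ} {X : (ℂ → ℂ) → Prop} (hX : IsPotentialClass R X)
    (h0 : X fun _ => 0) {N : ℕ} {g : ℕ → ℂ → ℂ} (hg : ∀ i < N, X (g i)) : X (greenSum R N g) :=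
  hX.const_mul _ _ (hX.sum h0 fun i hi => hX.potential _ _ (weakKernel_greenKer R i)
    (hg i (Finset.mem_range.1 hi)))

/-- Polyanalytic functions are sums of iterated potentials of holomorphic functions. -/
theorem DbarChain.exists_eq_greenSum {R : ℝ} {X : (ℂ → ℂ) → Prop} (hX : IsPotentialClass R X)
    (h0 : X fun _ => 0) {N : ℕ} {W : ℕ → ℂ → ℂ} (hW : DbarChain R N W)
    (hN : ∀ z ∈ ball (0 : ℂ) R, W N z = 0) (hWX : ∀ k < N, X (W k)) :
    ∃ g : ℕ → ℂ → ℂ, (∀ j < N, IsHolomorphicOfClass R X (g j)) ∧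
      ∀ z ∈ ball (0 : ℂ) R, W 0 z = g 0 z + greenSum R (N - 1) (fun i => g (i + 1)) z := by
  induction N generalizing W with
  | zero => exact ⟨fun _ _ => 0, by simp, fun z hz => by simp [greenSum, hN z hz]⟩
  | succ N ih =>
    obtain ⟨g, hg, hgW⟩ := ih (W := fun k => W (k + 1)) (fun k hk => hW (k + 1) (by omega)) hN
      fun k hk => hWX (k + 1) (by omega)
    -- By induction `W 1` equals the `∂̄`-derivative of `greenSum R N g`, so this difference is
    -- holomorphic; the densities of the tail become `g 1, g 2, …`.
    set g₀ : ℂ → ℂ := fun z => W 0 z - greenSum R N g z with hg₀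
    have hg₀X : X g₀ := hX.sub (hWX 0 (by omega)) (hX.greenSum h0 fun i hi => (hg i hi).2)
    have hg₀d : DifferentiableOn ℂ g₀ (ball 0 R) := fun z hz => by
      have h1 : HasDbarAt (greenSum R N g) (W 1 z) z := by
        rcases N with _ | M
        · have e : greenSum R 0 g = fun _ => 0 := by
            funext w
            simp [greenSum]
          rw [e]
          exact (hasDbarAt_const 0 z).congr_deriv (hN z hz).symm
        · exact (hasDbarAt_greenSum (fun i hi => (hg i hi).isAdmissible hX) hz).congr_deriv
            (hgW z hz).symm
      exact (((hW 0 (by omega) z hz).sub h1).congr_deriv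
        (sub_self _)).differentiableAt_complex.differentiableWithinAt
    refine ⟨fun j => Nat.casesOn j g₀ g, fun j hj => ?_, fun z hz => ?_⟩
    · rcases j with _ | j
      · exact ⟨hg₀d, hg₀X⟩
      · exact hg j (by omega)
    · simp [hg₀]

/-- The chain produced by a sum of iterated potentials. -/
theorem exists_dbarChain {R : ℝ} {X : (ℂ → ℂ) → Prop} (hX : IsPotentialClass R X)
    (h0 : X fun _ => 0) {E : ℕ → ℂ → ℂ}
    (hE : ∀ m, ∀ z ∈ ball (0 : ℂ) R, HasDbarAt (E (m + 1)) (E m z) z) (hEX : ∀ m, X (E (m + 1)))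
    {N : ℕ} {g : ℕ → ℂ → ℂ} (hg : ∀ j < N + 1, IsHolomorphicOfClass R X (g j)) :
    ∃ U : ℕ → ℂ → ℂ, DbarChain R (N + 1) U ∧ (∀ k < N + 1, X (U k)) ∧ U (N + 1) = E 0 ∧
      U 0 = fun z => g 0 z + greenSum R N (fun i => g (i + 1)) z + E (N + 1) z := by
  induction N generalizing g with
  | zero =>
    refine ⟨fun k => Nat.casesOn k (fun z => g 0 z + greenSum R 0 (fun i => g (i + 1)) z + E 1 z)
      fun _ => E 0, fun k hk z hz => ?_, fun k hk => ?_, rfl, rfl⟩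
    · obtain rfl : k = 0 := by omega
      have h1 := (((hg 0 one_pos).1.differentiableAt
        (isOpen_ball.mem_nhds hz)).hasDbarAt_zero.add (hE 0 z hz))
      refine (h1.congr (.of_forall fun w => ?_)).congr_deriv (zero_add _)
      simp [greenSum]
    · obtain rfl : k = 0 := by omega
      exact hX.add _ _ (hX.add _ _ (hg 0 one_pos).2 (hX.greenSum h0 (by simp))) (hEX 0)
  | succ N ih =>
    obtain ⟨U, hU, hUX, hUN, hU0⟩ := ih (g := fun i => g (i + 1)) fun j hj => hg _ (by omega)
    -- The chain of the shifted densities is prolonged by a new head, whose `∂̄`-derivative is the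
    -- old head `U 0`.
    refine ⟨fun k => Nat.casesOn k
      (fun z => g 0 z + greenSum R (N + 1) (fun i => g (i + 1)) z + E (N + 1 + 1) z) U,
      fun k hk z hz => ?_, fun k hk => ?_, hUN, rfl⟩
    · rcases k with _ | k
      · have h1 := (((hg 0 (by omega)).1.differentiableAt
          (isOpen_ball.mem_nhds hz)).hasDbarAt_zero.add (hasDbarAt_greenSum (N := N)
            (g := fun i => g (i + 1)) (fun i hi => (hg (i + 1) (by omega)).isAdmissible hX)
            hz)).add (hE (N + 1) z hz)
        refine h1.congr_deriv ?_
        change _ = U 0 z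
        rw [hU0, zero_add]
      · exact hU k (by omega) z hz
    · rcases k with _ | k
      · exact hX.add _ _ (hX.add _ _ (hg 0 (by omega)).2
          (hX.greenSum h0 fun i hi => (hg (i + 1) (by omega)).2)) (hEX _)
      · exact hUX k (by omega)

/-- The sequence `E` is a particular solution of the recursion. Since `E (N + 1 - k)` is
differentiated to `E (N + 1 - (k + 1))`, subtracting it from `U k` gives a chain that ends in 0. -/
theorem DbarChain.exists_eq_greenSum_add {R : ℝ} {X : (ℂ → ℂ) → Prop} (hX : IsPotentialClass R X)
    (h0 : X fun _ => 0) {E : ℕ → ℂ → ℂ}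
    (hE : ∀ m, ∀ z ∈ ball (0 : ℂ) R, HasDbarAt (E (m + 1)) (E m z) z) (hEX : ∀ m, X (E (m + 1)))
    {N : ℕ} {U : ℕ → ℂ → ℂ} (hU : DbarChain R (N + 1) U) (hUX : ∀ k < N + 1, X (U k))
    (hUN : Set.EqOn (U (N + 1)) (E 0) (ball 0 R)) :
    ∃ g : ℕ → ℂ → ℂ, (∀ j < N + 1, IsHolomorphicOfClass R X (g j)) ∧
      ∀ z ∈ ball (0 : ℂ) R,
        U 0 z = g 0 z + greenSum R N (fun i => g (i + 1)) z + E (N + 1) z := by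
  obtain ⟨g, hg, hgW⟩ := DbarChain.exists_eq_greenSum hX h0 (N := N + 1)
    (W := fun k z => U k z - E (N + 1 - k) z) (fun k hk z hz => by
      have h1 := hE (N - k) z hz
      rw [show N - k + 1 = N + 1 - k by omega] at h1
      refine ((hU k hk z hz).sub h1).congr_deriv ?_
      change _ = U (k + 1) z - E (N + 1 - (k + 1)) z
      rw [show N + 1 - (k + 1) = N - k by omega])
    (fun z hz => by simp [hUN hz]) fun k hk => by
      have h1 := hEX (N - k)
      rw [show N - k + 1 = N + 1 - k by omega] at h1
      exact hX.sub (hUX k hk) h1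
  exact ⟨g, hg, fun z hz => sub_eq_iff_eq_add.1 (hgW z hz)⟩

theorem DbarChain.iterate_wirtingerDbar {R : ℝ} {N : ℕ} {U : ℕ → ℂ → ℂ} (hU : DbarChain R N U)
    {u : ℂ → ℂ} (hu : Set.EqOn u (U 0) (ball 0 R)) {k : ℕ} (hk : k ≤ N) :
    Set.EqOn (wirtingerDbar^[k] u) (U k) (ball 0 R) := by
  induction k with
  | zero => exact hu
  | succ k ih =>
    rw [Function.iterate_succ_apply']
    exact (wirtingerDbar_congr isOpen_ball (ih (by omega))).trans fun z hz =>
      (hU k (by omega) z hz).2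

theorem DbarChain.iterate_wirtingerD {R : ℝ} {N : ℕ} {U : ℕ → ℂ → ℂ} (hU : DbarChain R N U)
    {u : ℂ → ℂ} (hu : Set.EqOn u (fun z => conj (U 0 z)) (ball 0 R)) {k : ℕ} (hk : k ≤ N) :
    Set.EqOn (wirtingerD^[k] u) (fun z => conj (U k z)) (ball 0 R) := by
  induction k with
  | zero => exact hu
  | succ k ih =>
    rw [Function.iterate_succ_apply']
    refine (wirtingerD_congr isOpen_ball (ih (by omega))).trans fun z hz => ?_
    obtain ⟨h1, h2⟩ := hU k (by omega) z hz
    rw [(wirtinger_conj h1).1, h2]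

/-- Each step back along the chain gains one derivative, by `IsHolderDiff.of_dbar`. -/
theorem DbarChain.isHolderDiff {R : ℝ} {N : ℕ} {U : ℕ → ℂ → ℂ} (hU : DbarChain R N U) {n : ℕ}
    (hn : IsHolderDiff n (U N) (ball 0 R)) : IsHolderDiff (n + N) (U 0) (ball 0 R) := by
  induction N generalizing U with
  | zero => exact hn
  | succ N ih =>
    have h1 := ih (U := fun k => U (k + 1)) (fun k hk => hU (k + 1) (by omega)) hn
    exact IsHolderDiff.of_dbar isOpen_ball (fun z hz => (hU 0 (by omega) z hz).1)
      (h1.congr isOpen_ball fun z hz => (hU 0 (by omega) z hz).2)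

theorem contDiffOn_iterate_wirtingerDbar {U : Set ℂ} (hU : IsOpen U) {n k : ℕ} {u : ℂ → ℂ}
    (hu : ContDiffOn ℝ ((n + k : ℕ) : WithTop ℕ∞) u U) :
    ContDiffOn ℝ (n : WithTop ℕ∞) (wirtingerDbar^[k] u) U := by
  induction k generalizing n with
  | zero => exact hu
  | succ k ih =>
    rw [Function.iterate_succ_apply']
    have h1 := ih (n := n + 1) (by rwa [show n + 1 + k = n + (k + 1) by omega])
    push_cast at h1
    exact (h1.wirtinger hU).2

theorem contDiffOn_iterate_wirtingerD {U : Set ℂ} (hU : IsOpen U) {n k : ℕ} {u : ℂ → ℂ}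
    (hu : ContDiffOn ℝ ((n + k : ℕ) : WithTop ℕ∞) u U) :
    ContDiffOn ℝ (n : WithTop ℕ∞) (wirtingerD^[k] u) U := by
  induction k generalizing n with
  | zero => exact hu
  | succ k ih =>
    rw [Function.iterate_succ_apply']
    have h1 := ih (n := n + 1) (by rwa [show n + 1 + k = n + (k + 1) by omega])
    push_cast at h1
    exact (h1.wirtinger hU).1

theorem ContDiffOn.dbarChain {R : ℝ} {N n : ℕ} {u : ℂ → ℂ}
    (hu : ContDiffOn ℝ ((n + N : ℕ) : WithTop ℕ∞) u (ball 0 R)) :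
    DbarChain R N fun k => wirtingerDbar^[k] u := by
  intro k hk z hz
  have h1 : ContDiffOn ℝ ((1 : ℕ) : WithTop ℕ∞) (wirtingerDbar^[k] u) (ball 0 R) :=
    contDiffOn_iterate_wirtingerDbar isOpen_ball (hu.of_le (by exact_mod_cast (by omega)))
  refine ⟨(h1.contDiffAt (isOpen_ball.mem_nhds hz)).differentiableAt (by simp), ?_⟩
  beta_reduce
  rw [Function.iterate_succ_apply']

/-- Conjugation turns iterated `∂` into iterated `∂̄`, so the same theory of chains serves both
operators. -/
theorem ContDiffOn.dbarChain_conj {R : ℝ} {N : ℕ} {u : ℂ → ℂ}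
    (hu : ContDiffOn ℝ (N : WithTop ℕ∞) u (ball 0 R)) :
    DbarChain R N fun k z => conj (wirtingerD^[k] u z) := by
  intro k hk z hz
  have h1 : ContDiffOn ℝ ((1 : ℕ) : WithTop ℕ∞) (wirtingerD^[k] u) (ball 0 R) :=
    contDiffOn_iterate_wirtingerD isOpen_ball (hu.of_le (by exact_mod_cast (by omega)))
  have h2 : DifferentiableAt ℝ (wirtingerD^[k] u) z :=
    (h1.contDiffAt (isOpen_ball.mem_nhds hz)).differentiableAt (by simp)
  refine ⟨h2.conj_real, ?_⟩
  beta_reduce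
  rw [(wirtinger_conj h2).2, Function.iterate_succ_apply']

/-! ### Particular solutions and the characterization of solutions. -/

/-- The iterated Cauchy potentials of `B`. -/
noncomputable def greenPotential (R : ℝ) (B : ℂ → ℂ) : ℕ → ℂ → ℂ
  | 0 => B
  | m + 1 => fun z => 2 * I * diskPotential R (fun z ζ => greenKer z ζ (m + 1)) B z

theorem hasDbarAt_greenPotential {R : ℝ} {B : ℂ → ℂ} (hB : IsAdmissible R B) (m : ℕ) {z : ℂ}
    (hz : z ∈ ball (0 : ℂ) R) :
    HasDbarAt (greenPotential R B (m + 1)) (greenPotential R B m z) z := by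
  rcases m with _ | m
  · exact hasDbarAt_potential_greenKer_one hB hz
  · refine (((dbarKernel_greenKer R m).dbar B hB z hz).const_mul (2 * I)).congr_deriv ?_
    simp [greenPotential]

/-- The potentials that solve `∂^(M+1) ∂̄^m u = A`, with boundary data `f`. -/
noncomputable def mixedPotential (R : ℝ) (M : ℕ) (A : ℂ → ℂ) (f : ℕ → ℂ → ℂ) : ℕ → ℂ → ℂ
  | 0 => fun z => conj (f 0 z + greenSum R M (fun i => f (i + 1)) z +
      greenPotential R (fun z => conj (A z)) (M + 1) z)
  | m + 1 => fun z => 2 * I * (diskPotential R (fun z ζ => greenKer z ζ (m + 1))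
      (fun z => conj (f 0 z)) z +
      ∑ i ∈ Finset.range M, diskPotential R (fun z ζ => greenKer₂ R z ζ (m + 1) (i + 1))
        (fun z => conj (f (i + 1) z)) z +
      diskPotential R (fun z ζ => greenKer₂ R z ζ (m + 1) (M + 1)) A z)

theorem hasDbarAt_greenKer₂_one {R : ℝ} {h : ℂ → ℂ} (hh : IsAdmissible R h) (k : ℕ) {z : ℂ}
    (hz : z ∈ ball (0 : ℂ) R) :
    HasDbarAt (fun w => 2 * I * diskPotential R (fun z ζ => greenKer₂ R z ζ 1 (k + 1)) h w)
      (conj (2 * I * diskPotential R (fun z ζ => greenKer z ζ (k + 1)) (fun z => conj (h z)) z))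
      z := by
  refine (((dbarKernel_greenKer₂_one R k).dbar h hh z hz).const_mul (2 * I)).congr_deriv ?_
  -- The minus sign of the kernel identity is absorbed by `conj (2 * I) = -(2 * I)`.
  simp only [diskPotential, Pi.zero_apply, zero_mul, add_zero, map_mul, conj_I, map_ofNat]
  rw [← integral_conj, mul_neg, neg_mul, ← mul_neg, ← integral_neg]
  congr 2
  funext ζ
  simp

/-- For `m = 0` this is the passage from `G(z, ζ, 1, n)` to the conjugated potentials; for larger
`m` the first index of every kernel drops by one. -/
theorem hasDbarAt_mixedPotential {R : ℝ} {M : ℕ} {A : ℂ → ℂ} {f : ℕ → ℂ → ℂ}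
    (hA : IsAdmissible R A) (hf : ∀ i < M + 1, IsAdmissible R (f i)) (m : ℕ) {z : ℂ}
    (hz : z ∈ ball (0 : ℂ) R) :
    HasDbarAt (mixedPotential R M A f (m + 1)) (mixedPotential R M A f m z) z := by
  have hf0 := (hf 0 (by omega)).conj
  have hfi : ∀ i ∈ Finset.range M, IsAdmissible R fun z => conj (f (i + 1) z) := fun i hi =>
    (hf (i + 1) (by have := Finset.mem_range.1 hi; omega)).conj
  rcases m with _ | m
  · refine ((((hasDbarAt_potential_greenKer_one hf0 hz).add (HasDbarAt.sum fun i hi =>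
      hasDbarAt_greenKer₂_one (hfi i hi) i hz)).add (hasDbarAt_greenKer₂_one hA M hz)).congr
      (.of_forall fun w => ?_)).congr_deriv ?_
    · simp only [mixedPotential, mul_add, Finset.mul_sum]
    · simp only [mixedPotential, greenSum, greenPotential, map_add, Finset.mul_sum, map_sum,
        conj_conj]
  · refine (((((dbarKernel_greenKer R m).dbar _ hf0 z hz).add (HasDbarAt.sum fun i hi =>
      (dbarKernel_greenKer₂ R m (i + 1)).dbar _ (hfi i hi) z hz)).add
      ((dbarKernel_greenKer₂ R m (M + 1)).dbar A hA z hz)).const_mul (2 * I)).congr_deriv ?_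
    simp [mixedPotential]

theorem IsPotentialClass.mixedPotential {R : ℝ} {X : (ℂ → ℂ) → Prop} (hX : IsPotentialClass R X)
    (h0 : X fun _ => 0) {M : ℕ} {A : ℂ → ℂ} {f : ℕ → ℂ → ℂ} (hA : X A)
    (hf : ∀ i < M + 1, X (f i)) (m : ℕ) : X (mixedPotential R M A f (m + 1)) := by
  refine hX.const_mul _ _ (hX.add _ _ (hX.add _ _ ?_ (hX.sum h0 fun i hi => ?_)) ?_)
  · exact hX.potential _ _ (weakKernel_greenKer R m) (hX.conj_mem _ (hf 0 (by omega)))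
  · exact hX.potential _ _ (weakKernel_greenKer₂ R m (i + 1)) (hX.conj_mem _ (hf _ (by
      have := Finset.mem_range.1 hi
      omega)))
  · exact hX.potential _ _ (weakKernel_greenKer₂ R m (M + 1)) hA

theorem IsPotentialClass.greenPotential {R : ℝ} {X : (ℂ → ℂ) → Prop} (hX : IsPotentialClass R X)
    {B : ℂ → ℂ} (hB : X B) (m : ℕ) : X (greenPotential R B (m + 1)) :=
  hX.const_mul _ _ (hX.potential _ _ (weakKernel_greenKer R m) hB)

/-- Both directions glue two chains at `∂̄^(N+1) u`: one leads from `u` down to it, the other from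
its conjugate down to `conj A`. The representation of the second chain yields the `f i`; with these,
`mixedPotential` is a particular solution for the first, which yields the `g j`. -/
theorem isClassicalSolution_iff {R : ℝ} {X : (ℂ → ℂ) → Prop} (hX : IsPotentialClass R X)
    {M N : ℕ} {A : ℂ → ℂ} (hA : IsAdmissible R A) (hAX : X A) (u : ℂ → ℂ) :
    (IsClassicalSolution R (M + 1) (N + 1) A u ∧ (∀ j < N + 1, X (wirtingerDbar^[j] u)) ∧
        (∀ i < M + 1, X (wirtingerD^[i] (wirtingerDbar^[N + 1] u)))) ↔
      ∃ f g : ℕ → ℂ → ℂ, (∀ i < M + 1, IsHolomorphicOfClass R X (f i)) ∧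
        (∀ j < N + 1, IsHolomorphicOfClass R X (g j)) ∧
        ∀ z ∈ ball (0 : ℂ) R, u z = g 0 z + greenSum R N (fun i => g (i + 1)) z +
          mixedPotential R M A f (N + 1) z := by
  have h0 : X fun _ => 0 := by simpa using hX.const_mul 0 A hAX
  constructor
  · rintro ⟨⟨hu, hsol⟩, hjX, hiX⟩
    have hv := contDiffOn_iterate_wirtingerDbar isOpen_ball hu
    obtain ⟨f, hf, hfv⟩ := DbarChain.exists_eq_greenSum_add hX h0
      (E := greenPotential R fun z => conj (A z))
      (fun m z hz => hasDbarAt_greenPotential hA.conj m hz)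
      (hX.greenPotential (hX.conj_mem _ hAX)) hv.dbarChain_conj
      (fun i hi => hX.conj_mem _ (hiX i hi)) fun z hz => congrArg conj (hsol z hz)
    obtain ⟨g, hg, hgu⟩ := DbarChain.exists_eq_greenSum_add hX h0 (E := mixedPotential R M A f)
      (fun m z hz => hasDbarAt_mixedPotential hA (fun i hi => (hf i hi).isAdmissible hX) m hz)
      (hX.mixedPotential h0 hAX fun i hi => (hf i hi).2) (ContDiffOn.dbarChain hu) hjX
      fun z hz => by
        simp only [mixedPotential]
        rw [← hfv z hz, conj_conj]
        rfl
    exact ⟨f, g, hf, hg, hgu⟩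
  · rintro ⟨f, g, hf, hg, hu⟩
    obtain ⟨V, hV, hVX, hVN, hV0⟩ := exists_dbarChain hX h0
      (E := greenPotential R fun z => conj (A z))
      (fun m z hz => hasDbarAt_greenPotential hA.conj m hz)
      (hX.greenPotential (hX.conj_mem _ hAX)) hf
    obtain ⟨U, hU, hUX, hUN, hU0⟩ := exists_dbarChain hX h0 (E := mixedPotential R M A f)
      (fun m z hz => hasDbarAt_mixedPotential hA (fun i hi => (hf i hi).isAdmissible hX) m hz)
      (hX.mixedPotential h0 hAX fun i hi => (hf i hi).2) hg
    have huU : Set.EqOn u (U 0) (ball 0 R) := fun z hz => by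
      rw [hU0]
      exact hu z hz
    -- The end of the first chain is the conjugate of the head of the second.
    have hUV : U (N + 1) = fun z => conj (V 0 z) := by
      rw [hUN, hV0]
      rfl
    have hj := fun k (hk : k ≤ N + 1) => hU.iterate_wirtingerDbar huU hk
    have hi := fun i (hi : i ≤ M + 1) => hV.iterate_wirtingerD
      (u := wirtingerDbar^[N + 1] u) ((hj (N + 1) le_rfl).trans fun z _ => congrFun hUV z) hi
    have hB : IsHolderDiff 0 (V (M + 1)) (ball 0 R) := by
      rw [hVN]
      exact hA.conj.holder
    -- Starting from the Hölder function `A`, the second chain gains `M + 1` derivatives; the first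
    -- then adds `N + 1` more.
    have hreg : IsHolderDiff (M + 1) (U (N + 1)) (ball 0 R) := by
      rw [hUV]
      have := (hV.isHolderDiff hB).conj isOpen_ball
      rwa [zero_add] at this
    refine ⟨⟨((hU.isHolderDiff hreg).congr isOpen_ball huU).contDiffOn isOpen_ball,
      fun z hz => ?_⟩, fun j hjN => hX.congr _ _ (hUX j hjN) (hj j hjN.le),
      fun i hiM => hX.congr _ _ (hX.conj_mem _ (hVX i hiM)) (hi i hiM.le)⟩
    rw [hi (M + 1) le_rfl hz, hVN]
    exact conj_conj (A z)

/-! ### From potentials to the representation formula. -/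

/-- All potentials of `h` with weakly singular kernels converge at `z`. -/
def HasWeakPotentials (R : ℝ) (h : ℂ → ℂ) (z : ℂ) : Prop :=
  ∀ K, WeakKernel R K → IntegrableOn (fun ζ => K z ζ * h ζ) (closedBall 0 R)

theorem IsAdmissible.hasWeakPotentials {R : ℝ} {h : ℂ → ℂ} (hh : IsAdmissible R h) {z : ℂ}
    (hz : z ∈ ball (0 : ℂ) R) : HasWeakPotentials R h z :=
  fun _ hK => hK.integrableOn_admissible hh hz

theorem ContinuousOn.hasWeakPotentials {R : ℝ} {h : ℂ → ℂ} (hh : ContinuousOn h (closedBall 0 R))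
    {z : ℂ} (hz : z ∈ closedBall (0 : ℂ) R) : HasWeakPotentials R h z :=
  fun _ hK => hK.integrableOn_of_continuousOn hh hz

theorem greenIntegrand_succ (R : ℝ) (M N : ℕ) (A : ℂ → ℂ) (f g : ℕ → ℂ → ℂ) (z : ℂ) :
    greenIntegrand R (M + 1) (N + 1) A f g z = fun ζ =>
      (∑ j ∈ Finset.range N, greenKer z ζ (j + 1) * g (j + 1) ζ) +
        greenKer z ζ (N + 1) * conj (f 0 ζ) +
        (∑ i ∈ Finset.range M, greenKer₂ R z ζ (N + 1) (i + 1) * conj (f (i + 1) ζ)) +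
        greenKer₂ R z ζ (N + 1) (M + 1) * A ζ := by
  funext ζ
  simp [greenIntegrand, Finset.sum_Ico_eq_sum_range, add_comm 1]

section

variable {R : ℝ} {M N : ℕ} {A : ℂ → ℂ} {f g : ℕ → ℂ → ℂ} {z : ℂ}

/-- Formulated at a single point, so that it covers interior points with integrable data and all
points of the closed disk with continuous data. -/
theorem integrableOn_and_diskIntegral_greenIntegrand
    (hg : ∀ j < N + 1, HasWeakPotentials R (g j) z)
    (hf : ∀ i < M + 1, HasWeakPotentials R (fun ζ => conj (f i ζ)) z)
    (hA : HasWeakPotentials R A z) :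
    IntegrableOn (greenIntegrand R (M + 1) (N + 1) A f g z) (closedBall 0 R) ∧
      diskIntegral R (greenIntegrand R (M + 1) (N + 1) A f g z) =
        greenSum R N (fun i => g (i + 1)) z + mixedPotential R M A f (N + 1) z := by
  have h1 : ∀ j ∈ Finset.range N, IntegrableOn (fun ζ => greenKer z ζ (j + 1) * g (j + 1) ζ)
      (closedBall 0 R) := fun j hj => hg (j + 1) (by
    have := Finset.mem_range.1 hj
    omega) _ (weakKernel_greenKer R j)
  have h2 : IntegrableOn (fun ζ => greenKer z ζ (N + 1) * conj (f 0 ζ)) (closedBall 0 R) :=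
    hf 0 (by omega) _ (weakKernel_greenKer R N)
  have h3 : ∀ i ∈ Finset.range M,
      IntegrableOn (fun ζ => greenKer₂ R z ζ (N + 1) (i + 1) * conj (f (i + 1) ζ))
        (closedBall 0 R) := fun i hi => hf (i + 1) (by
    have := Finset.mem_range.1 hi
    omega) _ (weakKernel_greenKer₂ R N (i + 1))
  have h4 : IntegrableOn (fun ζ => greenKer₂ R z ζ (N + 1) (M + 1) * A ζ) (closedBall 0 R) :=
    hA _ (weakKernel_greenKer₂ R N (M + 1))
  have s1 := integrable_finsetSum _ h1
  have s3 := integrable_finsetSum _ h3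
  rw [greenIntegrand_succ]
  refine ⟨((s1.add h2).add s3).add h4, ?_⟩
  have e4 := integral_add ((s1.add h2).add s3) h4
  have e3 := integral_add (s1.add h2) s3
  simp only [Pi.add_apply] at e3 e4
  rw [diskIntegral, e4, e3, integral_add s1 h2, integral_finsetSum _ h1, integral_finsetSum _ h3]
  simp only [greenSum, mixedPotential, diskPotential]
  ring

end

theorem HolderOnWith.holderNear {R : ℝ} {C α : ℝ≥0} (hα : 0 < α) (hα1 : α ≤ 1) {A : ℂ → ℂ}
    (hA : HolderOnWith C α A (closedBall 0 R)) {z : ℂ} (hz : z ∈ ball (0 : ℂ) R) :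
    HolderNear A z := by
  obtain ⟨r, hr, H⟩ := Metric.isOpen_iff.1 isOpen_ball z hz
  refine ⟨r, hr, C, C.2, α, hα, by exact_mod_cast hα1, fun x hx y hy => ?_⟩
  simpa [dist_eq_norm] using hA.dist_le (ball_subset_closedBall (H hx))
    (ball_subset_closedBall (H hy))

theorem HolderOnWith.isAdmissible {R : ℝ} {C α : ℝ≥0} (hα : 0 < α) (hα1 : α ≤ 1) {A : ℂ → ℂ}
    (hA : HolderOnWith C α A (closedBall 0 R)) : IsAdmissible R A :=
  ⟨(hA.continuousOn hα).integrableOn_compact (isCompact_closedBall _ _),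
    fun _ hz => hA.holderNear hα hα1 hz⟩

theorem isIntegrableHolomorphic_iff {R : ℝ} {h : ℂ → ℂ} :
    IsIntegrableHolomorphic R h ↔
      IsHolomorphicOfClass R (fun v => IntegrableOn v (ball 0 R)) h :=
  and_congr_right fun _ => integrableOn_ball_iff.symm

theorem IsContinuousHolomorphic.isHolomorphicOfClass {R : ℝ} {h : ℂ → ℂ}
    (hh : IsContinuousHolomorphic R h) : IsHolomorphicOfClass R (ExtendsToClosedDisk R) h :=
  ⟨hh.1, h, hh.2, fun _ _ => rfl⟩

theorem ContinuousOn.complex_conj {s : Set ℂ} {h : ℂ → ℂ} (hh : ContinuousOn h s) :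
    ContinuousOn (fun ζ => conj (h ζ)) s :=
  continuous_conj.comp_continuousOn hh

theorem continuousOn_greenSum {R : ℝ} {N : ℕ} {g : ℕ → ℂ → ℂ}
    (hg : ∀ i < N, ContinuousOn (g i) (closedBall 0 R)) :
    ContinuousOn (greenSum R N g) (closedBall 0 R) :=
  continuousOn_const.mul (continuousOn_finsetSum _ fun i hi =>
    (weakKernel_greenKer R i).continuousOn_diskPotential (hg i (Finset.mem_range.1 hi)))

theorem continuousOn_mixedPotential {R : ℝ} {M : ℕ} {A : ℂ → ℂ} {f : ℕ → ℂ → ℂ}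
    (hA : ContinuousOn A (closedBall 0 R)) (hf : ∀ i < M + 1, ContinuousOn (f i) (closedBall 0 R))
    (m : ℕ) : ContinuousOn (mixedPotential R M A f (m + 1)) (closedBall 0 R) := by
  refine continuousOn_const.mul (((ContinuousOn.add ?_ (continuousOn_finsetSum _ fun i hi => ?_))).add
    ?_)
  · exact (weakKernel_greenKer R m).continuousOn_diskPotential (hf 0 (by omega)).complex_conj
  · exact (weakKernel_greenKer₂ R m (i + 1)).continuousOn_diskPotential (hf _ (by
      have := Finset.mem_range.1 hi
      omega)).complex_conj
  · exact (weakKernel_greenKer₂ R m (M + 1)).continuousOn_diskPotential hA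

theorem greenSum_congr {R : ℝ} {N : ℕ} {g g' : ℕ → ℂ → ℂ}
    (hg : ∀ i < N, Set.EqOn (g i) (g' i) (ball 0 R)) (z : ℂ) :
    greenSum R N g z = greenSum R N g' z := by
  rw [greenSum, greenSum]
  refine congrArg _ (Finset.sum_congr rfl fun i hi => ?_)
  exact diskPotential_congr (fun _ _ => rfl) (hg i (Finset.mem_range.1 hi))

theorem mixedPotential_congr {R : ℝ} {M : ℕ} {A : ℂ → ℂ} {f f' : ℕ → ℂ → ℂ}
    (hf : ∀ i < M + 1, Set.EqOn (f i) (f' i) (ball 0 R)) (m : ℕ) (z : ℂ) :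
    mixedPotential R M A f (m + 1) z = mixedPotential R M A f' (m + 1) z := by
  have h : ∀ i < M + 1, Set.EqOn (fun z => conj (f i z)) (fun z => conj (f' i z)) (ball 0 R) :=
    fun i hi ζ hζ => congrArg conj (hf i hi hζ)
  simp only [mixedPotential]
  rw [diskPotential_congr (fun _ _ => rfl) (h 0 (by omega)),
    Finset.sum_congr rfl fun i hi => diskPotential_congr (fun _ _ => rfl) (h (i + 1) (by
      have := Finset.mem_range.1 hi
      omega))]

/-- Holomorphic functions that extend to the closed disk may be taken continuous there. -/
theorem exists_isContinuousHolomorphic {R : ℝ} {n : ℕ} {f : ℕ → ℂ → ℂ}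
    (hf : ∀ i < n, IsHolomorphicOfClass R (ExtendsToClosedDisk R) (f i)) :
    ∃ f' : ℕ → ℂ → ℂ, (∀ i < n, IsContinuousHolomorphic R (f' i)) ∧
      ∀ i < n, Set.EqOn (f i) (f' i) (ball 0 R) := by
  have h : ∀ i, ∃ w, i < n → IsContinuousHolomorphic R w ∧ Set.EqOn (f i) w (ball 0 R) := by
    intro i
    by_cases hi : i < n
    · obtain ⟨hd, w, hw, e⟩ := hf i hi
      exact ⟨w, fun _ => ⟨⟨hd.congr fun z hz => e hz, hw⟩, e.symm⟩⟩
    · exact ⟨0, fun h => absurd h hi⟩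
  choose f' hf' using h
  exact ⟨f', fun i hi => (hf' i hi).1, fun i hi => (hf' i hi).2⟩

/-- Both halves are `isClassicalSolution_iff`, for integrability over the disk and for continuous
extension to its closure. The second half also carries the formula to the boundary circle by
continuity. -/
theorem theorem4p1 (R : ℝ) (hR : 0 < R) (μ ν : ℕ) (hμ : 0 < μ) (hν : 0 < ν)
    (α : ℝ≥0) (hα : 0 < α) (hα1 : α < 1)
    (A : ℂ → ℂ) (hA : ∃ C : ℝ≥0, HolderOnWith C α A (closedBall 0 R)) :
    -- functions integrable over the disk, formula in the open disk
    ((∀ f g : ℕ → ℂ → ℂ,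
        (∀ i < μ, IsIntegrableHolomorphic R (f i)) →
        (∀ j < ν, IsIntegrableHolomorphic R (g j)) →
        ∀ z ∈ ball (0 : ℂ) R,
          IntegrableOn (greenIntegrand R μ ν A f g z) (closedBall 0 R)) ∧
      ∀ u : ℂ → ℂ,
        (IsClassicalSolution R μ ν A u ∧
            (∀ j < ν, IntegrableOn (wirtingerDbar^[j] u) (ball 0 R)) ∧
            (∀ i < μ, IntegrableOn (wirtingerD^[i] (wirtingerDbar^[ν] u)) (ball 0 R))) ↔
          ∃ f g : ℕ → ℂ → ℂ,
            (∀ i < μ, IsIntegrableHolomorphic R (f i)) ∧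
            (∀ j < ν, IsIntegrableHolomorphic R (g j)) ∧
            ∀ z ∈ ball (0 : ℂ) R,
              u z = g 0 z + diskIntegral R (greenIntegrand R μ ν A f g z)) ∧
    -- functions continuous up to the boundary, formula on the closed disk
    ((∀ f g : ℕ → ℂ → ℂ,
        (∀ i < μ, IsContinuousHolomorphic R (f i)) →
        (∀ j < ν, IsContinuousHolomorphic R (g j)) →
        ∀ z ∈ closedBall (0 : ℂ) R,
          IntegrableOn (greenIntegrand R μ ν A f g z) (closedBall 0 R)) ∧
      ∀ u : ℂ → ℂ,
        (IsClassicalSolution R μ ν A u ∧ ContinuousOn u (closedBall 0 R) ∧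
            (∀ j < ν, ExtendsToClosedDisk R (wirtingerDbar^[j] u)) ∧
            (∀ i < μ, ExtendsToClosedDisk R (wirtingerD^[i] (wirtingerDbar^[ν] u)))) ↔
          ∃ f g : ℕ → ℂ → ℂ,
            (∀ i < μ, IsContinuousHolomorphic R (f i)) ∧
            (∀ j < ν, IsContinuousHolomorphic R (g j)) ∧
            ∀ z ∈ closedBall (0 : ℂ) R,
              u z = g 0 z + diskIntegral R (greenIntegrand R μ ν A f g z)) := by
  obtain ⟨M, rfl⟩ : ∃ M, μ = M + 1 := ⟨μ - 1, by omega⟩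
  obtain ⟨N, rfl⟩ : ∃ N, ν = N + 1 := ⟨ν - 1, by omega⟩
  obtain ⟨C, hA⟩ := hA
  have hAc : ContinuousOn A (closedBall 0 R) := hA.continuousOn hα
  have hAa : IsAdmissible R A := hA.isAdmissible hα hα1.le
  have integrable_case : ∀ f g : ℕ → ℂ → ℂ,
      (∀ i < M + 1, IsIntegrableHolomorphic R (f i)) →
      (∀ j < N + 1, IsIntegrableHolomorphic R (g j)) → ∀ z ∈ ball (0 : ℂ) R,
      IntegrableOn (greenIntegrand R (M + 1) (N + 1) A f g z) (closedBall 0 R) ∧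
        diskIntegral R (greenIntegrand R (M + 1) (N + 1) A f g z) =
          greenSum R N (fun i => g (i + 1)) z + mixedPotential R M A f (N + 1) z := by
    intro f g hf hg z hz
    have h : ∀ k, IsIntegrableHolomorphic R k → IsAdmissible R k := fun k hk =>
      (isIntegrableHolomorphic_iff.1 hk).isAdmissible (isPotentialClass_integrableOn R)
    exact integrableOn_and_diskIntegral_greenIntegrand (fun j hj => (h _ (hg j hj)).hasWeakPotentials hz)
      (fun i hi => (h _ (hf i hi)).conj.hasWeakPotentials hz) (hAa.hasWeakPotentials hz)
  have continuous_case : ∀ f g : ℕ → ℂ → ℂ,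
      (∀ i < M + 1, IsContinuousHolomorphic R (f i)) →
      (∀ j < N + 1, IsContinuousHolomorphic R (g j)) → ∀ z ∈ closedBall (0 : ℂ) R,
      IntegrableOn (greenIntegrand R (M + 1) (N + 1) A f g z) (closedBall 0 R) ∧
        diskIntegral R (greenIntegrand R (M + 1) (N + 1) A f g z) =
          greenSum R N (fun i => g (i + 1)) z + mixedPotential R M A f (N + 1) z :=
    fun f g hf hg z hz =>
      integrableOn_and_diskIntegral_greenIntegrand (fun j hj => (hg j hj).2.hasWeakPotentials hz)
        (fun i hi => (hf i hi).2.complex_conj.hasWeakPotentials hz) (hAc.hasWeakPotentials hz)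
  have hcont : ∀ f g : ℕ → ℂ → ℂ,
      (∀ i < M + 1, IsContinuousHolomorphic R (f i)) →
      (∀ j < N + 1, IsContinuousHolomorphic R (g j)) →
      ContinuousOn (fun z => g 0 z + greenSum R N (fun i => g (i + 1)) z +
        mixedPotential R M A f (N + 1) z) (closedBall 0 R) := fun f g hf hg =>
    ((hg 0 (by omega)).2.add (continuousOn_greenSum fun i hi => (hg (i + 1) (by omega)).2)).add
      (continuousOn_mixedPotential hAc (fun i hi => (hf i hi).2) N)
  refine ⟨⟨fun f g hf hg z hz => (integrable_case f g hf hg z hz).1, fun u => ?_⟩,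
    fun f g hf hg z hz => (continuous_case f g hf hg z hz).1, fun u => ?_⟩
  · rw [isClassicalSolution_iff (isPotentialClass_integrableOn R) hAa
      (integrableOn_ball_iff.2 hAa.integrableOn)]
    simp only [← isIntegrableHolomorphic_iff]
    refine exists_congr fun f => exists_congr fun g => and_congr_right fun hf =>
      and_congr_right fun hg => forall₂_congr fun z hz => ?_
    rw [(integrable_case f g hf hg z hz).2, add_assoc]
  · have key := isClassicalSolution_iff (isPotentialClass_extends R) (M := M) (N := N) hAa
      ⟨A, hAc, fun _ _ => rfl⟩ u
    constructor
    · rintro ⟨hu, huc, hj, hi⟩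
      obtain ⟨f, g, hf, hg, hfg⟩ := key.1 ⟨hu, hj, hi⟩
      -- The data are replaced by their continuous extensions. Potentials do not see the change,
      -- since the boundary circle is a null set.
      obtain ⟨f', hf', ef⟩ := exists_isContinuousHolomorphic hf
      obtain ⟨g', hg', eg⟩ := exists_isContinuousHolomorphic hg
      refine ⟨f', g', hf', hg', fun z hz => ?_⟩
      rw [(continuous_case f' g' hf' hg' z hz).2, ← add_assoc]
      have e : Set.EqOn u (fun z => g' 0 z + greenSum R N (fun i => g' (i + 1)) z +
          mixedPotential R M A f' (N + 1) z) (ball 0 R) := fun w hw => by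
        rw [hfg w hw, eg 0 (by omega) hw, greenSum_congr (g' := fun i => g' (i + 1))
          (fun i hi => eg (i + 1) (by omega)) w, mixedPotential_congr ef N w]
      -- Both sides are continuous on the closed disk and agree on the dense open disk; density uses
      -- `R ≠ 0`.
      exact e.of_subset_closure huc (hcont f' g' hf' hg') ball_subset_closedBall
        (closure_ball (0 : ℂ) hR.ne').ge hz
    · rintro ⟨f, g, hf, hg, hfg⟩
      have hfg' : ∀ z ∈ closedBall (0 : ℂ) R, u z = g 0 z +
          greenSum R N (fun i => g (i + 1)) z + mixedPotential R M A f (N + 1) z :=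
        fun z hz => by rw [hfg z hz, (continuous_case f g hf hg z hz).2, add_assoc]
      obtain ⟨hu, hj, hi⟩ := key.2 ⟨f, g, fun i hi => (hf i hi).isHolomorphicOfClass,
        fun j hj => (hg j hj).isHolomorphicOfClass, fun z hz => hfg' z (ball_subset_closedBall hz)⟩
      exact ⟨hu, (hcont f g hf hg).congr hfg', hj, hi⟩
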